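/- **Setting.** Customers arrive in a Poisson process of rate $\lambda>0$ at a single-server system that holds at most $N\ge 1$ customers, including the one in service; a customer who finds $N$ customers present is lost. Service times are i.i.d. copies of $S\ge 0$. Whenever a departure leaves the system empty the server takes a vacation; if the system is still empty when a vacation ends, another vacation starts, otherwise the server serves until the system is empty again. Vacation lengths are i.i.d. copies of $V\ge 0$; arrivals, services and vacations are independent, $E[S]<\infty$ and $0<E[V]<\infty$. Let $P_{\mathrm{loss}}(N)$ be the steady-state probability that an arriving customer is lost, that is, $P_{\mathrm{loss}}(N)=\lim_{n\to\infty}\frac1n\sum_{i=1}^{n}\Pr(\text{the } i\text{-th arriving customer finds } N \text{ customers present})$ for the system that starts empty at the beginning of a vacation. Put $\rho=\lambda E[S]$. For $F\in\{S,V\}$ let $F^*(s)=E[e^{-sF}]$ (for real $s$ this is a number in $[0,\infty]$), and let $R_{F^*}\in[1,\infty]$ be the abscissa of the leftmost singularity of $z\mapsto F^*(\lambda-\lambda z)$, i.e. the supremum of the $x$ such that this function, given for $\operatorname{Re} z<1$, extends analytically to $\operatorname{Re} z<x$. For $\hat r>r$ and $0<\beta<\pi/2$ let $\Delta(r,\beta,\hat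 r)=\{z\in\mathbb C: |z|<\hat r,\ z\ne r,\ |\mathrm{Arg}(z-r)|>\beta\}$. **Theorem.** Assume that $\rho<1$ and that $r:=\min\{R_{S^*},R_{V^*}\}$ satisfies $1<r<\infty$. Then $P_{\mathrm{loss}}(N)$ exists for every $N\ge 1$, and the following hold. (i) Suppose that $r=R_{V^*}$ and $S^*(\lambda-\lambda r)<r$. Suppose that $V^*(\lambda-\lambda z)$ extends analytically to some domain $\Delta(r,\beta,\hat r)$ and that, for some constants $c$ and $\theta>0$, this extension satisfies $V^*(\lambda-\lambda z)\sim \dfrac{c}{(r-z)^{\theta}}$ as $z\to r$, $z\in\Delta(r,\beta,\hat r)$; if $\theta<1$, suppose in addition that $R_{V^*}<R_{S^*}$. Then $$\lim_{N\to\infty}N^{1-\theta}r^{N}P_{\mathrm{loss}}(N)=\frac{c\,(1-\rho)^2\,S^*(\lambda-\lambda r)}{r^{\theta-1}\,\Gamma(\theta)\,\lambda\,E[V]\,(r-1)\,[\,r-S^*(\lambda-\lambda r)\,]}.$$ (ii) Suppose that $r=R_{S^*}$ and $r<S^*(\lambda-\lambda r)\le\infty$. Then the equation $z=S^*(\lambda-\lambda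 z)$ has exactly one solution $z_1$ with $1<z_1<r$, and $$\lim_{N\to\infty}z_1^{N}P_{\mathrm{loss}}(N)=\frac{z_1(1-\rho)^2\,[\,1-V^*(\lambda-\lambda z_1)\,]}{\lambda\,E[V]\,(z_1-1)\,\bigl[\,1-\frac{d}{du}S^*(\lambda-\lambda u)\big|_{u=z_1}\bigr]}.$$ -/

import Mathlib

open MeasureTheory ProbabilityTheory Filter Topology Asymptotics

/-! ### The M/G/1/N queue with exhaustive service and multiple vacations -/

/-- The state of the system between two consecutive events (an event is an arrival, the end of a
service or the end of a vacation). -/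
structure QState where
  /-- number of customers present, including the one in service -/
  inSystem : ℕ
  /-- `true` while a customer is served, `false` while the server is on vacation -/
  serving : Bool
  /-- remaining length of the current service or vacation -/
  clock : ℝ
  /-- remaining time until the next arrival -/
  nextArrival : ℝ
  /-- number of customers (accepted or lost) that have arrived so far -/
  arrived : ℕ

/-- The effect of the next event in a system of capacity `N`; `a`, `s`, `v` are a fresh
interarrival time, service time and vacation time, of which those that are needed are used.

* If the next arrival comes before the end of the current service or vacation, then the arriving
  customer enters, or is lost if there are already `N` customers, and a new interarrival time
  starts.
* Otherwise the current service or vacation ends. At the end of a service one customer leaves. If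
  the system is now empty, a (new) vacation starts; if not, a service starts. -/
noncomputable def QState.step (N : ℕ) (q : QState) (a s v : ℝ) : QState :=
  if q.nextArrival < q.clock then
    { inSystem := min (q.inSystem + 1) N
      serving := q.serving
      clock := q.clock - q.nextArrival
      nextArrival := a
      arrived := q.arrived + 1 }
  else
    { inSystem := if q.serving then q.inSystem - 1 else q.inSystem
      serving := decide ((if q.serving then q.inSystem - 1 else q.inSystem) ≠ 0)
      clock := if (if q.serving then q.inSystem - 1 else q.inSystem) = 0 then v else s
      nextArrival := q.nextArrival - q.clock
      arrived := q.arrived }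

/-- The state after `k` events, driven by the interarrival times `A`, the service times `S` and
the vacation times `V`. At time `0` the system is empty and a vacation starts. Event number `k`
draws the fresh values it needs from `A k`, `S k`, `V k`. -/
noncomputable def queuePath (N : ℕ) (A S V : ℕ → ℝ) : ℕ → QState
  | 0 => { inSystem := 0, serving := false, clock := V 0, nextArrival := A 0, arrived := 0 }
  | k + 1 => (queuePath N A S V k).step N (A (k + 1)) (S (k + 1)) (V (k + 1))

/-- The `i`-th arriving customer (`i = 0, 1, …`) finds no free room, i.e. finds `N` customers. -/
def CustomerLost (N : ℕ) (A S V : ℕ → ℝ) (i : ℕ) : Prop :=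
  ∃ k, (queuePath N A S V k).arrived = i ∧
    (queuePath N A S V k).nextArrival < (queuePath N A S V k).clock ∧
    (queuePath N A S V k).inSystem = N

/-- `A`, `S`, `V` are independent i.i.d. sequences: exponential interarrival times with rate `lam`
(so that arrivals form a Poisson process), service times with law `σ`, vacations with law `υ`. -/
structure IsQueueInput {Ω : Type*} [MeasurableSpace Ω] (P : Measure Ω) (lam : ℝ)
    (σ υ : Measure ℝ) (A S V : ℕ → Ω → ℝ) : Prop where
  measurable_arrival : ∀ k, Measurable (A k)
  measurable_service : ∀ k, Measurable (S k)
  measurable_vacation : ∀ k, Measurable (V k)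
  law_arrival : ∀ k, P.map (A k) = expMeasure lam
  law_service : ∀ k, P.map (S k) = σ
  law_vacation : ∀ k, P.map (V k) = υ
  indep : iIndepFun (Sum.elim A (Sum.elim S V) : ℕ ⊕ ℕ ⊕ ℕ → Ω → ℝ) P

/-- `p` is the steady-state probability that an arriving customer finds no free room in the system
of capacity `N`: with `pᵢ` the probability that the `i`-th arriving customer is lost, the averages
`(p₀ + ⋯ + pₙ₋₁) / n` converge to `p`. (If `pᵢ` converges, then `p` is its limit.) -/
def IsLossProbability {Ω : Type*} [MeasurableSpace Ω] (P : Measure Ω) (A S V : ℕ → Ω → ℝ)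
    (N : ℕ) (p : ℝ) : Prop :=
  Tendsto
    (fun n : ℕ => (∑ i ∈ Finset.range n,
      P.real {ω | CustomerLost N (fun k => A k ω) (fun k => S k ω) (fun k => V k ω) i}) / (n : ℝ))
    atTop (𝓝 p)

/-! ### Laplace transforms and their singularities -/

/-- The Laplace transform `F^*(s) = ∫ e^{-s t} dF(t)` at complex `s`; only used for `0 < re s`,
where the integral converges. -/
noncomputable def lst (F : Measure ℝ) (s : ℂ) : ℂ := ∫ t, Complex.exp (-s * t) ∂F

/-- The Laplace transform `F^*(s) = ∫ e^{-s t} dF(t) ∈ [0, ∞]` at real `s`. -/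
noncomputable def realLst (F : Measure ℝ) (s : ℝ) : ENNReal :=
  ∫⁻ t, ENNReal.ofReal (Real.exp (-s * t)) ∂F

/-- The abscissa `R_{F^*} ∈ [1, ∞]` of the leftmost singularity of `z ↦ F^*(lam - lam z)`: the
largest `x` such that this function, given by its integral for `re z < 1`, extends analytically to
the half-plane `re z < x`. -/
noncomputable def leftmostSingularity (lam : ℝ) (F : Measure ℝ) : EReal :=
  sSup {x : EReal | ∃ g : ℂ → ℂ, DifferentiableOn ℂ g {z : ℂ | (z.re : EReal) < x} ∧
    ∀ z : ℂ, z.re < 1 → g z = lst F (lam - lam * z)}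

/-- The open domain `Δ(r, β, r̂)`. -/
def deltaDomain (r β rhat : ℝ) : Set ℂ :=
  {z : ℂ | ‖z‖ < rhat ∧ z ≠ (r : ℂ) ∧ β < |Complex.arg (z - r)|}

/-! ### Exponential interarrival times and Poisson counts -/

/-! A cycle runs from one start of a vacation to the next. Let M be the mean number of services in a
cycle of the system with capacity N. Per cycle M customers are served, in mean time E[V] + M E[S],
so a fraction M/(λE[V] + ρM) of the arrivals is served and P_loss(N) = 1 - M/(λE[V] + ρM).

This is proved without regeneration theory. The queue is stopped at the J-th arrival, and one-step
changes of four expectations are summed over the events: the number present, the indicator of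
service, the clock, and the mean number of services still to come in the cycle
(`lintegral_futureServices_succ`). Summed up, they express the expected number of losses among J
arrivals with an error o(J) (`abs_le_of_balance`, `abs_sum_loss_sub_le`). The Markov property that
is used is that the time to the next arrival stays exponential given the rest of the state
(`lintegral_stoppedQueue_resample`).

To compute M, let f and g generate the numbers of arrivals in a service and in a vacation, and put
T_f = (1 - f)/(1 - X), T_g = (1 - g)/(1 - X) and R = 1/(1 - T_f). The mean number of services that
lower the number present by one depends only on the free room i, and its generating function in i is
f/(f - X) = f R/(1 - X). Hence M is the sum of the coefficients y_k, k < N, of T_g f R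
(`isMeanServices_descentSeries`, `cycleServices_eq_sum`). All y_k together sum to λE[V]/(1 - ρ), so
P_loss(N) is (1 - ρ) times the tail of the y_k from k = N on, divided by λE[V] + ρM. Only the
asymptotics of y_k remain (`tendsto_loss_of_scaled`).

In (i), the singularity of g at r gives the asymptotics of its coefficients by singularity analysis
(`tendsto_scaled_of_isEquivalent`). They pass to the tails T_g, and convolution with f R, which
converges absolutely at r because f(r) < r, multiplies them by the value of f R at r. In (ii), z₁ is
the point beyond 1 where T_f = 1. Tilting the coefficients of T_f by z₁ gives a probability
distribution with an exponential moment, and the renewal theorem (`tendsto_coeff_renewal`) shows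
that z₁^k times the k-th coefficient of R converges. Now T_g f is the harmless factor. -/

lemma lintegral_expMeasure (lam : ℝ) (f : ℝ → ENNReal) (hf : Measurable f) :
    ∫⁻ x, f x ∂(expMeasure lam) = ∫⁻ x, exponentialPDF lam x * f x := by
  have hm : Measurable (exponentialPDF lam) := (measurable_exponentialPDFReal lam).ennreal_ofReal
  change ∫⁻ x, f x ∂(volume.withDensity (exponentialPDF lam)) = _
  rw [lintegral_withDensity_eq_lintegral_mul _ hm hf]
  rfl

/-- Translation by c multiplies the exponential density by e^{-λc}. This is memorylessness in the
form used when a phase of length c ends before the next arrival and the residual time is carried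
over. -/
lemma lintegral_expMeasure_memoryless {lam c : ℝ} (hc : 0 ≤ c)
    (H : ℝ → ENNReal) (hH : Measurable H) :
    ∫⁻ x, (if x < c then 0 else H (x - c)) ∂(expMeasure lam)
      = ENNReal.ofReal (Real.exp (-(lam * c))) * ∫⁻ x, H x ∂(expMeasure lam) := by
  have hm : Measurable (fun x : ℝ => if x < c then (0 : ENNReal) else H (x - c)) :=
    Measurable.ite measurableSet_Iio measurable_const (hH.comp (measurable_id.sub_const c))
  have hm2 : Measurable (exponentialPDF lam) := (measurable_exponentialPDFReal lam).ennreal_ofReal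
  rw [lintegral_expMeasure _ _ hm, lintegral_expMeasure _ _ hH,
    ← lintegral_add_right_eq_self _ c, ← lintegral_const_mul _ (by fun_prop : Measurable fun x => exponentialPDF lam x * H x)]
  refine lintegral_congr fun x => ?_
  by_cases hx : x < 0
  · rw [if_pos (by linarith), exponentialPDF_of_neg hx]; simp
  · push Not at hx
    rw [if_neg (by linarith), exponentialPDF_of_nonneg hx,
      exponentialPDF_of_nonneg (by linarith), add_sub_cancel_right, ← mul_assoc,
      ← ENNReal.ofReal_mul (Real.exp_pos _).le]
    congr 2
    rw [show -(lam * (x + c)) = -(lam * c) + -(lam * x) by ring, Real.exp_add]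
    ring

/-- The Poisson probability of `j` arrivals in time `t`. -/
noncomputable def poissonProb (lam : ℝ) (j : ℕ) (t : ℝ) : ℝ :=
  Real.exp (-(lam * t)) * (lam * t) ^ j / (j.factorial : ℝ)

lemma continuous_poissonProb (lam : ℝ) (j : ℕ) : Continuous (poissonProb lam j) := by
  unfold poissonProb; fun_prop

lemma poissonProb_nonneg {lam t : ℝ} (hlam : 0 < lam) (ht : 0 ≤ t) (j : ℕ) :
    0 ≤ poissonProb lam j t := by
  unfold poissonProb; positivity

lemma hasSum_poissonProb {lam t : ℝ} (hlam : 0 < lam) (ht : 0 ≤ t) :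
    HasSum (fun j => poissonProb lam j t) 1 :=
  hasSum_one_poissonMeasure ⟨lam * t, by positivity⟩

lemma poissonProb_le_one {lam t : ℝ} (hlam : 0 < lam) (ht : 0 ≤ t) (j : ℕ) :
    poissonProb lam j t ≤ 1 :=
  le_hasSum (hasSum_poissonProb hlam ht) j fun i _ => poissonProb_nonneg hlam ht i

lemma hasDerivAt_poissonProb_zero (lam t : ℝ) :
    HasDerivAt (poissonProb lam 0) (-(lam * poissonProb lam 0 t)) t := by
  have h1 : HasDerivAt (fun t => Real.exp (-(lam * t))) (Real.exp (-(lam * t)) * -(lam * 1)) t :=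
    ((hasDerivAt_id t).const_mul lam).neg.exp
  unfold poissonProb
  simp only [pow_zero, mul_one, Nat.factorial_zero, Nat.cast_one, div_one]
  exact h1.congr_deriv (by ring)

lemma hasDerivAt_poissonProb_succ (lam t : ℝ) (j : ℕ) :
    HasDerivAt (poissonProb lam (j + 1))
      (lam * (poissonProb lam j t - poissonProb lam (j + 1) t)) t := by
  have h1 : HasDerivAt (fun t => Real.exp (-(lam * t))) (Real.exp (-(lam * t)) * -(lam * 1)) t :=
    ((hasDerivAt_id t).const_mul lam).neg.exp
  have h2 : HasDerivAt (fun t => (lam * t) ^ (j + 1)) (((j + 1 : ℕ) : ℝ) * (lam * t) ^ j * (lam * 1)) t :=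
    ((hasDerivAt_id t).const_mul lam).pow (j + 1)
  have h3 := (h1.mul h2).div_const ((j + 1).factorial : ℝ)
  refine h3.congr_deriv ?_
  unfold poissonProb
  have : ((j + 1).factorial : ℝ) = (j + 1) * j.factorial := by
    rw [Nat.factorial_succ]; push_cast; ring
  rw [this]
  have : (j.factorial : ℝ) ≠ 0 := by positivity
  have : (j + 1 : ℝ) ≠ 0 := by positivity
  field_simp
  push_cast
  ring

/-- The mean of `u (min (n + K) N)`, where `K` is the number of arrivals in time `t`. -/
noncomputable def poissonAvg (lam : ℝ) (N : ℕ) (u : ℕ → ℝ) (n : ℕ) (t : ℝ) : ℝ :=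
  u N + ∑ j ∈ Finset.range (N - n), poissonProb lam j t * (u (n + j) - u N)

lemma continuous_poissonAvg (lam : ℝ) (N : ℕ) (u : ℕ → ℝ) (n : ℕ) :
    Continuous (poissonAvg lam N u n) := by
  unfold poissonAvg
  have := continuous_poissonProb lam
  fun_prop

lemma poissonAvg_zero (lam : ℝ) {N n : ℕ} (u : ℕ → ℝ) (hn : n ≤ N) :
    poissonAvg lam N u n 0 = u n := by
  unfold poissonAvg
  rcases hn.eq_or_lt with rfl | hn
  · simp
  · obtain ⟨k, hk⟩ : ∃ k, N - n = k + 1 := ⟨N - n - 1, by omega⟩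
    rw [hk, Finset.sum_range_succ']
    simp [poissonProb]

lemma poissonAvg_bounds {lam t C : ℝ} (hlam : 0 < lam) (ht : 0 ≤ t) {N : ℕ} {u : ℕ → ℝ}
    (hu : ∀ n ≤ N, 0 ≤ u n ∧ u n ≤ C) (n : ℕ) :
    0 ≤ poissonAvg lam N u n t ∧ poissonAvg lam N u n t ≤ C := by
  have h1 : ∑ j ∈ Finset.range (N - n), poissonProb lam j t ≤ 1 :=
    sum_le_hasSum _ (fun i _ => poissonProb_nonneg hlam ht i) (hasSum_poissonProb hlam ht)
  have h2 : poissonAvg lam N u n t = u N * (1 - ∑ j ∈ Finset.range (N - n), poissonProb lam j t)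
      + ∑ j ∈ Finset.range (N - n), poissonProb lam j t * u (n + j) := by
    unfold poissonAvg
    simp only [mul_sub, Finset.sum_sub_distrib, ← Finset.sum_mul]
    ring
  have h3 : ∑ j ∈ Finset.range (N - n), poissonProb lam j t * u (n + j)
      ≤ ∑ j ∈ Finset.range (N - n), poissonProb lam j t * C :=
    Finset.sum_le_sum fun j hj => mul_le_mul_of_nonneg_left
      (hu _ (by have := Finset.mem_range.1 hj; omega)).2 (poissonProb_nonneg hlam ht j)
  have h4 : 0 ≤ ∑ j ∈ Finset.range (N - n), poissonProb lam j t * u (n + j) :=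
    Finset.sum_nonneg fun j hj => mul_nonneg (poissonProb_nonneg hlam ht j)
      (hu _ (by have := Finset.mem_range.1 hj; omega)).1
  rw [← Finset.sum_mul] at h3
  have h5 := hu N le_rfl
  rw [h2]
  constructor
  · nlinarith [h5.1]
  · nlinarith [h5.2]

/-- Kolmogorov's backward equation for a Poisson process absorbed at N: an arrival lifts n by one,
and at n = N nothing changes any more. -/
lemma hasDerivAt_poissonAvg (lam t : ℝ) {N n : ℕ} (u : ℕ → ℝ) (hn : n ≤ N) :
    HasDerivAt (poissonAvg lam N u n)
      (lam * (poissonAvg lam N u (min (n + 1) N) t - poissonAvg lam N u n t)) t := by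
  rcases hn.eq_or_lt with rfl | hn
  · have : poissonAvg lam n u n = fun _ => u n := by
      funext t; simp [poissonAvg]
    simp only [this, min_eq_right (Nat.le_succ n), sub_self, mul_zero]
    exact hasDerivAt_const t _
  · obtain ⟨k, hk⟩ : ∃ k, N - n = k + 1 := ⟨N - n - 1, by omega⟩
    have hk' : N - (n + 1) = k := by omega
    rw [min_eq_left (by omega : n + 1 ≤ N)]
    have h : HasDerivAt (poissonAvg lam N u n)
        (∑ j ∈ Finset.range k, lam * (poissonProb lam j t - poissonProb lam (j + 1) t) *
          (u (n + (j + 1)) - u N) + -(lam * poissonProb lam 0 t) * (u (n + 0) - u N)) t := by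
      unfold poissonAvg
      rw [hk]
      simp only [Finset.sum_range_succ']
      exact ((HasDerivAt.fun_sum fun j _ =>
        (hasDerivAt_poissonProb_succ lam t j).mul_const _).add
          ((hasDerivAt_poissonProb_zero lam t).mul_const _)).const_add _
    refine h.congr_deriv ?_
    unfold poissonAvg
    rw [hk, hk', Finset.sum_range_succ']
    have e : ∀ j, u (n + (j + 1)) = u (n + 1 + j) := fun j => by rw [add_comm j 1, add_assoc]
    simp_rw [e]
    rw [show ∀ a b c d e : ℝ, lam * (a + b - (a + (c + d * e))) = lam * (b - c) - lam * (d * e) by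
      intros; ring, ← Finset.sum_sub_distrib, Finset.mul_sum]
    rw [Finset.sum_congr rfl fun j _ => show lam * (poissonProb lam j t - poissonProb lam (j + 1) t)
      * (u (n + 1 + j) - u N) = lam * (poissonProb lam j t * (u (n + 1 + j) - u N)
        - poissonProb lam (j + 1) t * (u (n + 1 + j) - u N)) by ring]
    ring

/-- Conditioning on the time x of the first arrival. By the backward equation the integrand on [0,
t) is the derivative of -e^{-λx} `poissonAvg` (t - x), so the integral is elementary. -/
lemma lintegral_poissonAvg {lam t C : ℝ} (hlam : 0 < lam) (ht : 0 ≤ t) {N n : ℕ} {u : ℕ → ℝ}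
    (hu : ∀ n ≤ N, 0 ≤ u n ∧ u n ≤ C) (hn : n ≤ N) :
    ∫⁻ x, (if x < t then ENNReal.ofReal (poissonAvg lam N u (min (n + 1) N) (t - x))
      else ENNReal.ofReal (u n)) ∂(expMeasure lam) = ENNReal.ofReal (poissonAvg lam N u n t) := by
  set Φ := poissonAvg lam N u (min (n + 1) N) with hΦ
  have hΦc : Continuous Φ := continuous_poissonAvg _ _ _ _
  have hmA : Measurable (fun x : ℝ => if x < t then ENNReal.ofReal (Φ (t - x)) else 0) :=
    Measurable.ite measurableSet_Iio (by fun_prop) measurable_const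
  have hsplit : ∀ x : ℝ, (if x < t then ENNReal.ofReal (Φ (t - x)) else ENNReal.ofReal (u n))
      = (if x < t then ENNReal.ofReal (Φ (t - x)) else 0)
        + (if x < t then 0 else ENNReal.ofReal (u n)) := by
    intro x; split_ifs <;> simp
  simp only [hsplit]
  have := isProbabilityMeasure_expMeasure hlam
  rw [lintegral_add_left hmA,
    lintegral_expMeasure_memoryless ht (fun _ => ENNReal.ofReal (u n)) measurable_const,
    lintegral_const, measure_univ, mul_one, lintegral_expMeasure _ _ hmA]
  have hder : ∀ x ∈ Set.uIcc 0 t, HasDerivAt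
      (fun x => -(Real.exp (-(lam * x)) * poissonAvg lam N u n (t - x)))
      (lam * Real.exp (-(lam * x)) * Φ (t - x)) x := by
    intro x _
    have h1 : HasDerivAt (fun t => Real.exp (-(lam * t))) (Real.exp (-(lam * x)) * -(lam * 1)) x :=
      ((hasDerivAt_id x).const_mul lam).neg.exp
    have h2 := HasDerivAt.comp_const_sub t x (hasDerivAt_poissonAvg lam (t - x) u hn)
    refine (h1.mul h2).neg.congr_deriv ?_
    rw [← hΦ]; ring
  have hint := intervalIntegral.integral_eq_sub_of_hasDerivAt hder
    (Continuous.intervalIntegrable (by fun_prop) _ _)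
  simp only [sub_self, poissonAvg_zero lam u hn, mul_zero, neg_zero, Real.exp_zero, one_mul,
    sub_zero, sub_neg_eq_add] at hint
  have hA : ∫⁻ x, exponentialPDF lam x * (if x < t then ENNReal.ofReal (Φ (t - x)) else 0)
      = ENNReal.ofReal (∫ x in (0 : ℝ)..t, lam * Real.exp (-(lam * x)) * Φ (t - x)) := by
    rw [intervalIntegral.integral_of_le ht, ← integral_Ico_eq_integral_Ioc,
      ofReal_integral_eq_lintegral_ofReal, ← lintegral_indicator measurableSet_Ico]
    · refine lintegral_congr fun x => ?_
      by_cases hx : x ∈ Set.Ico 0 t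
      · rw [Set.indicator_of_mem hx, if_pos hx.2, exponentialPDF_of_nonneg hx.1,
          ← ENNReal.ofReal_mul (by positivity)]
      · rw [Set.indicator_of_notMem hx]
        by_cases h0 : x < 0
        · rw [exponentialPDF_of_neg h0, zero_mul]
        · rw [if_neg (fun h => hx ⟨not_lt.1 h0, h⟩), mul_zero]
    · exact (Continuous.integrableOn_Icc (by fun_prop)).mono_set Set.Ico_subset_Icc_self
    · refine (ae_restrict_iff' measurableSet_Ico).2 (ae_of_all _ fun x hx => ?_)
      have := (poissonAvg_bounds hlam (by linarith [hx.2] : (0 : ℝ) ≤ t - x) hu (min (n + 1) N)).1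
      simp only [Pi.zero_apply]
      positivity
  rw [hA, hint, ← ENNReal.ofReal_mul (Real.exp_pos _).le, ← ENNReal.ofReal_add]
  · congr 1; ring
  · rw [← hint]
    refine intervalIntegral.integral_nonneg ht fun x hx => ?_
    have := (poissonAvg_bounds hlam (by linarith [hx.2] : (0 : ℝ) ≤ t - x) hu (min (n + 1) N)).1
    positivity
  · exact mul_nonneg (Real.exp_pos _).le (hu n hn).1

/-! ### The queue stopped at the `J`-th arrival -/

instance : MeasurableSpace QState :=
  MeasurableSpace.comap
    (fun q => (q.inSystem, q.serving, q.clock, q.nextArrival, q.arrived)) inferInstance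

namespace QState

lemma measurable_toTuple : Measurable
    (fun q : QState => (q.inSystem, q.serving, q.clock, q.nextArrival, q.arrived)) :=
  comap_measurable _

@[fun_prop] lemma measurable_inSystem : Measurable QState.inSystem := measurable_toTuple.fst
@[fun_prop] lemma measurable_serving : Measurable QState.serving := measurable_toTuple.snd.fst
@[fun_prop] lemma measurable_clock : Measurable QState.clock := measurable_toTuple.snd.snd.fst
@[fun_prop] lemma measurable_nextArrival : Measurable QState.nextArrival :=
  measurable_toTuple.snd.snd.snd.fst
@[fun_prop] lemma measurable_arrived : Measurable QState.arrived :=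
  measurable_toTuple.snd.snd.snd.snd

lemma measurable_mk {α : Type*} [MeasurableSpace α] {n : α → ℕ} {s : α → Bool} {c x : α → ℝ}
    {j : α → ℕ} (hn : Measurable n) (hs : Measurable s) (hc : Measurable c) (hx : Measurable x)
    (hj : Measurable j) : Measurable (fun a => QState.mk (n a) (s a) (c a) (x a) (j a)) :=
  measurable_comap_iff.2 (hn.prodMk (hs.prodMk (hc.prodMk (hx.prodMk hj))))

/-- The number of customers present if the current service or vacation ends now. -/
def after (q : QState) : ℕ := if q.serving then q.inSystem - 1 else q.inSystem

@[fun_prop] lemma measurable_after : Measurable QState.after := by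
  unfold after
  exact Measurable.ite (measurable_serving (measurableSet_singleton true))
    ((measurable_of_countable (fun n : ℕ => n - 1)).comp measurable_inSystem) measurable_inSystem

/-- Replace the time until the next arrival. -/
def withNext (q : QState) (a : ℝ) : QState := { q with nextArrival := a }

lemma measurable_withNext : Measurable (fun p : QState × ℝ => p.1.withNext p.2) :=
  measurable_mk (by fun_prop) (by fun_prop) (by fun_prop) (by fun_prop) (by fun_prop)

/-- The effect of the next event in the queue that is stopped at the `J`-th arrival. -/
noncomputable def stoppedStep (N J : ℕ) (q : QState) (w : ℝ × ℝ × ℝ) : QState :=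
  if q.arrived < J then q.step N w.1 w.2.1 w.2.2 else q

lemma measurableSet_arrival : MeasurableSet {q : QState | q.nextArrival < q.clock} :=
  measurableSet_lt measurable_nextArrival measurable_clock

lemma step_of_lt {N : ℕ} {q : QState} {a s v : ℝ} (h : q.nextArrival < q.clock) :
    q.step N a s v = ⟨min (q.inSystem + 1) N, q.serving, q.clock - q.nextArrival, a,
      q.arrived + 1⟩ := by
  rw [step, if_pos h]

lemma step_of_not_lt {N : ℕ} {q : QState} {a s v : ℝ} (h : ¬ q.nextArrival < q.clock) :
    q.step N a s v = ⟨q.after, decide (q.after ≠ 0), if q.after = 0 then v else s,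
      q.nextArrival - q.clock, q.arrived⟩ := by
  rw [step, if_neg h]; rfl

lemma measurable_stoppedStep (N J : ℕ) :
    Measurable (fun p : QState × ℝ × ℝ × ℝ => p.1.stoppedStep N J p.2) := by
  unfold stoppedStep
  have h1 : MeasurableSet {p : QState × ℝ × ℝ × ℝ | p.1.arrived < J} :=
    measurableSet_lt (by fun_prop) measurable_const
  have h2 : MeasurableSet {p : QState × ℝ × ℝ × ℝ | p.1.nextArrival < p.1.clock} :=
    measurableSet_lt (by fun_prop) (by fun_prop)
  have h3 : MeasurableSet {p : QState × ℝ × ℝ × ℝ | p.1.after = 0} :=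
    measurableSet_eq_fun (by fun_prop) measurable_const
  have hfst : Measurable (fun p : QState × ℝ × ℝ × ℝ => p.1) := measurable_fst
  refine Measurable.ite h1 ?_ measurable_fst
  unfold step
  refine Measurable.ite h2 ?_ ?_
  · refine measurable_mk ?_ (by fun_prop) (by fun_prop) (by fun_prop) ?_
    · exact (measurable_of_countable (fun n : ℕ => min (n + 1) N)).comp
        (measurable_inSystem.comp hfst)
    · exact (measurable_of_countable (fun n : ℕ => n + 1)).comp (measurable_arrived.comp hfst)
  · refine measurable_mk (measurable_after.comp hfst) ?_ (Measurable.ite h3 (by fun_prop)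
      (by fun_prop)) (by fun_prop) (by fun_prop)
    exact (measurable_of_countable (fun n : ℕ => decide (n ≠ 0))).comp (measurable_after.comp hfst)

end QState

/-- The path of the queue stopped at the `J`-th arrival. -/
noncomputable def stoppedPath (N J : ℕ) (A S V : ℕ → ℝ) : ℕ → QState
  | 0 => { inSystem := 0, serving := false, clock := V 0, nextArrival := A 0, arrived := 0 }
  | k + 1 => (stoppedPath N J A S V k).stoppedStep N J (A (k + 1), S (k + 1), V (k + 1))

/-- Arrival counts never decrease and the stopped path freezes once it has counted J arrivals. So if
either path is still below J at time k, both have taken the same steps up to k. -/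
lemma stoppedPath_eq_queuePath {N J : ℕ} {A S V : ℕ → ℝ} (k : ℕ)
    (h : (queuePath N A S V k).arrived < J ∨ (stoppedPath N J A S V k).arrived < J) :
    stoppedPath N J A S V k = queuePath N A S V k := by
  induction k with
  | zero => rfl
  | succ k ih =>
    have hmono : ∀ (q : QState) (a s v : ℝ), q.arrived ≤ (q.step N a s v).arrived := by
      intro q a s v; unfold QState.step; split_ifs <;> simp
    have h' : (queuePath N A S V k).arrived < J ∨ (stoppedPath N J A S V k).arrived < J := by
      rcases h with h | h
      · exact Or.inl ((hmono _ _ _ _).trans_lt h)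
      · right
        by_contra h2
        have : stoppedPath N J A S V (k + 1) = stoppedPath N J A S V k := by
          rw [stoppedPath, QState.stoppedStep, if_neg h2]
        exact h2 (this ▸ h)
    have e := ih h'
    have hlt : (stoppedPath N J A S V k).arrived < J := by
      rcases h' with h' | h'
      · rw [e]; exact h'
      · exact h'
    rw [stoppedPath, QState.stoppedStep, if_pos hlt, e]; rfl

lemma stoppedPath_arrived_le {N J : ℕ} {A S V : ℕ → ℝ} (k : ℕ) :
    (stoppedPath N J A S V k).arrived ≤ J := by
  induction k with
  | zero => exact Nat.zero_le _
  | succ k ih =>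
    rw [stoppedPath, QState.stoppedStep]
    split_ifs with h
    · unfold QState.step; split_ifs <;> simp <;> omega
    · exact ih

/-- The number of customers stays at most `N`, and the server only serves if there are some. -/
lemma stoppedPath_inSystem {N J : ℕ} (hN : 1 ≤ N) {A S V : ℕ → ℝ} (k : ℕ) :
    (stoppedPath N J A S V k).inSystem ≤ N ∧
      ((stoppedPath N J A S V k).serving = true → 1 ≤ (stoppedPath N J A S V k).inSystem) := by
  induction k with
  | zero => simp [stoppedPath]
  | succ k ih =>
    rw [stoppedPath, QState.stoppedStep]
    set q := stoppedPath N J A S V k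
    split_ifs with h
    · by_cases hx : q.nextArrival < q.clock
      · rw [QState.step_of_lt hx]
        simp only [min_le_iff, le_refl, or_true, true_and, le_min_iff]
        intro _; omega
      · rw [QState.step_of_not_lt hx]
        have : q.after ≤ q.inSystem := by unfold QState.after; split_ifs <;> omega
        simp only [decide_eq_true_eq]
        omega
    · exact ih

/-! ### Independence of fresh inputs and the Markov property -/

section Law

variable {Ω : Type*} [MeasurableSpace Ω] {P : Measure Ω} [IsProbabilityMeasure P] {lam : ℝ}
  {σ υ : Measure ℝ} {A S V : ℕ → Ω → ℝ} (N J : ℕ)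

set_option linter.unusedSectionVars false

/-- The stopped queue as a random process. -/
noncomputable def stoppedQueue (A S V : ℕ → Ω → ℝ) (k : ℕ) (ω : Ω) : QState :=
  stoppedPath N J (fun k => A k ω) (fun k => S k ω) (fun k => V k ω) k

lemma stoppedQueue_zero (ω : Ω) : stoppedQueue N J A S V 0 ω = ⟨0, false, V 0 ω, A 0 ω, 0⟩ := rfl

lemma stoppedQueue_succ (k : ℕ) (ω : Ω) : stoppedQueue N J A S V (k + 1) ω =
    (stoppedQueue N J A S V k ω).stoppedStep N J (A (k + 1) ω, S (k + 1) ω, V (k + 1) ω) := rfl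

/-- The σ-algebra m is arbitrary: the ambient one gives measurability, the one generated by the
inputs up to index k gives adaptedness. -/
lemma measurable_stoppedQueue_of {m : MeasurableSpace Ω} (k : ℕ)
    (hA : ∀ i ≤ k, Measurable[m] (A i)) (hS : ∀ i ≤ k, Measurable[m] (S i))
    (hV : ∀ i ≤ k, Measurable[m] (V i)) : Measurable[m] (stoppedQueue N J A S V k) := by
  induction k with
  | zero =>
    exact QState.measurable_mk measurable_const measurable_const (hV 0 le_rfl) (hA 0 le_rfl)
      measurable_const
  | succ k ih =>
    have h := ih (fun i hi => hA i (by omega)) (fun i hi => hS i (by omega))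
      (fun i hi => hV i (by omega))
    exact (QState.measurable_stoppedStep N J).comp (h.prodMk ((hA _ le_rfl).prodMk
      ((hS _ le_rfl).prodMk (hV _ le_rfl))))

lemma measurable_stoppedQueue (hin : IsQueueInput P lam σ υ A S V) (k : ℕ) :
    Measurable (stoppedQueue N J A S V k) :=
  measurable_stoppedQueue_of N J k (fun i _ => hin.measurable_arrival i)
    (fun i _ => hin.measurable_service i) (fun i _ => hin.measurable_vacation i)

/-- The state after k events is a function of the inputs with index at most k, and the jointly
independent family is split by index. -/
lemma indepFun_stoppedQueue (hin : IsQueueInput P lam σ υ A S V) (k : ℕ) :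
    IndepFun (stoppedQueue N J A S V k)
      (fun ω => (A (k + 1) ω, S (k + 1) ω, V (k + 1) ω)) P := by
  set f : ℕ ⊕ ℕ ⊕ ℕ → Ω → ℝ := Sum.elim A (Sum.elim S V)
  have hf : ∀ i, Measurable (f i) := by
    rintro (i | i | i)
    exacts [hin.measurable_arrival i, hin.measurable_service i, hin.measurable_vacation i]
  let time : ℕ ⊕ ℕ ⊕ ℕ → ℕ := Sum.elim id (Sum.elim id id)
  have hd : Disjoint {i | time i ≤ k} {i | time i = k + 1} := by
    rw [Set.disjoint_left]; intro i hi hi'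
    rw [Set.mem_ofPred_eq] at hi hi'; omega
  have h := indep_iSup_of_disjoint (fun i => (hf i).comap_le) hin.indep hd
  have hm : ∀ (T : Set (ℕ ⊕ ℕ ⊕ ℕ)) (i), i ∈ T →
      Measurable[⨆ i ∈ T, MeasurableSpace.comap (f i) inferInstance] (f i) := fun T i hi =>
    (comap_measurable (f i)).mono (le_iSup₂ (f := fun i (_ : i ∈ T) =>
      MeasurableSpace.comap (f i) inferInstance) i hi) le_rfl
  refine indep_of_indep_of_le_left (indep_of_indep_of_le_right h ?_) ?_
  · refine Measurable.comap_le ?_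
    exact (hm {i | time i = k + 1} (Sum.inl (k + 1)) rfl).prodMk
      ((hm {i | time i = k + 1} (Sum.inr (Sum.inl (k + 1))) rfl).prodMk
        (hm {i | time i = k + 1} (Sum.inr (Sum.inr (k + 1))) rfl))
  · refine Measurable.comap_le ?_
    exact measurable_stoppedQueue_of N J k (fun i hi => hm {i | time i ≤ k} (Sum.inl i) hi)
      (fun i hi => hm {i | time i ≤ k} (Sum.inr (Sum.inl i)) hi)
      (fun i hi => hm {i | time i ≤ k} (Sum.inr (Sum.inr i)) hi)

lemma IsQueueInput.measurable_input (hin : IsQueueInput P lam σ υ A S V) (k : ℕ) :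
    Measurable (fun ω => (A k ω, S k ω, V k ω)) :=
  (hin.measurable_arrival k).prodMk
    ((hin.measurable_service k).prodMk (hin.measurable_vacation k))

lemma lintegral_stoppedQueue_prod (hin : IsQueueInput P lam σ υ A S V) (k : ℕ)
    (F : QState × ℝ × ℝ × ℝ → ENNReal) (hF : Measurable F) :
    ∫⁻ ω, F (stoppedQueue N J A S V k ω, A (k + 1) ω, S (k + 1) ω, V (k + 1) ω) ∂P =
      ∫⁻ ω, ∫⁻ w, F (stoppedQueue N J A S V k ω, w)
        ∂(P.map fun ω => (A (k + 1) ω, S (k + 1) ω, V (k + 1) ω)) ∂P := by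
  have h1 := measurable_stoppedQueue N J hin k
  have h2 := hin.measurable_input (k + 1)
  have hi := (indepFun_iff_map_prod_eq_prod_map_map h1.aemeasurable h2.aemeasurable).1
    (indepFun_stoppedQueue N J hin k)
  have := Measure.isProbabilityMeasure_map (μ := P) h2.aemeasurable
  rw [← lintegral_map (f := F) hF (h1.prodMk h2), hi, lintegral_prod _ hF.aemeasurable,
    lintegral_map hF.lintegral_prod_right' h1]

lemma stoppedQueue_clock_nonneg (hin : IsQueueInput P lam σ υ A S V) (hσ : σ (Set.Iio 0) = 0)
    (hυ : υ (Set.Iio 0) = 0) (k : ℕ) : ∀ᵐ ω ∂P, 0 ≤ (stoppedQueue N J A S V k ω).clock := by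
  have hS : ∀ i, ∀ᵐ ω ∂P, 0 ≤ S i ω := fun i => by
    have : ∀ᵐ s ∂(P.map (S i)), 0 ≤ s := by
      rw [hin.law_service, ae_iff]; simp only [not_le]; exact hσ
    exact ae_of_ae_map (hin.measurable_service i).aemeasurable this
  have hV : ∀ i, ∀ᵐ ω ∂P, 0 ≤ V i ω := fun i => by
    have : ∀ᵐ s ∂(P.map (V i)), 0 ≤ s := by
      rw [hin.law_vacation, ae_iff]; simp only [not_le]; exact hυ
    exact ae_of_ae_map (hin.measurable_vacation i).aemeasurable this
  induction k with
  | zero => exact hV 0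
  | succ k ih =>
    filter_upwards [ih, hS (k + 1), hV (k + 1)] with ω h1 h2 h3
    rw [stoppedQueue_succ, QState.stoppedStep]
    set q := stoppedQueue N J A S V k ω
    split_ifs with h
    · by_cases hx : q.nextArrival < q.clock
      · rw [QState.step_of_lt hx]; simp only; linarith
      · rw [QState.step_of_not_lt hx]; simp only; split_ifs <;> assumption
    · exact h1

/-- Given the rest of the state, the time until the next arrival is exponential. -/
lemma lintegral_stoppedQueue_resample (hin : IsQueueInput P lam σ υ A S V) (hlam : 0 < lam)
    (hσ : σ (Set.Iio 0) = 0) (hυ : υ (Set.Iio 0) = 0) (k : ℕ) (F : QState → ENNReal)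
    (hF : Measurable F) :
    ∫⁻ ω, F (stoppedQueue N J A S V k ω) ∂P =
      ∫⁻ ω, ∫⁻ a, F ((stoppedQueue N J A S V k ω).withNext a) ∂(expMeasure lam) ∂P := by
  have hE := isProbabilityMeasure_expMeasure hlam
  have hR : ∀ F : QState → ENNReal, Measurable F →
      Measurable (fun q : QState => ∫⁻ a, F (q.withNext a) ∂(expMeasure lam)) := fun F hF =>
    (hF.comp QState.measurable_withNext).lintegral_prod_right'
  induction k generalizing F with
  | zero =>
    have hA := hin.measurable_arrival 0
    have hV := hin.measurable_vacation 0
    have hi : IndepFun (V 0) (A 0) P :=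
      hin.indep.indepFun (i := Sum.inr (Sum.inr 0)) (j := Sum.inl 0) (by simp)
    have hi' := (indepFun_iff_map_prod_eq_prod_map_map hV.aemeasurable hA.aemeasurable).1 hi
    have hG : Measurable (fun p : ℝ × ℝ => F ⟨0, false, p.1, p.2, 0⟩) :=
      hF.comp (QState.measurable_mk measurable_const measurable_const measurable_fst
        measurable_snd measurable_const)
    have := Measure.isProbabilityMeasure_map (μ := P) hA.aemeasurable
    have := Measure.isProbabilityMeasure_map (μ := P) hV.aemeasurable
    have e := lintegral_map (μ := P) hG (hV.prodMk hA)
    rw [hi', lintegral_prod _ hG.aemeasurable, lintegral_map hG.lintegral_prod_right' hV,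
      hin.law_arrival] at e
    exact e.symm
  | succ k ih =>
    set τ := P.map fun ω => (A (k + 1) ω, S (k + 1) ω, V (k + 1) ω) with hτ
    have hmi := hin.measurable_input (k + 1)
    have hτp : IsProbabilityMeasure τ := Measure.isProbabilityMeasure_map hmi.aemeasurable
    have hτA : ∀ f : ℝ → ENNReal, Measurable f → ∫⁻ w, f w.1 ∂τ = ∫⁻ a, f a ∂(expMeasure lam) := by
      intro f hf
      rw [hτ, lintegral_map (f := fun w : ℝ × ℝ × ℝ => f w.1) (hf.comp measurable_fst) hmi, ← hin.law_arrival (k + 1),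
        lintegral_map hf (hin.measurable_arrival _)]
    have hK : ∀ F : QState → ENNReal, Measurable F →
        Measurable (fun q : QState => ∫⁻ w, F (q.stoppedStep N J w) ∂τ) := fun F hF =>
      (hF.comp (QState.measurable_stoppedStep N J)).lintegral_prod_right'
    -- The induction hypothesis is applied to q ↦ ∫ F(next state), so that the time to the next
    -- arrival before the step may be taken as a fresh exponential a.
    have hstep : ∀ F : QState → ENNReal, Measurable F →
        ∫⁻ ω, F (stoppedQueue N J A S V (k + 1) ω) ∂P =
          ∫⁻ ω, ∫⁻ a, ∫⁻ w, F (((stoppedQueue N J A S V k ω).withNext a).stoppedStep N J w) ∂τ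
            ∂(expMeasure lam) ∂P := by
      intro F hF
      rw [← ih _ (hK F hF)]
      exact lintegral_stoppedQueue_prod N J hin k (fun p => F (p.1.stoppedStep N J p.2))
        (hF.comp (QState.measurable_stoppedStep N J))
    rw [hstep F hF, hstep _ (hR F hF)]
    refine lintegral_congr_ae ?_
    filter_upwards [stoppedQueue_clock_nonneg N J hin hσ hυ k] with ω hc
    set q := stoppedQueue N J A S V k ω
    by_cases hj : q.arrived < J
    · have hsp : ∀ (F : QState → ENNReal) (a : ℝ), Measurable F →
          ∫⁻ w, F ((q.withNext a).stoppedStep N J w) ∂τ =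
          (if a < q.clock then ∫⁻ b, F ⟨min (q.inSystem + 1) N, q.serving, q.clock - a, b,
            q.arrived + 1⟩ ∂(expMeasure lam) else 0) +
          (if a < q.clock then 0 else ∫⁻ w, F ⟨q.after, decide (q.after ≠ 0),
            if q.after = 0 then w.2.2 else w.2.1, a - q.clock, q.arrived⟩ ∂τ) := by
        intro F a hF
        have hq : (q.withNext a).arrived < J := hj
        simp only [QState.stoppedStep, if_pos hq]
        by_cases hx : a < q.clock
        · rw [if_pos hx, if_pos hx, add_zero, ← hτA (fun b => F ⟨min (q.inSystem + 1) N,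
            q.serving, q.clock - a, b, q.arrived + 1⟩) (hF.comp (QState.measurable_mk
              measurable_const measurable_const measurable_const measurable_id measurable_const))]
          refine lintegral_congr fun w => ?_
          rw [QState.step_of_lt (show (q.withNext a).nextArrival < (q.withNext a).clock from hx)]
          rfl
        · rw [if_neg hx, if_neg hx, zero_add]
          refine lintegral_congr fun w => ?_
          rw [QState.step_of_not_lt
            (show ¬ (q.withNext a).nextArrival < (q.withNext a).clock from hx)]
          rfl
      have hm1 : ∀ F : QState → ENNReal, Measurable F → Measurable (fun a : ℝ =>
          if a < q.clock then ∫⁻ b, F ⟨min (q.inSystem + 1) N, q.serving, q.clock - a, b,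
            q.arrived + 1⟩ ∂(expMeasure lam) else 0) := by
        intro F hF
        refine Measurable.ite measurableSet_Iio ?_ measurable_const
        exact Measurable.lintegral_prod_right' (f := fun p : ℝ × ℝ =>
          F ⟨min (q.inSystem + 1) N, q.serving, q.clock - p.1, p.2, q.arrived + 1⟩)
          (hF.comp (QState.measurable_mk measurable_const measurable_const (by fun_prop)
            measurable_snd measurable_const))
      have hmH : ∀ F : QState → ENNReal, Measurable F → Measurable (fun p : ℝ × ℝ × ℝ × ℝ =>
          F ⟨q.after, decide (q.after ≠ 0),
            if q.after = 0 then p.2.2.2 else p.2.2.1, p.1, q.arrived⟩) := by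
        intro F hF
        refine hF.comp (QState.measurable_mk measurable_const measurable_const ?_
          measurable_fst measurable_const)
        split_ifs <;> fun_prop
      -- If a is below the clock, the new interarrival time b is fresh; otherwise the residual time
      -- a - clock is exponential by memorylessness. Either way F is averaged over an independent
      -- exponential time, so resampling once more changes nothing.
      have hfin : ∀ F : QState → ENNReal, Measurable F →
          ∫⁻ a, ∫⁻ w, F ((q.withNext a).stoppedStep N J w) ∂τ ∂(expMeasure lam) =
          ∫⁻ a, (if a < q.clock then ∫⁻ b, F ⟨min (q.inSystem + 1) N, q.serving, q.clock - a, b,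
            q.arrived + 1⟩ ∂(expMeasure lam) else 0) ∂(expMeasure lam) +
          ENNReal.ofReal (Real.exp (-(lam * q.clock))) * ∫⁻ w, ∫⁻ a, F ⟨q.after,
            decide (q.after ≠ 0), if q.after = 0 then w.2.2 else w.2.1, a, q.arrived⟩
            ∂(expMeasure lam) ∂τ := by
        intro F hF
        rw [lintegral_congr fun a => hsp F a hF, lintegral_add_left (hm1 F hF),
          lintegral_expMeasure_memoryless hc (fun a => ∫⁻ w, F ⟨q.after, decide (q.after ≠ 0),
            if q.after = 0 then w.2.2 else w.2.1, a, q.arrived⟩ ∂τ)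
            (hmH F hF).lintegral_prod_right',
          lintegral_lintegral_swap (hmH F hF).aemeasurable]
      rw [hfin F hF, hfin _ (hR F hF)]
      simp only [QState.withNext, lintegral_const, measure_univ, mul_one]
    · have h1 : ∀ a w, (q.withNext a).stoppedStep N J w = q.withNext a := fun a w => by
        rw [QState.stoppedStep, if_neg]; exact hj
      have h2 : ∀ a b, (q.withNext a).withNext b = q.withNext b := fun _ _ => rfl
      simp only [h1, h2, lintegral_const, measure_univ, mul_one]

end Law

lemma MeasureTheory.Integrable.fun_sub' {α : Type*} {m : MeasurableSpace α} {μ : Measure α}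
    {f g : α → ℝ} (hf : Integrable f μ) (hg : Integrable g μ) :
    Integrable (fun x => f x - g x) μ := hf.sub hg

/-! ### Expected changes of the stopped queue in one step -/

lemma integral_expMeasure_id {lam : ℝ} (hlam : 0 < lam) :
    Integrable (fun x : ℝ => x) (expMeasure lam) ∧ ∫ x, x ∂(expMeasure lam) = 1 / lam := by
  have hm2 : Measurable (exponentialPDF lam) := (measurable_exponentialPDFReal lam).ennreal_ofReal
  have h1 : ∀ x ∈ Set.Ioi (0 : ℝ), x ^ ((2 : ℝ) - 1) * Real.exp (-(lam * x)) =
      (1 / lam) * ((exponentialPDF lam x).toReal * x) := by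
    intro x hx
    rw [exponentialPDF_of_nonneg (le_of_lt hx), ENNReal.toReal_ofReal (by positivity)]
    norm_num
    field_simp
  have h2 := Real.integral_rpow_mul_exp_neg_mul_Ioi (a := 2) (by norm_num) hlam
  -- A non-integrable function has Bochner integral 0, whereas the Gamma integral is positive.
  have h3 : IntegrableOn (fun x : ℝ => x ^ ((2 : ℝ) - 1) * Real.exp (-(lam * x))) (Set.Ioi 0) := by
    by_contra h
    rw [integral_undef h] at h2
    have : (1 / lam) ^ (2 : ℝ) * Real.Gamma 2 > 0 :=
      mul_pos (Real.rpow_pos_of_pos (by positivity) _) (Real.Gamma_pos_of_pos (by norm_num))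
    linarith
  rw [setIntegral_congr_fun measurableSet_Ioi h1, integral_const_mul] at h2
  rw [integrableOn_congr_fun h1 measurableSet_Ioi] at h3
  have h4 : ∀ x ∉ Set.Ioi (0 : ℝ), (exponentialPDF lam x).toReal * x = 0 := by
    intro x hx
    rcases (not_lt.1 (fun h => hx h) : x ≤ 0).lt_or_eq with h | h
    · rw [exponentialPDF_of_neg h]; simp
    · rw [h]; simp
  have h5 : IntegrableOn (fun x : ℝ => (exponentialPDF lam x).toReal * x) (Set.Ioi 0) := by
    refine (h3.const_mul lam).congr (ae_of_all _ fun x => ?_)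
    field_simp
  have h6 : Integrable (fun x : ℝ => (exponentialPDF lam x).toReal * x) := by
    rw [← integrableOn_univ]
    exact h5.of_forall_sdiff_eq_zero MeasurableSet.univ fun x hx => h4 x hx.2
  have hlt : ∀ᵐ x : ℝ, exponentialPDF lam x < ⊤ := ae_of_all _ fun x => ENNReal.ofReal_lt_top
  change Integrable (fun x : ℝ => x) (volume.withDensity (exponentialPDF lam)) ∧
    ∫ x, x ∂(volume.withDensity (exponentialPDF lam)) = 1 / lam
  constructor
  · rw [integrable_withDensity_iff_integrable_smul' hm2 hlt]
    simpa using h6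
  · rw [integral_withDensity_eq_integral_toReal_smul hm2 hlt]
    simp only [smul_eq_mul]
    rw [← setIntegral_eq_integral_of_forall_compl_eq_zero h4]
    have : Real.Gamma 2 = 1 := by
      rw [show (2 : ℝ) = 1 + 1 by norm_num, Real.Gamma_add_one one_ne_zero, Real.Gamma_one, mul_one]
    rw [this, mul_one, show (2 : ℝ) = ((2 : ℕ) : ℝ) by norm_num, Real.rpow_natCast] at h2
    field_simp at h2 ⊢
    linarith

namespace QState

/-- The next event is the arrival of one of the first `J` customers. -/
def arrivalSet (J : ℕ) : Set QState := {q | q.arrived < J ∧ q.nextArrival < q.clock}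

/-- The next event starts a vacation. -/
def vacationSet (J : ℕ) : Set QState := {q | q.arrived < J ∧ ¬ q.nextArrival < q.clock ∧ q.after = 0}

/-- The next event starts a service. -/
def serviceSet (J : ℕ) : Set QState := {q | q.arrived < J ∧ ¬ q.nextArrival < q.clock ∧ q.after ≠ 0}

/-- The next event completes a service. -/
def completionSet (J : ℕ) : Set QState :=
  {q | q.arrived < J ∧ ¬ q.nextArrival < q.clock ∧ q.serving = true}

/-- The next event is the loss of one of the first `J` customers. -/
def lossSet (N J : ℕ) : Set QState :=
  {q | q.arrived < J ∧ q.nextArrival < q.clock ∧ q.inSystem = N}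

/-- Fewer than `J` customers have arrived. -/
def activeSet (J : ℕ) : Set QState := {q | q.arrived < J}

lemma measurableSet_activeSet (J : ℕ) : MeasurableSet (activeSet J) :=
  measurableSet_lt measurable_arrived measurable_const

lemma measurableSet_arrivalSet (J : ℕ) : MeasurableSet (arrivalSet J) :=
  (measurableSet_activeSet J).inter measurableSet_arrival

lemma measurableSet_vacationSet (J : ℕ) : MeasurableSet (vacationSet J) :=
  (measurableSet_activeSet J).inter (measurableSet_arrival.compl.inter
    (measurableSet_eq_fun measurable_after measurable_const))

lemma measurableSet_serviceSet (J : ℕ) : MeasurableSet (serviceSet J) :=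
  (measurableSet_activeSet J).inter (measurableSet_arrival.compl.inter
    (measurableSet_eq_fun measurable_after measurable_const).compl)

lemma measurableSet_completionSet (J : ℕ) : MeasurableSet (completionSet J) :=
  (measurableSet_activeSet J).inter (measurableSet_arrival.compl.inter
    (measurableSet_eq_fun measurable_serving measurable_const))

lemma measurableSet_lossSet (N J : ℕ) : MeasurableSet (lossSet N J) :=
  (measurableSet_activeSet J).inter (measurableSet_arrival.inter
    (measurableSet_eq_fun measurable_inSystem measurable_const))

end QState

section OneStep

open QState

set_option linter.unusedSectionVars false

variable {Ω : Type*} [MeasurableSpace Ω] {P : Measure Ω} [IsProbabilityMeasure P] {lam : ℝ}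
  {σ υ : Measure ℝ} {A S V : ℕ → Ω → ℝ} (N J : ℕ)

local notation "Z" => stoppedQueue N J A S V

/-- Wald's identity for a single step: the type of the next event is decided by the inputs up to
index k, independently of the variables that are drawn at it. -/
lemma integral_indicator_mul_input (hin : IsQueueInput P lam σ υ A S V) (k : ℕ) {G : Set QState}
    (hG : MeasurableSet G) {f : ℝ × ℝ × ℝ → ℝ} (hf : Measurable f) :
    ∫ ω, G.indicator 1 (Z k ω) * f (A (k + 1) ω, S (k + 1) ω, V (k + 1) ω) ∂P =
      P.real (Z k ⁻¹' G) * ∫ ω, f (A (k + 1) ω, S (k + 1) ω, V (k + 1) ω) ∂P := by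
  have hg : Measurable (G.indicator (1 : QState → ℝ)) := measurable_one.indicator hG
  have hi := (indepFun_stoppedQueue N J hin k).comp hg hf
  have h := hi.integral_fun_mul_eq_mul_integral
    (hg.comp (measurable_stoppedQueue N J hin k)).aestronglyMeasurable
    (hf.comp (hin.measurable_input (k + 1))).aestronglyMeasurable
  simp only [Function.comp_apply] at h
  rw [h]
  congr 1
  rw [← integral_indicator_one ((measurable_stoppedQueue N J hin k) hG)]
  rfl

lemma integrable_indicator_mul_input (hin : IsQueueInput P lam σ υ A S V) (k : ℕ) {G : Set QState}
    (hG : MeasurableSet G) {f : Ω → ℝ} (hf : Integrable f P) :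
    Integrable (fun ω => G.indicator 1 (Z k ω) * f ω) P := by
  have hg : Measurable (G.indicator (1 : QState → ℝ)) := measurable_one.indicator hG
  refine hf.bdd_mul (c := 1) (hg.comp (measurable_stoppedQueue N J hin k)).aestronglyMeasurable
    (ae_of_all _ fun ω => ?_)
  by_cases h : Z k ω ∈ G <;> simp [h]

lemma integrable_indicator_stoppedQueue (hin : IsQueueInput P lam σ υ A S V) (k : ℕ)
    {G : Set QState} (hG : MeasurableSet G) :
    Integrable (fun ω => G.indicator (1 : QState → ℝ) (Z k ω)) P := by
  simpa using integrable_indicator_mul_input N J hin k hG (integrable_const (1 : ℝ))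

lemma integral_indicator_stoppedQueue (hin : IsQueueInput P lam σ υ A S V) (k : ℕ)
    {G : Set QState} (hG : MeasurableSet G) :
    ∫ ω, G.indicator (1 : QState → ℝ) (Z k ω) ∂P = P.real (Z k ⁻¹' G) := by
  simpa using integral_indicator_mul_input N J hin k hG (f := fun _ => 1) measurable_const

lemma measureReal_activeSet (hin : IsQueueInput P lam σ υ A S V) (k : ℕ) :
    P.real (Z k ⁻¹' activeSet J) = P.real (Z k ⁻¹' arrivalSet J) +
      P.real (Z k ⁻¹' serviceSet J) + P.real (Z k ⁻¹' vacationSet J) := by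
  simp only [← integral_indicator_stoppedQueue N J hin k (measurableSet_activeSet J),
    ← integral_indicator_stoppedQueue N J hin k (measurableSet_arrivalSet J),
    ← integral_indicator_stoppedQueue N J hin k (measurableSet_serviceSet J),
    ← integral_indicator_stoppedQueue N J hin k (measurableSet_vacationSet J)]
  have i1 := integrable_indicator_stoppedQueue N J hin k (measurableSet_arrivalSet J)
  have i2 := integrable_indicator_stoppedQueue N J hin k (measurableSet_serviceSet J)
  have i3 := integrable_indicator_stoppedQueue N J hin k (measurableSet_vacationSet J)
  rw [← integral_add i1 i2, ← integral_add (i1.fun_add i2) i3]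
  refine integral_congr_ae (ae_of_all _ fun ω => ?_)
  simp only [Set.indicator_apply, activeSet, arrivalSet, serviceSet, vacationSet,
    Set.mem_ofPred_eq, Pi.one_apply]
  by_cases h1 : (Z k ω).arrived < J <;> by_cases h2 : (Z k ω).nextArrival < (Z k ω).clock <;>
    by_cases h3 : (Z k ω).after = 0 <;> simp [h1, h2, h3]

lemma stoppedQueue_succ_cases (k : ℕ) (ω : Ω) {a s v : ℝ} (ha : a = A (k + 1) ω)
    (hs : s = S (k + 1) ω) (hv : v = V (k + 1) ω) :
    ((Z k ω).arrived < J ∧ (Z k ω).nextArrival < (Z k ω).clock ∧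
      Z (k + 1) ω = ⟨min ((Z k ω).inSystem + 1) N, (Z k ω).serving,
        (Z k ω).clock - (Z k ω).nextArrival, a, (Z k ω).arrived + 1⟩) ∨
    ((Z k ω).arrived < J ∧ ¬ (Z k ω).nextArrival < (Z k ω).clock ∧
      Z (k + 1) ω = ⟨(Z k ω).after, decide ((Z k ω).after ≠ 0), if (Z k ω).after = 0 then v else s,
        (Z k ω).nextArrival - (Z k ω).clock, (Z k ω).arrived⟩) ∨
    (¬ (Z k ω).arrived < J ∧ Z (k + 1) ω = Z k ω) := by
  subst ha hs hv
  rw [stoppedQueue_succ, QState.stoppedStep]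
  by_cases h1 : (Z k ω).arrived < J
  · by_cases h2 : (Z k ω).nextArrival < (Z k ω).clock
    · left; rw [if_pos h1, step_of_lt h2]; exact ⟨h1, h2, rfl⟩
    · right; left; rw [if_pos h1, step_of_not_lt h2]; exact ⟨h1, h2, rfl⟩
  · right; right; rw [if_neg h1]; exact ⟨h1, rfl⟩

lemma map_nextArrival_stoppedQueue (hin : IsQueueInput P lam σ υ A S V) (hlam : 0 < lam)
    (hσ : σ (Set.Iio 0) = 0) (hυ : υ (Set.Iio 0) = 0) (k : ℕ) :
    P.map (fun ω => (Z k ω).nextArrival) = expMeasure lam := by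
  have hm : Measurable (fun ω => (Z k ω).nextArrival) :=
    measurable_nextArrival.comp (measurable_stoppedQueue N J hin k)
  ext B hB
  rw [Measure.map_apply hm hB, ← lintegral_indicator_one (hm hB)]
  have h := lintegral_stoppedQueue_resample N J hin hlam hσ hυ k
    (fun q => B.indicator 1 q.nextArrival) ((measurable_one.indicator hB).comp measurable_nextArrival)
  refine (Eq.trans ?_ h).trans ?_
  · rfl
  · simp [QState.withNext, lintegral_indicator_one hB]

lemma integral_nextArrival_stoppedQueue (hin : IsQueueInput P lam σ υ A S V) (hlam : 0 < lam)
    (hσ : σ (Set.Iio 0) = 0) (hυ : υ (Set.Iio 0) = 0) (k : ℕ) :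
    Integrable (fun ω => (Z k ω).nextArrival) P ∧ ∫ ω, (Z k ω).nextArrival ∂P = 1 / lam := by
  have hm : Measurable (fun ω => (Z k ω).nextArrival) :=
    measurable_nextArrival.comp (measurable_stoppedQueue N J hin k)
  have h := map_nextArrival_stoppedQueue N J hin hlam hσ hυ k
  have h2 := integral_expMeasure_id hlam
  rw [← h] at h2
  exact ⟨(integrable_map_measure aestronglyMeasurable_id hm.aemeasurable).1 h2.1,
    (integral_map hm.aemeasurable aestronglyMeasurable_id).symm.trans h2.2⟩

lemma IsQueueInput.integral_arrival (hin : IsQueueInput P lam σ υ A S V) (hlam : 0 < lam) (k : ℕ) :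
    Integrable (A k) P ∧ ∫ ω, A k ω ∂P = 1 / lam := by
  have h2 := integral_expMeasure_id hlam
  rw [← hin.law_arrival k] at h2
  have hm := (hin.measurable_arrival k).aemeasurable (μ := P)
  exact ⟨(integrable_map_measure aestronglyMeasurable_id hm).1 h2.1,
    (integral_map hm aestronglyMeasurable_id).symm.trans h2.2⟩

lemma IsQueueInput.integral_service (hin : IsQueueInput P lam σ υ A S V) {f : ℝ → ℝ}
    (hf : Measurable f) (hσi : Integrable f σ) (k : ℕ) :
    Integrable (fun ω => f (S k ω)) P ∧ ∫ ω, f (S k ω) ∂P = ∫ t, f t ∂σ := by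
  rw [← hin.law_service k] at hσi ⊢
  have hm := (hin.measurable_service k).aemeasurable (μ := P)
  exact ⟨(integrable_map_measure hf.aestronglyMeasurable hm).1 hσi,
    (integral_map hm hf.aestronglyMeasurable).symm⟩

lemma IsQueueInput.integral_vacation (hin : IsQueueInput P lam σ υ A S V) {f : ℝ → ℝ}
    (hf : Measurable f) (hυi : Integrable f υ) (k : ℕ) :
    Integrable (fun ω => f (V k ω)) P ∧ ∫ ω, f (V k ω) ∂P = ∫ t, f t ∂υ := by
  rw [← hin.law_vacation k] at hυi ⊢
  have hm := (hin.measurable_vacation k).aemeasurable (μ := P)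
  exact ⟨(integrable_map_measure hf.aestronglyMeasurable hm).1 hυi,
    (integral_map hm hf.aestronglyMeasurable).symm⟩

lemma integral_inSystem_succ (hin : IsQueueInput P lam σ υ A S V) (hN : 1 ≤ N) (k : ℕ) :
    ∫ ω, ((Z (k + 1) ω).inSystem : ℝ) ∂P = ∫ ω, ((Z k ω).inSystem : ℝ) ∂P
      + P.real (Z k ⁻¹' arrivalSet J) - P.real (Z k ⁻¹' lossSet N J)
      - P.real (Z k ⁻¹' completionSet J) := by
  have i0 : Integrable (fun ω => ((Z k ω).inSystem : ℝ)) P := by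
    refine Integrable.of_bound (C := N) (measurable_from_top.comp (measurable_inSystem.comp
      (measurable_stoppedQueue N J hin k))).aestronglyMeasurable (ae_of_all _ fun ω => ?_)
    rw [Real.norm_natCast]; exact_mod_cast (stoppedPath_inSystem hN k).1
  simp only [← integral_indicator_stoppedQueue N J hin k (measurableSet_lossSet N J),
    ← integral_indicator_stoppedQueue N J hin k (measurableSet_arrivalSet J),
    ← integral_indicator_stoppedQueue N J hin k (measurableSet_completionSet J)]
  have i1 := integrable_indicator_stoppedQueue N J hin k (measurableSet_arrivalSet J)
  have i2 := integrable_indicator_stoppedQueue N J hin k (measurableSet_lossSet N J)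
  have i3 := integrable_indicator_stoppedQueue N J hin k (measurableSet_completionSet J)
  rw [← integral_add i0 i1, ← integral_sub (i0.fun_add i1) i2, ← integral_sub ((i0.fun_add i1).fun_sub' i2) i3]
  refine integral_congr_ae (ae_of_all _ fun ω => ?_)
  have hn : (Z k ω).inSystem ≤ N ∧ ((Z k ω).serving = true → 1 ≤ (Z k ω).inSystem) :=
    stoppedPath_inSystem hN k
  simp only [Set.indicator_apply, arrivalSet, lossSet, completionSet,
    Set.mem_ofPred_eq, Pi.one_apply]
  rcases stoppedQueue_succ_cases (A := A) (S := S) (V := V) N J k ω rfl rfl rfl with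
    ⟨h1, h2, h3⟩ | ⟨h1, h2, h3⟩ | ⟨h1, h3⟩
  · rw [h3]
    by_cases hl : (Z k ω).inSystem = N
    · simp [h1, h2, hl]
    · simp [h1, h2, hl, min_eq_left (by omega : (Z k ω).inSystem + 1 ≤ N)]
  · rw [h3]
    by_cases hs : (Z k ω).serving = true
    · simp [h1, h2, hs, QState.after, Nat.cast_sub (hn.2 hs)]
    · simp [h1, h2, hs, QState.after]
  · rw [h3]; simp [h1]

lemma measureReal_serving_succ (hin : IsQueueInput P lam σ υ A S V) (k : ℕ) :
    P.real (Z (k + 1) ⁻¹' {q | q.serving = true}) = P.real (Z k ⁻¹' {q | q.serving = true})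
      + P.real (Z k ⁻¹' serviceSet J) - P.real (Z k ⁻¹' completionSet J) := by
  have hs : MeasurableSet {q : QState | q.serving = true} :=
    measurableSet_eq_fun measurable_serving measurable_const
  simp only [← integral_indicator_stoppedQueue N J hin _ hs,
    ← integral_indicator_stoppedQueue N J hin k (measurableSet_serviceSet J),
    ← integral_indicator_stoppedQueue N J hin k (measurableSet_completionSet J)]
  have i0 := integrable_indicator_stoppedQueue N J hin k hs
  have i1 := integrable_indicator_stoppedQueue N J hin k (measurableSet_serviceSet J)
  have i2 := integrable_indicator_stoppedQueue N J hin k (measurableSet_completionSet J)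
  rw [← integral_add i0 i1, ← integral_sub (i0.fun_add i1) i2]
  refine integral_congr_ae (ae_of_all _ fun ω => ?_)
  simp only [Set.indicator_apply, serviceSet, completionSet,
    Set.mem_ofPred_eq, Pi.one_apply]
  rcases stoppedQueue_succ_cases (A := A) (S := S) (V := V) N J k ω rfl rfl rfl with
    ⟨h1, h2, h3⟩ | ⟨h1, h2, h3⟩ | ⟨h1, h3⟩
  · rw [h3]; simp [h1, h2]
  · rw [h3]
    by_cases hs : (Z k ω).serving = true <;> by_cases ha : (Z k ω).after = 0 <;>
      simp [h1, h2, hs, ha]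
  · rw [h3]; simp [h1]

lemma integral_arrived_succ (hin : IsQueueInput P lam σ υ A S V) (k : ℕ) :
    ∫ ω, ((Z (k + 1) ω).arrived : ℝ) ∂P = ∫ ω, ((Z k ω).arrived : ℝ) ∂P
      + P.real (Z k ⁻¹' arrivalSet J) := by
  have i0 : Integrable (fun ω => ((Z k ω).arrived : ℝ)) P := by
    refine Integrable.of_bound (C := J) (measurable_from_top.comp (measurable_arrived.comp
      (measurable_stoppedQueue N J hin k))).aestronglyMeasurable (ae_of_all _ fun ω => ?_)
    rw [Real.norm_natCast]; exact_mod_cast stoppedPath_arrived_le k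
  rw [← integral_indicator_stoppedQueue N J hin k (measurableSet_arrivalSet J)]
  have i1 := integrable_indicator_stoppedQueue N J hin k (measurableSet_arrivalSet J)
  rw [← integral_add i0 i1]
  refine integral_congr_ae (ae_of_all _ fun ω => ?_)
  simp only [Set.indicator_apply, arrivalSet, Set.mem_ofPred_eq, Pi.one_apply]
  rcases stoppedQueue_succ_cases (A := A) (S := S) (V := V) N J k ω rfl rfl rfl with
    ⟨h1, h2, h3⟩ | ⟨h1, h2, h3⟩ | ⟨h1, h3⟩ <;> rw [h3] <;> simp [h1]
  · simp [h2]
  · exact not_lt.1 h2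

lemma integrable_clock_stoppedQueue (hin : IsQueueInput P lam σ υ A S V) (hlam : 0 < lam)
    (hσ : σ (Set.Iio 0) = 0) (hυ : υ (Set.Iio 0) = 0) (hσi : Integrable (fun t : ℝ => t) σ)
    (hυi : Integrable (fun t : ℝ => t) υ) (k : ℕ) :
    Integrable (fun ω => (Z k ω).clock) P := by
  induction k with
  | zero => exact (hin.integral_vacation measurable_id hυi 0).1
  | succ k ih =>
    have hb := ((ih.norm.add (integral_nextArrival_stoppedQueue N J hin hlam hσ hυ k).1.norm).add
      (hin.integral_service measurable_id hσi (k + 1)).1.norm).add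
      (hin.integral_vacation measurable_id hυi (k + 1)).1.norm
    refine hb.mono' (measurable_clock.comp
      (measurable_stoppedQueue N J hin _)).aestronglyMeasurable (ae_of_all _ fun ω => ?_)
    simp only [Pi.add_apply, Real.norm_eq_abs, id]
    have e1 := abs_nonneg (Z k ω).clock
    have e2 := abs_nonneg (Z k ω).nextArrival
    have e3 := abs_nonneg (S (k + 1) ω)
    have e4 := abs_nonneg (V (k + 1) ω)
    rcases stoppedQueue_succ_cases (A := A) (S := S) (V := V) N J k ω rfl rfl rfl with
      ⟨h1, h2, h3⟩ | ⟨h1, h2, h3⟩ | ⟨h1, h3⟩ <;> rw [h3] <;> try simp only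
    · have := abs_sub (Z k ω).clock (Z k ω).nextArrival
      linarith
    · split_ifs <;> linarith
    · linarith

/-- The difference `clock - nextArrival` is additive: it loses the fresh interarrival time at an
arrival and gains the fresh service or vacation time at any other event. Since `nextArrival` has
mean 1/λ at every event, the mean clock has the same increments. -/
lemma integral_clock_succ (hin : IsQueueInput P lam σ υ A S V) (hlam : 0 < lam)
    (hσ : σ (Set.Iio 0) = 0) (hυ : υ (Set.Iio 0) = 0) (hσi : Integrable (fun t : ℝ => t) σ)
    (hυi : Integrable (fun t : ℝ => t) υ) (k : ℕ) :
    ∫ ω, (Z (k + 1) ω).clock ∂P = ∫ ω, (Z k ω).clock ∂P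
      - P.real (Z k ⁻¹' arrivalSet J) * (1 / lam) + P.real (Z k ⁻¹' serviceSet J) * ∫ t, t ∂σ
      + P.real (Z k ⁻¹' vacationSet J) * ∫ t, t ∂υ := by
  have hA := hin.integral_arrival hlam (k + 1)
  have hS := hin.integral_service measurable_id hσi (k + 1)
  have hV := hin.integral_vacation measurable_id hυi (k + 1)
  have ic := integrable_clock_stoppedQueue N J hin hlam hσ hυ hσi hυi
  have ix := integral_nextArrival_stoppedQueue N J hin hlam hσ hυ
  have i1 := integrable_indicator_mul_input N J hin k (measurableSet_arrivalSet J) hA.1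
  have i2 := integrable_indicator_mul_input N J hin k (measurableSet_serviceSet J) hS.1
  have i3 := integrable_indicator_mul_input N J hin k (measurableSet_vacationSet J) hV.1
  have m1 := integral_indicator_mul_input N J hin k (measurableSet_arrivalSet J)
    (f := fun w => w.1) measurable_fst
  have m2 := integral_indicator_mul_input N J hin k (measurableSet_serviceSet J)
    (f := fun w => w.2.1) (by fun_prop)
  have m3 := integral_indicator_mul_input N J hin k (measurableSet_vacationSet J)
    (f := fun w => w.2.2) (by fun_prop)
  simp only [id] at hS hV i2 i3 m1 m2 m3
  rw [hA.2] at m1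
  rw [hS.2] at m2
  rw [hV.2] at m3
  have key : ∫ ω, ((Z (k + 1) ω).clock - (Z (k + 1) ω).nextArrival) ∂P =
      ∫ ω, ((((((Z k ω).clock - (Z k ω).nextArrival)
        - (arrivalSet J).indicator 1 (Z k ω) * A (k + 1) ω)
        + (serviceSet J).indicator 1 (Z k ω) * S (k + 1) ω))
        + (vacationSet J).indicator 1 (Z k ω) * V (k + 1) ω) ∂P := by
    refine integral_congr_ae (ae_of_all _ fun ω => ?_)
    simp only [Set.indicator_apply, serviceSet, vacationSet, arrivalSet,
      Set.mem_ofPred_eq, Pi.one_apply]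
    rcases stoppedQueue_succ_cases (A := A) (S := S) (V := V) N J k ω rfl rfl rfl with
      ⟨h1, h2, h3⟩ | ⟨h1, h2, h3⟩ | ⟨h1, h3⟩ <;> rw [h3] <;> try simp only
    · simp [h1, h2]
    · by_cases ha : (Z k ω).after = 0 <;> simp [h1, h2, ha] <;> ring
    · simp [h1]
  have i0 := (ic k).fun_sub' (ix k).1
  have i01 := i0.fun_sub' i1
  rw [integral_sub (ic _) (ix _).1, integral_add (i01.fun_add i2) i3, integral_add i01 i2,
    integral_sub i0 i1, integral_sub (ic k) (ix k).1, m1, m2, m3, (ix _).2, (ix _).2] at key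
  linarith

/-- An arrival only lowers the clock, and any other event replaces it by a fresh value. The excess
over κ is therefore controlled by the excesses of the values drawn, which replaces a uniform
integrability argument for the clock. -/
lemma integral_clock_excess_succ (hin : IsQueueInput P lam σ υ A S V) (hlam : 0 < lam)
    (hσ : σ (Set.Iio 0) = 0) (hυ : υ (Set.Iio 0) = 0) (hσi : Integrable (fun t : ℝ => t) σ)
    (hυi : Integrable (fun t : ℝ => t) υ) (κ : ℝ) (k : ℕ) :
    ∫ ω, max ((Z (k + 1) ω).clock - κ) 0 ∂P ≤ ∫ ω, max ((Z k ω).clock - κ) 0 ∂P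
      + P.real (Z k ⁻¹' serviceSet J) * ∫ t, max (t - κ) 0 ∂σ
      + P.real (Z k ⁻¹' vacationSet J) * ∫ t, max (t - κ) 0 ∂υ := by
  have := isProbabilityMeasure_expMeasure hlam
  have hσp : IsProbabilityMeasure σ := by
    rw [← hin.law_service 0]
    exact Measure.isProbabilityMeasure_map (hin.measurable_service 0).aemeasurable
  have hυp : IsProbabilityMeasure υ := by
    rw [← hin.law_vacation 0]
    exact Measure.isProbabilityMeasure_map (hin.measurable_vacation 0).aemeasurable
  have hf : Measurable (fun t : ℝ => max (t - κ) 0) := by fun_prop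
  have hS := hin.integral_service hf (hσi.sub (integrable_const κ)).pos_part (k + 1)
  have hV := hin.integral_vacation hf (hυi.sub (integrable_const κ)).pos_part (k + 1)
  have ic : ∀ k, Integrable (fun ω => max ((Z k ω).clock - κ) 0) P := fun k =>
    ((integrable_clock_stoppedQueue N J hin hlam hσ hυ hσi hυi k).sub
      (integrable_const κ)).pos_part
  have i2 := integrable_indicator_mul_input N J hin k (measurableSet_serviceSet J) hS.1
  have i3 := integrable_indicator_mul_input N J hin k (measurableSet_vacationSet J) hV.1
  have m2 := integral_indicator_mul_input N J hin k (measurableSet_serviceSet J)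
    (f := fun w => max (w.2.1 - κ) 0) (by fun_prop)
  have m3 := integral_indicator_mul_input N J hin k (measurableSet_vacationSet J)
    (f := fun w => max (w.2.2 - κ) 0) (by fun_prop)
  rw [hS.2] at m2
  rw [hV.2] at m3
  have hx : ∀ᵐ ω ∂P, 0 ≤ (Z k ω).nextArrival := by
    refine ae_of_ae_map (p := fun x : ℝ => 0 ≤ x)
      (measurable_nextArrival.comp (measurable_stoppedQueue N J hin k)).aemeasurable ?_
    rw [show P.map (QState.nextArrival ∘ Z k) = expMeasure lam from
      map_nextArrival_stoppedQueue N J hin hlam hσ hυ k, ae_iff]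
    simp only [not_le]
    change (volume.withDensity (exponentialPDF lam)) (Set.Iio 0) = 0
    rw [withDensity_apply _ measurableSet_Iio]
    exact lintegral_exponentialPDF_of_nonpos le_rfl
  rw [← m2, ← m3, ← integral_add (ic k) i2, ← integral_add ((ic k).fun_add i2) i3]
  refine integral_mono_ae (ic (k + 1)) (((ic k).fun_add i2).fun_add i3) ?_
  filter_upwards [hx] with ω hx
  simp only [Set.indicator_apply, serviceSet, vacationSet, Set.mem_ofPred_eq, Pi.one_apply]
  rcases stoppedQueue_succ_cases (A := A) (S := S) (V := V) N J k ω rfl rfl rfl with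
    ⟨h1, h2, h3⟩ | ⟨h1, h2, h3⟩ | ⟨h1, h3⟩ <;> rw [h3] <;> try simp only
  · simp only [h1, h2, not_true_eq_false, false_and, and_false, if_false, zero_mul, add_zero]
    exact max_le_max (by linarith) le_rfl
  · by_cases ha : (Z k ω).after = 0 <;> simp [h1, h2, ha]
  · simp [h1]

end OneStep

/-- `m n` is the mean number of services in the rest of the busy period when a service starts with
`n` customers in a system of capacity `N`, and `M` is the mean number of services in a cycle. -/
structure IsMeanServices (lam : ℝ) (σ υ : Measure ℝ) (N : ℕ) (m : ℕ → ℝ) (M : ℝ) : Prop where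
  zero : m 0 = 0
  one_le : ∀ n, 1 ≤ n → 1 ≤ m n
  service : ∀ n, 1 ≤ n → n ≤ N → ∫ t, poissonAvg lam N (fun i => m (i - 1)) n t ∂σ = m n - 1
  vacation : ∫ t, poissonAvg lam N m 0 t ∂υ = M
  pos : 0 < M

/-! ### The mean number of services left in the cycle, as a potential -/

section Potential

open QState

set_option linter.unusedSectionVars false

variable {Ω : Type*} [MeasurableSpace Ω] {P : Measure Ω} [IsProbabilityMeasure P] {lam : ℝ}
  {σ υ : Measure ℝ} {A S V : ℕ → Ω → ℝ} (N J : ℕ)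

local notation "Z" => stoppedQueue N J A S V

/-- The number of customers at the start of the next phase when `n` customers are present at the
end of the current one, turned into a mean number of services. -/
def phaseValue (m : ℕ → ℝ) (s : Bool) (n : ℕ) : ℝ := m (if s then n - 1 else n)

/-- The mean number of services that follow the current phase within the cycle. -/
noncomputable def futureServices (lam : ℝ) (m : ℕ → ℝ) (q : QState) : ENNReal :=
  ENNReal.ofReal (poissonAvg lam N (phaseValue m q.serving) q.inSystem q.clock)

lemma measurable_futureServices (lam : ℝ) (m : ℕ → ℝ) :
    Measurable (futureServices N lam m) := by
  have h : Measurable (fun p : (Bool × ℕ) × ℝ => poissonAvg lam N (phaseValue m p.1.1) p.1.2 p.2) :=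
    measurable_from_prod_countable_right fun p =>
      (continuous_poissonAvg lam N (phaseValue m p.1) p.2).measurable
  exact (h.comp ((measurable_serving.prodMk measurable_inSystem).prodMk
    measurable_clock)).ennreal_ofReal

lemma IsMeanServices.nonneg {M : ℝ} {m : ℕ → ℝ} (h : IsMeanServices lam σ υ N m M) (n : ℕ) :
    0 ≤ m n := by
  rcases Nat.eq_zero_or_pos n with rfl | hn
  · exact h.zero.ge
  · linarith [h.one_le n hn]

lemma IsMeanServices.phaseValue_bounds {M : ℝ} {m : ℕ → ℝ} (h : IsMeanServices lam σ υ N m M)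
    (s : Bool) (n : ℕ) (hn : n ≤ N) :
    0 ≤ phaseValue m s n ∧ phaseValue m s n ≤ ∑ i ∈ Finset.range (N + 1), m i :=
  ⟨h.nonneg N _, Finset.single_le_sum (fun i _ => h.nonneg N i)
    (Finset.mem_range.2 (by split_ifs <;> omega))⟩

lemma lintegral_poissonAvg_of_bounds {C : ℝ} (hlam : 0 < lam) {ν : Measure ℝ}
    [IsProbabilityMeasure ν] (hν : ν (Set.Iio 0) = 0) {u : ℕ → ℝ}
    (hu : ∀ n ≤ N, 0 ≤ u n ∧ u n ≤ C) (n : ℕ) :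
    ∫⁻ t, ENNReal.ofReal (poissonAvg lam N u n t) ∂ν =
      ENNReal.ofReal (∫ t, poissonAvg lam N u n t ∂ν) := by
  have h0 : ∀ᵐ t ∂ν, 0 ≤ t := by rw [ae_iff]; simp only [not_le]; exact hν
  refine (ofReal_integral_eq_lintegral_ofReal ?_ ?_).symm
  · refine Integrable.of_bound (C := C) (continuous_poissonAvg _ _ _ _).aestronglyMeasurable ?_
    filter_upwards [h0] with t ht
    have := poissonAvg_bounds hlam ht hu n
    rw [Real.norm_eq_abs, abs_of_nonneg this.1]; exact this.2
  · filter_upwards [h0] with t ht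
    exact (poissonAvg_bounds hlam ht hu n).1

/-- In the mean, the potential gains M when a vacation starts, loses 1 when a service starts and is
otherwise unchanged: it counts services still to come, and each start of a vacation opens a cycle
that is worth M. -/
lemma lintegral_futureServices_succ (hin : IsQueueInput P lam σ υ A S V) (hlam : 0 < lam)
    (hN : 1 ≤ N) (hσ : σ (Set.Iio 0) = 0) (hυ : υ (Set.Iio 0) = 0) {M : ℝ} {m : ℕ → ℝ}
    (h : IsMeanServices lam σ υ N m M) (k : ℕ) :
    ∫⁻ ω, futureServices N lam m (Z (k + 1) ω) ∂P + P (Z k ⁻¹' serviceSet J) =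
      ∫⁻ ω, futureServices N lam m (Z k ω) ∂P + ENNReal.ofReal M * P (Z k ⁻¹' vacationSet J) := by
  have := isProbabilityMeasure_expMeasure hlam
  have hσp : IsProbabilityMeasure σ := by
    rw [← hin.law_service 0]
    exact Measure.isProbabilityMeasure_map (hin.measurable_service 0).aemeasurable
  have hυp : IsProbabilityMeasure υ := by
    rw [← hin.law_vacation 0]
    exact Measure.isProbabilityMeasure_map (hin.measurable_vacation 0).aemeasurable
  set F := futureServices N lam m with hF
  have hFm : Measurable F := measurable_futureServices N lam m
  have hZ := measurable_stoppedQueue N J hin k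
  have hmi := hin.measurable_input (k + 1)
  set τ := P.map fun ω => (A (k + 1) ω, S (k + 1) ω, V (k + 1) ω) with hτ
  have hτp : IsProbabilityMeasure τ := Measure.isProbabilityMeasure_map hmi.aemeasurable
  have hvac : ∫⁻ w, ENNReal.ofReal (poissonAvg lam N (phaseValue m false) 0 w.2.2) ∂τ
      = ENNReal.ofReal M := by
    have hm : Measurable (fun t => ENNReal.ofReal (poissonAvg lam N (phaseValue m false) 0 t)) :=
      (continuous_poissonAvg _ _ _ _).measurable.ennreal_ofReal
    rw [← h.vacation, hτ, lintegral_map (f := fun w : ℝ × ℝ × ℝ =>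
      ENNReal.ofReal (poissonAvg lam N (phaseValue m false) 0 w.2.2)) (hm.comp (by fun_prop)) hmi]
    have := lintegral_map (μ := P) hm (hin.measurable_vacation (k + 1))
    rw [hin.law_vacation, lintegral_poissonAvg_of_bounds N hlam hυ
      (h.phaseValue_bounds N false)] at this
    exact this.symm
  have hser : ∀ n, 1 ≤ n → n ≤ N →
      ∫⁻ w, ENNReal.ofReal (poissonAvg lam N (phaseValue m true) n w.2.1) ∂τ
      = ENNReal.ofReal (m n - 1) := by
    intro n hn1 hn
    have hm : Measurable (fun t => ENNReal.ofReal (poissonAvg lam N (phaseValue m true) n t)) :=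
      (continuous_poissonAvg _ _ _ _).measurable.ennreal_ofReal
    rw [← h.service n hn1 hn, hτ, lintegral_map (f := fun w : ℝ × ℝ × ℝ =>
      ENNReal.ofReal (poissonAvg lam N (phaseValue m true) n w.2.1)) (hm.comp (by fun_prop)) hmi]
    have := lintegral_map (μ := P) hm (hin.measurable_service (k + 1))
    rw [hin.law_service, lintegral_poissonAvg_of_bounds N hlam hσ
      (h.phaseValue_bounds N true)] at this
    exact this.symm
  have hms := measurableSet_serviceSet J
  have hmv := measurableSet_vacationSet J
  have his : Measurable ((serviceSet J).indicator (1 : QState → ENNReal)) :=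
    measurable_one.indicator hms
  have hiv : Measurable ((vacationSet J).indicator (1 : QState → ENNReal)) :=
    measurable_one.indicator hmv
  set H : QState → ENNReal := fun q => ∫⁻ w, F (q.stoppedStep N J w) ∂τ with hH
  have hHm : Measurable H :=
    (hFm.comp (QState.measurable_stoppedStep N J)).lintegral_prod_right'
  have e1 : ∫⁻ ω, F (Z (k + 1) ω) ∂P = ∫⁻ ω, H (Z k ω) ∂P :=
    lintegral_stoppedQueue_prod N J hin k (fun p => F (p.1.stoppedStep N J p.2))
      (hFm.comp (QState.measurable_stoppedStep N J))
  have e2 : P (Z k ⁻¹' serviceSet J) = ∫⁻ ω, (serviceSet J).indicator 1 (Z k ω) ∂P :=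
    (lintegral_indicator_one (hZ hms)).symm
  have e3 : P (Z k ⁻¹' vacationSet J) = ∫⁻ ω, (vacationSet J).indicator 1 (Z k ω) ∂P :=
    (lintegral_indicator_one (hZ hmv)).symm
  have hHZ : Measurable (fun ω => H (Z k ω)) := hHm.comp hZ
  have hFZ : Measurable (fun ω => F (Z k ω)) := hFm.comp hZ
  have hiZ : Measurable (fun ω => (vacationSet J).indicator (1 : QState → ENNReal) (Z k ω)) :=
    hiv.comp hZ
  rw [e1, e2, e3, ← lintegral_add_left hHZ, ← lintegral_const_mul _ hiZ, ← lintegral_add_left hFZ]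
  have r1 := lintegral_stoppedQueue_resample N J hin hlam hσ hυ k
    (fun q => H q + (serviceSet J).indicator 1 q) (hHm.add his)
  have r2 := lintegral_stoppedQueue_resample N J hin hlam hσ hυ k
    (fun q => F q + ENNReal.ofReal M * (vacationSet J).indicator 1 q) (hFm.add (hiv.const_mul _))
  refine (r1.trans ?_).trans r2.symm
  refine lintegral_congr_ae ?_
  filter_upwards [stoppedQueue_clock_nonneg N J hin hσ hυ k] with ω hc
  have hn : (Z k ω).inSystem ≤ N := (stoppedPath_inSystem hN k).1
  set q := Z k ω
  by_cases hj : q.arrived < J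
  · have hFq : ∀ a, F (q.withNext a) = F q := fun _ => rfl
    have hP := lintegral_poissonAvg (lam := lam) hlam hc
      (h.phaseValue_bounds N q.serving) hn
    have hmP : Measurable (fun x : ℝ => if x < q.clock then ENNReal.ofReal (poissonAvg lam N
        (phaseValue m q.serving) (min (q.inSystem + 1) N) (q.clock - x))
        else ENNReal.ofReal (phaseValue m q.serving q.inSystem)) :=
      Measurable.ite measurableSet_Iio (((continuous_poissonAvg _ _ _ _).measurable.comp
        (by fun_prop)).ennreal_ofReal) measurable_const
    have hwm : Measurable (fun a : ℝ => F (q.withNext a)) :=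
      hFm.comp (measurable_withNext.comp (measurable_const.prodMk measurable_id))
    -- The potential ignores `nextArrival`. Replacing its constant value by the average over the
    -- first arrival makes the two sides equal for each single value a.
    have hR : ∫⁻ a, (F (q.withNext a) + ENNReal.ofReal M *
        (vacationSet J).indicator 1 (q.withNext a)) ∂(expMeasure lam) =
        ∫⁻ a, ((if a < q.clock then ENNReal.ofReal (poissonAvg lam N
        (phaseValue m q.serving) (min (q.inSystem + 1) N) (q.clock - a))
        else ENNReal.ofReal (phaseValue m q.serving q.inSystem)) + ENNReal.ofReal M *
        (vacationSet J).indicator 1 (q.withNext a)) ∂(expMeasure lam) := by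
      rw [lintegral_add_left hmP, hP, lintegral_add_left hwm]
      congr 1
      simp only [hFq, lintegral_const, measure_univ, mul_one]
      rfl
    rw [hR]
    refine lintegral_congr fun a => ?_
    have hval : phaseValue m q.serving q.inSystem = m q.after := rfl
    have hafter : (q.withNext a).after = q.after := rfl
    have hnext : (q.withNext a).nextArrival = a := rfl
    have hclock : (q.withNext a).clock = q.clock := rfl
    have hj' : (q.withNext a).arrived < J := hj
    have hle : q.after ≤ N := by unfold QState.after; split_ifs <;> omega
    simp only [hH, Set.indicator_apply, serviceSet, vacationSet, Set.mem_ofPred_eq, Pi.one_apply,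
      hafter, hnext, hclock, hj', true_and, hval, QState.stoppedStep, if_true]
    by_cases hx : a < q.clock
    · have hstep : ∀ w : ℝ × ℝ × ℝ, F ((q.withNext a).step N w.1 w.2.1 w.2.2) =
          ENNReal.ofReal (poissonAvg lam N (phaseValue m q.serving) (min (q.inSystem + 1) N)
            (q.clock - a)) := by
        intro w
        rw [step_of_lt (q := q.withNext a) hx]; rfl
      simp only [hstep, lintegral_const, measure_univ, mul_one, hx, not_true_eq_false, false_and,
        if_false, if_true, mul_zero]
    · have hstep : ∀ w : ℝ × ℝ × ℝ, F ((q.withNext a).step N w.1 w.2.1 w.2.2) =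
          ENNReal.ofReal (poissonAvg lam N (phaseValue m (decide (q.after ≠ 0))) q.after
            (if q.after = 0 then w.2.2 else w.2.1)) := by
        intro w
        rw [step_of_not_lt (q := q.withNext a) hx]; rfl
      simp only [hstep, hx, not_false_eq_true, true_and, if_false]
      by_cases h0 : q.after = 0
      -- When the system is empty, the phase that ends contributes m 0 = 0 and the new vacation
      -- contributes M.
      · simp [h0, hvac, h.zero]
      · have h1 := h.one_le q.after (Nat.one_le_iff_ne_zero.2 h0)
        simp only [h0, ne_eq, not_false_eq_true, decide_true, if_false, if_true, mul_zero, add_zero,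
          hser q.after (Nat.one_le_iff_ne_zero.2 h0) hle]
        rw [← ENNReal.ofReal_one, ← ENNReal.ofReal_add (by linarith) zero_le_one]
        congr 1; ring
  · have h1 : ∀ a w, (q.withNext a).stoppedStep N J w = q.withNext a := fun a w => by
      rw [QState.stoppedStep, if_neg]; exact hj
    refine lintegral_congr fun a => ?_
    have hj' : ¬ (q.withNext a).arrived < J := hj
    simp [hH, h1, serviceSet, vacationSet, hj']

end Potential

/-! ### Balance of the expected numbers of events, and existence of the loss probability -/

section Loss

open QState

set_option linter.unusedSectionVars false

variable {Ω : Type*} [MeasurableSpace Ω] {P : Measure Ω} [IsProbabilityMeasure P] {lam : ℝ}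
  {σ υ : Measure ℝ} {A S V : ℕ → Ω → ℝ} (N J : ℕ)

local notation "Z" => stoppedQueue N J A S V

/-- A given customer arrives at no more than one event, so the probability of its loss is the sum
over k of the probabilities that it is lost at event k. Below J arrivals the stopped and the
original queue coincide. -/
lemma hasSum_measureReal_lossSet (hin : IsQueueInput P lam σ υ A S V) :
    HasSum (fun k => P.real (Z k ⁻¹' lossSet N J)) (∑ i ∈ Finset.range J,
      P.real {ω | CustomerLost N (fun k => A k ω) (fun k => S k ω) (fun k => V k ω) i}) := by
  let B : ℕ → Set QState := fun i => {q | q.arrived = i ∧ q.nextArrival < q.clock ∧ q.inSystem = N}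
  have hB : ∀ i, MeasurableSet (B i) := fun i =>
    (measurableSet_eq_fun measurable_arrived measurable_const).inter
      (measurableSet_arrival.inter (measurableSet_eq_fun measurable_inSystem measurable_const))
  have hdec : ∀ k, P.real (Z k ⁻¹' lossSet N J) = ∑ i ∈ Finset.range J, P.real (Z k ⁻¹' B i) := by
    intro k
    have : Z k ⁻¹' lossSet N J = ⋃ i ∈ Finset.range J, Z k ⁻¹' B i := by
      ext ω
      simp [lossSet, B, and_left_comm]
    rw [this, measureReal_biUnion_finset]
    · intro i _ j _ hij
      rw [Function.onFun, Set.disjoint_left]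
      intro ω h1 h2
      exact hij (h1.1.symm.trans h2.1)
    · exact fun i _ => measurable_stoppedQueue N J hin k (hB i)
  simp only [hdec]
  refine hasSum_sum fun i hi => ?_
  have hi : i < J := Finset.mem_range.1 hi
  have hset : {ω | CustomerLost N (fun k => A k ω) (fun k => S k ω) (fun k => V k ω) i} =
      ⋃ k, Z k ⁻¹' B i := by
    ext ω
    simp only [CustomerLost, Set.mem_ofPred_eq, Set.mem_iUnion, Set.mem_preimage, B]
    refine exists_congr fun k => ?_
    constructor
    · intro h
      have e : Z k ω = _ := stoppedPath_eq_queuePath k (Or.inl (h.1.trans_lt hi))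
      rw [e]; exact h
    · intro h
      have e : Z k ω = _ := stoppedPath_eq_queuePath k (Or.inr (h.1.trans_lt hi))
      rw [e] at h; exact h
  have hmono : ∀ ω k, (Z k ω).arrived ≤ (Z (k + 1) ω).arrived := by
    intro ω k
    rcases stoppedQueue_succ_cases (A := A) (S := S) (V := V) N J k ω rfl rfl rfl with
      ⟨-, -, h3⟩ | ⟨-, -, h3⟩ | ⟨-, h3⟩ <;> rw [h3]
    exact Nat.le_succ _
  have hdisj : ∀ k l, k < l → Disjoint (Z k ⁻¹' B i) (Z l ⁻¹' B i) := by
    intro k l hkl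
    rw [Set.disjoint_left]
    intro ω h1 h2
    have hm : Monotone fun k => (Z k ω).arrived := monotone_nat_of_le_succ (hmono ω)
    have hlt : (Z k ω).arrived < (Z (k + 1) ω).arrived := by
      have ha : (Z k ω).arrived < J := h1.1.trans_lt hi
      rcases stoppedQueue_succ_cases (A := A) (S := S) (V := V) N J k ω rfl rfl rfl with
        ⟨-, -, h3⟩ | ⟨-, h, -⟩ | ⟨h, -⟩
      · rw [h3]; exact Nat.lt_succ_self _
      · exact absurd h1.2.1 h
      · exact absurd ha h
    have h3 : (Z (k + 1) ω).arrived ≤ (Z l ω).arrived := hm hkl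
    have h4 : (Z k ω).arrived = i := h1.1
    have h5 : (Z l ω).arrived = i := h2.1
    omega
  have hU := measure_iUnion (μ := P) (f := fun k => Z k ⁻¹' B i)
    (fun k l hkl => by
      rcases lt_or_gt_of_ne hkl with h | h
      exacts [hdisj k l h, (hdisj l k h).symm])
    (fun k => measurable_stoppedQueue N J hin k (hB i))
  rw [← hset] at hU
  rw [measureReal_def, hU, ENNReal.tsum_toReal_eq fun k => measure_ne_top _ _]
  simp only [measureReal_def]
  exact ENNReal.hasSum_toReal (by rw [← hU]; exact measure_ne_top _ _)

/-- Here α, l, c, s, v stand for expected numbers of arrivals, losses, completions, starts of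
service and starts of vacations after time 0; n is the mean number present, w the probability of
serving, cl the mean clock and x the change of the potential. The relations h3 and h4 are linear in
s and v and give s = Mα/μ up to terms in cl and x, and h1, h2 give l = α - s + w - n. The bound s ≤
J + 1 comes from c ≤ α and w ≤ 1. -/
lemma abs_le_of_balance {α l c s v n w κ εs εv lam ES EV M C B cl x J : ℝ} (hlam : 0 < lam)
    (hES : 0 ≤ ES) (hEV : 0 < EV) (hM : 0 < M) (hεs : 0 ≤ εs) (hεv : 0 ≤ εv)
    (hn0 : 0 ≤ n) (hnB : n ≤ B) (hw0 : 0 ≤ w) (hw1 : w ≤ 1) (hx : |x| ≤ C)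
    (hl : 0 ≤ l) (hcl0 : 0 ≤ cl)
    (hcl : cl ≤ κ + εv + s * εs + v * εv) (hαJ : α ≤ J)
    (h1 : n = α - l - c) (h2 : w = s - c) (h3 : cl = EV - α * (1 / lam) + s * ES + v * EV)
    (h4 : x = M * v - s) :
    |l - α * (1 - M / (lam * EV + lam * ES * M))| ≤
      M / (lam * EV + lam * ES * M) * (lam * (κ + εv + (J + 1) * εs + (J + 1 + C) / M * εv)
        + lam * EV + lam * EV * C / M) + B + 1 := by
  set μ := lam * EV + lam * ES * M with hμ
  have hμ0 : 0 < μ := by positivity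
  have hsJ : s ≤ J + 1 := by linarith
  have hvJ : v ≤ (J + 1 + C) / M := by
    rw [le_div_iff₀ hM]; linarith [(abs_le.1 hx).2]
  have hcl' : cl ≤ κ + εv + (J + 1) * εs + (J + 1 + C) / M * εv := by
    have := mul_le_mul_of_nonneg_right hsJ hεs
    have := mul_le_mul_of_nonneg_right hvJ hεv
    linarith
  have e1 : s = M / μ * (α + (lam * cl - lam * EV - lam * EV * x / M)) := by
    rw [h3, h4, hμ]
    field_simp
    ring
  have e2 : l - α * (1 - M / μ) = -(M / μ * (lam * cl - lam * EV - lam * EV * x / M)) + (w - n) := by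
    have : l = α - s + w - n := by linarith
    rw [this]
    nth_rewrite 1 [e1]
    ring
  have hlx : |lam * cl - lam * EV - lam * EV * x / M| ≤
      lam * (κ + εv + (J + 1) * εs + (J + 1 + C) / M * εv) + lam * EV + lam * EV * C / M := by
    have a1 : |lam * EV * x / M| ≤ lam * EV * C / M := by
      rw [abs_div, abs_mul, abs_of_pos hM, abs_of_pos (by positivity : 0 < lam * EV)]
      gcongr
    have a2 : |lam * cl| ≤ lam * (κ + εv + (J + 1) * εs + (J + 1 + C) / M * εv) := by
      rw [abs_of_nonneg (by positivity)]; gcongr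
    have a3 : |lam * EV| = lam * EV := abs_of_pos (by positivity)
    calc _ ≤ |lam * cl - lam * EV| + |lam * EV * x / M| := abs_sub _ _
      _ ≤ |lam * cl| + |lam * EV| + |lam * EV * x / M| := by gcongr; exact abs_sub _ _
      _ ≤ _ := by rw [a3]; gcongr
  rw [e2]
  calc _ ≤ |-(M / μ * (lam * cl - lam * EV - lam * EV * x / M))| + |w - n| := abs_add_le _ _
    _ ≤ M / μ * (lam * (κ + εv + (J + 1) * εs + (J + 1 + C) / M * εv)
        + lam * EV + lam * EV * C / M) + (B + 1) := by
      refine add_le_add ?_ (abs_le.2 ⟨by linarith, by linarith⟩)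
      rw [abs_neg, abs_mul, abs_of_pos (by positivity : 0 < M / μ)]
      gcongr
    _ = _ := by ring

lemma tendsto_integral_excess {ν : Measure ℝ} (hν : ν (Set.Iio 0) = 0)
    (hi : Integrable (fun t : ℝ => t) ν) :
    Tendsto (fun κ : ℕ => ∫ t, max (t - κ) 0 ∂ν) atTop (𝓝 0) := by
  have h0 : ∀ᵐ t ∂ν, 0 ≤ t := by rw [ae_iff]; simp only [not_le]; exact hν
  have h := tendsto_integral_of_dominated_convergence (μ := ν) (F := fun (κ : ℕ) t => max (t - κ) 0)
    (f := fun _ => 0) (fun t => t) (fun κ => by fun_prop) hi ?_ ?_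
  · simpa using h
  · intro κ
    filter_upwards [h0] with t ht
    rw [Real.norm_eq_abs, abs_of_nonneg (le_max_right _ _)]
    exact max_le (by linarith [(Nat.cast_nonneg κ : (0 : ℝ) ≤ κ)]) ht
  · refine ae_of_all _ fun t => ?_
    obtain ⟨n, hn⟩ := exists_nat_ge t
    refine tendsto_const_nhds.congr' ?_
    filter_upwards [eventually_ge_atTop n] with k hk
    have : (n : ℝ) ≤ k := by exact_mod_cast hk
    exact (max_eq_right (by linarith)).symm

/-- The one-step identities are summed over the first K events, where the bound does not depend on
K, and then K → ∞. What matters afterwards is that the coefficient of J on the right contains only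
the mean excesses over κ, which are small for large κ. -/
lemma abs_sum_loss_sub_le (hin : IsQueueInput P lam σ υ A S V) (hlam : 0 < lam) (hN : 1 ≤ N)
    (hσ : σ (Set.Iio 0) = 0) (hυ : υ (Set.Iio 0) = 0) (hσi : Integrable (fun t : ℝ => t) σ)
    (hυi : Integrable (fun t : ℝ => t) υ) (hυpos : 0 < ∫ t, t ∂υ) {M : ℝ} {m : ℕ → ℝ}
    (h : IsMeanServices lam σ υ N m M) (κ : ℕ) :
    |(∑ i ∈ Finset.range J,
      P.real {ω | CustomerLost N (fun k => A k ω) (fun k => S k ω) (fun k => V k ω) i}) -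
      J * (1 - M / (lam * (∫ t, t ∂υ) + lam * (∫ t, t ∂σ) * M))| ≤
    M / (lam * (∫ t, t ∂υ) + lam * (∫ t, t ∂σ) * M) * (lam * (κ + ∫ t, max (t - κ) 0 ∂υ +
      (J + 1) * ∫ t, max (t - κ) 0 ∂σ +
      (J + 1 + ∑ i ∈ Finset.range (N + 1), m i) / M * ∫ t, max (t - κ) 0 ∂υ)
        + lam * (∫ t, t ∂υ) + lam * (∫ t, t ∂υ) * (∑ i ∈ Finset.range (N + 1), m i) / M) + N + 1 := by
  set α : ℕ → ℝ := fun K => ∑ k ∈ Finset.range K, P.real (Z k ⁻¹' arrivalSet J) with hα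
  set l : ℕ → ℝ := fun K => ∑ k ∈ Finset.range K, P.real (Z k ⁻¹' lossSet N J) with hl
  set c : ℕ → ℝ := fun K => ∑ k ∈ Finset.range K, P.real (Z k ⁻¹' completionSet J) with hc
  set s : ℕ → ℝ := fun K => ∑ k ∈ Finset.range K, P.real (Z k ⁻¹' serviceSet J) with hs
  set v : ℕ → ℝ := fun K => ∑ k ∈ Finset.range K, P.real (Z k ⁻¹' vacationSet J) with hv
  set C := ∑ i ∈ Finset.range (N + 1), m i with hC
  have hC0 : 0 ≤ C := Finset.sum_nonneg fun i _ => h.nonneg N i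
  have hα0 : ∀ K, 0 ≤ α K := fun K => Finset.sum_nonneg fun _ _ => measureReal_nonneg
  have hl0 : ∀ K, 0 ≤ l K := fun K => Finset.sum_nonneg fun _ _ => measureReal_nonneg
  have hES : 0 ≤ ∫ t, t ∂σ := integral_nonneg_of_ae <| by
    rw [EventuallyLE, ae_iff]; simp only [Pi.zero_apply, not_le]; exact hσ
  have hn : ∀ K, ∫ ω, ((Z K ω).inSystem : ℝ) ∂P = α K - l K - c K := by
    intro K
    induction K with
    | zero => simp [stoppedQueue_zero, hα, hl, hc]
    | succ K ih =>
      rw [integral_inSystem_succ N J hin hN, ih]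
      simp only [hα, hl, hc, Finset.sum_range_succ]; ring
  have hw : ∀ K, P.real (Z K ⁻¹' {q | q.serving = true}) = s K - c K := by
    intro K
    induction K with
    | zero => simp [stoppedQueue_zero, hs, hc, Set.preimage]
    | succ K ih =>
      rw [measureReal_serving_succ N J hin, ih]
      simp only [hs, hc, Finset.sum_range_succ]; ring
  have harr : ∀ K, ∫ ω, ((Z K ω).arrived : ℝ) ∂P = α K := by
    intro K
    induction K with
    | zero => simp [stoppedQueue_zero, hα]
    | succ K ih =>
      rw [integral_arrived_succ N J hin, ih]
      simp only [hα, Finset.sum_range_succ]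
  have hcl : ∀ K, ∫ ω, (Z K ω).clock ∂P =
      (∫ t, t ∂υ) - α K * (1 / lam) + s K * (∫ t, t ∂σ) + v K * (∫ t, t ∂υ) := by
    intro K
    induction K with
    | zero =>
      have := (hin.integral_vacation measurable_id hυi 0).2
      simp only [id] at this
      simp [stoppedQueue_zero, hα, hs, hv, this]
    | succ K ih =>
      rw [integral_clock_succ N J hin hlam hσ hυ hσi hυi, ih]
      simp only [hα, hs, hv, Finset.sum_range_succ]; ring
  have hσp : IsProbabilityMeasure σ := by
    rw [← hin.law_service 0]
    exact Measure.isProbabilityMeasure_map (hin.measurable_service 0).aemeasurable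
  have hυp : IsProbabilityMeasure υ := by
    rw [← hin.law_vacation 0]
    exact Measure.isProbabilityMeasure_map (hin.measurable_vacation 0).aemeasurable
  have hex : ∀ K, ∫ ω, max ((Z K ω).clock - κ) 0 ∂P ≤ (∫ t, max (t - κ) 0 ∂υ) +
      s K * (∫ t, max (t - κ) 0 ∂σ) + v K * (∫ t, max (t - κ) 0 ∂υ) := by
    intro K
    induction K with
    | zero =>
      have := (hin.integral_vacation (f := fun t : ℝ => max (t - κ) 0) (by fun_prop)
        (hυi.sub (integrable_const (κ : ℝ))).pos_part 0).2
      simp [stoppedQueue_zero, hs, hv, this]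
    | succ K ih =>
      refine (integral_clock_excess_succ N J hin hlam hσ hυ hσi hυi κ K).trans ?_
      simp only [hs, hv, Finset.sum_range_succ] at ih ⊢
      linarith
  have hclK : ∀ K, 0 ≤ ∫ ω, (Z K ω).clock ∂P ∧ ∫ ω, (Z K ω).clock ∂P ≤
      κ + (∫ t, max (t - κ) 0 ∂υ) + s K * (∫ t, max (t - κ) 0 ∂σ) +
        v K * (∫ t, max (t - κ) 0 ∂υ) := by
    intro K
    refine ⟨integral_nonneg_of_ae (stoppedQueue_clock_nonneg N J hin hσ hυ K), ?_⟩
    have ic := integrable_clock_stoppedQueue N J hin hlam hσ hυ hσi hυi K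
    have ie : Integrable (fun ω => max ((Z K ω).clock - (κ : ℝ)) 0) P :=
      (ic.sub (integrable_const (κ : ℝ))).pos_part
    have : ∫ ω, (Z K ω).clock ∂P ≤ ∫ ω, ((κ : ℝ) + max ((Z K ω).clock - κ) 0) ∂P :=
      integral_mono ic ((integrable_const (κ : ℝ)).add ie) fun ω => by
        have := le_max_left ((Z K ω).clock - (κ : ℝ)) 0
        linarith
    rw [integral_add (integrable_const _) ie] at this
    simp only [integral_const, probReal_univ, one_smul] at this
    linarith [hex K]
  -- The witness x is the change of the mean potential from event 0 to event K; both values lie in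
  -- [0, C].
  have hΦ : ∀ K, ∃ x : ℝ, |x| ≤ C ∧ x = M * v K - s K := by
    have hF : ∀ K, ∫⁻ ω, futureServices N lam m (Z K ω) ∂P ≤ ENNReal.ofReal C := by
      intro K
      calc _ ≤ ∫⁻ _, ENNReal.ofReal C ∂P := by
            refine lintegral_mono_ae ?_
            filter_upwards [stoppedQueue_clock_nonneg N J hin hσ hυ K] with ω hω
            exact ENNReal.ofReal_le_ofReal
              (poissonAvg_bounds hlam hω (h.phaseValue_bounds N _) _).2
        _ = _ := by simp
    have hfin : ∀ K, ∫⁻ ω, futureServices N lam m (Z K ω) ∂P ≠ ⊤ := fun K =>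
      ((hF K).trans_lt ENNReal.ofReal_lt_top).ne
    have hrec : ∀ K, (∫⁻ ω, futureServices N lam m (Z K ω) ∂P).toReal =
        (∫⁻ ω, futureServices N lam m (Z 0 ω) ∂P).toReal + M * v K - s K := by
      intro K
      induction K with
      | zero => simp [hs, hv]
      | succ K ih =>
        have e := congrArg ENNReal.toReal
          (lintegral_futureServices_succ N J hin hlam hN hσ hυ h K)
        rw [ENNReal.toReal_add (hfin _) (measure_ne_top _ _),
          ENNReal.toReal_add (hfin _) (ENNReal.mul_ne_top ENNReal.ofReal_ne_top
            (measure_ne_top _ _)), ENNReal.toReal_mul, ENNReal.toReal_ofReal h.pos.le, ih,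
          ← measureReal_def, ← measureReal_def] at e
        simp only [hs, hv, Finset.sum_range_succ] at e ⊢
        linarith
    intro K
    refine ⟨_, ?_, rfl⟩
    have b : ∀ K, 0 ≤ (∫⁻ ω, futureServices N lam m (Z K ω) ∂P).toReal ∧
        (∫⁻ ω, futureServices N lam m (Z K ω) ∂P).toReal ≤ C := fun K =>
      ⟨ENNReal.toReal_nonneg, ENNReal.toReal_le_of_le_ofReal hC0 (hF K)⟩
    have b1 := b K
    have b0 := b 0
    have r := hrec K
    rw [abs_le]; constructor <;> linarith [b1.1, b1.2, b0.1, b0.2]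
  have iarr : ∀ K, Integrable (fun ω => ((Z K ω).arrived : ℝ)) P := fun K => by
    refine Integrable.of_bound (C := J) (measurable_from_top.comp (measurable_arrived.comp
      (measurable_stoppedQueue N J hin K))).aestronglyMeasurable (ae_of_all _ fun ω => ?_)
    rw [Real.norm_natCast]; exact_mod_cast stoppedPath_arrived_le K
  have hαJ : ∀ K, α K ≤ J := fun K => by
    rw [← harr K]
    calc _ ≤ ∫ _, (J : ℝ) ∂P := integral_mono (iarr K) (integrable_const _) fun ω => by
          have : (Z K ω).arrived ≤ J := stoppedPath_arrived_le K
          exact Nat.cast_le.2 this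
      _ = J := by simp
  have hnB : ∀ K, 0 ≤ ∫ ω, ((Z K ω).inSystem : ℝ) ∂P ∧ ∫ ω, ((Z K ω).inSystem : ℝ) ∂P ≤ N := by
    intro K
    refine ⟨integral_nonneg fun ω => Nat.cast_nonneg _, ?_⟩
    calc _ ≤ ∫ _, (N : ℝ) ∂P := by
          refine integral_mono_of_nonneg (ae_of_all _ fun ω => Nat.cast_nonneg _)
            (integrable_const _) (ae_of_all _ fun ω => ?_)
          have : (Z K ω).inSystem ≤ N := (stoppedPath_inSystem hN K).1
          exact Nat.cast_le.2 this
      _ = N := by simp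
  have hεσ : 0 ≤ ∫ t, max (t - (κ : ℝ)) 0 ∂σ := integral_nonneg fun t => le_max_right _ _
  have hευ : 0 ≤ ∫ t, max (t - (κ : ℝ)) 0 ∂υ := integral_nonneg fun t => le_max_right _ _
  have hbound : ∀ K, |l K - α K * (1 - M / (lam * (∫ t, t ∂υ) + lam * (∫ t, t ∂σ) * M))| ≤ _ :=
    fun K => by
      obtain ⟨x, hx, hx'⟩ := hΦ K
      exact abs_le_of_balance hlam hES hυpos h.pos hεσ hευ (hnB K).1 (hnB K).2
        measureReal_nonneg measureReal_le_one hx (hl0 K) (hclK K).1 (hclK K).2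
        (hαJ K) (hn K) (hw K) (hcl K) hx'
  -- Each event before the J-th arrival is an arrival, a start of a service or a start of a
  -- vacation, and all three expected numbers are bounded in K. So the probability of still being
  -- below J arrivals tends to 0, which gives α K → J.
  have hact : Summable fun k => P.real (Z k ⁻¹' activeSet J) := by
    refine summable_of_sum_range_le (c := J + (J + 1) + (J + 1 + C) / M)
      (fun _ => measureReal_nonneg) fun K => ?_
    have e : ∑ k ∈ Finset.range K, P.real (Z k ⁻¹' activeSet J) = α K + s K + v K := by
      simp only [measureReal_activeSet N J hin, Finset.sum_add_distrib, hα, hs, hv]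
    have hw1 : s K - c K ≤ 1 := by rw [← hw K]; exact measureReal_le_one
    have hn0 : 0 ≤ α K - l K - c K := by rw [← hn K]; exact (hnB K).1
    have hsJ : s K ≤ J + 1 := by linarith [hαJ K, hl0 K]
    have hvJ : v K ≤ (J + 1 + C) / M := by
      obtain ⟨x, hx, hx'⟩ := hΦ K
      rw [le_div_iff₀ h.pos]; linarith [(abs_le.1 hx).2]
    rw [e]; linarith [hαJ K]
  have hαlim : Tendsto α atTop (𝓝 J) := by
    have h1 : Tendsto (fun K => (J : ℝ) - J * P.real (Z K ⁻¹' activeSet J)) atTop (𝓝 J) := by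
      simpa using (hact.tendsto_atTop_zero.const_mul (J : ℝ)).const_sub (J : ℝ)
    refine tendsto_of_tendsto_of_tendsto_of_le_of_le h1 tendsto_const_nhds (fun K => ?_) hαJ
    have i1 := integrable_indicator_stoppedQueue N J hin K (measurableSet_activeSet J)
    simp only
    rw [← harr K, ← integral_indicator_stoppedQueue N J hin K (measurableSet_activeSet J),
      ← integral_const_mul]
    have : (J : ℝ) = ∫ _, (J : ℝ) ∂P := by simp
    nth_rewrite 1 [this]
    rw [← integral_sub (integrable_const _) (i1.const_mul _)]
    refine integral_mono ((integrable_const _).sub (i1.const_mul _)) (iarr K) fun ω => ?_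
    by_cases ha : (Z K ω).arrived < J
    · simp [activeSet, ha]
    · simp only [Set.indicator_apply, activeSet, Set.mem_ofPred_eq, ha, if_false, mul_zero,
        sub_zero]
      exact_mod_cast not_lt.1 ha
  have hllim := (hasSum_measureReal_lossSet N J hin).tendsto_sum_nat
  exact le_of_tendsto ((hllim.sub (hαlim.mul_const _)).abs) (Eventually.of_forall hbound)

theorem isLossProbability_of_isMeanServices (hin : IsQueueInput P lam σ υ A S V) (hlam : 0 < lam)
    (hN : 1 ≤ N) (hσ : σ (Set.Iio 0) = 0) (hυ : υ (Set.Iio 0) = 0)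
    (hσi : Integrable (fun t : ℝ => t) σ) (hυi : Integrable (fun t : ℝ => t) υ)
    (hυpos : 0 < ∫ t, t ∂υ) {M : ℝ} {m : ℕ → ℝ} (h : IsMeanServices lam σ υ N m M) :
    IsLossProbability P A S V N (1 - M / (lam * (∫ t, t ∂υ) + lam * (∫ t, t ∂σ) * M)) := by
  set p := 1 - M / (lam * (∫ t, t ∂υ) + lam * (∫ t, t ∂σ) * M) with hp
  set D := M / (lam * (∫ t, t ∂υ) + lam * (∫ t, t ∂σ) * M)
  set C := ∑ i ∈ Finset.range (N + 1), m i with hC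
  set L : ℕ → ℝ := fun n => ∑ i ∈ Finset.range n,
      P.real {ω | CustomerLost N (fun k => A k ω) (fun k => S k ω) (fun k => V k ω) i} with hL
  set εs : ℕ → ℝ := fun κ => ∫ t, max (t - κ) 0 ∂σ
  set εv : ℕ → ℝ := fun κ => ∫ t, max (t - κ) 0 ∂υ
  have hεs : Tendsto εs atTop (𝓝 0) := tendsto_integral_excess hσ hσi
  have hεv : Tendsto εv atTop (𝓝 0) := tendsto_integral_excess hυ hυi
  set a : ℕ → ℝ := fun κ => D * (lam * (εs κ + εv κ / M)) with ha
  set b : ℕ → ℝ := fun κ => D * (lam * (κ + εv κ + εs κ + (1 + C) / M * εv κ)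
        + lam * (∫ t, t ∂υ) + lam * (∫ t, t ∂υ) * C / M) + N + 1 with hb
  have hbound : ∀ κ J, |L J - J * p| ≤ b κ + a κ * J := fun κ J => by
    refine (abs_sum_loss_sub_le N J hin hlam hN hσ hυ hσi hυi hυpos h κ).trans (le_of_eq ?_)
    simp only [ha, hb]
    ring
  have ha0 : Tendsto a atTop (𝓝 0) := by
    have := ((hεs.add (hεv.div_const M)).const_mul lam).const_mul D
    simpa using this
  rw [IsLossProbability, Metric.tendsto_atTop]
  intro ε hε
  -- The truncation level κ is fixed first, to make the slope in J less than ε/2; then n grows to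
  -- absorb the constant `b κ`.
  obtain ⟨κ, hκ⟩ := ((tendsto_order.1 ha0).2 (ε / 2) (by positivity)).exists
  have hb0 : Tendsto (fun n : ℕ => b κ / n) atTop (𝓝 0) :=
    tendsto_const_nhds.div_atTop tendsto_natCast_atTop_atTop
  obtain ⟨n0, hn0⟩ := (eventually_atTop.1 ((tendsto_order.1 hb0).2 (ε / 2) (by positivity)))
  refine ⟨n0 + 1, fun n hn => ?_⟩
  have hnpos : (0 : ℝ) < n := by exact_mod_cast (by omega : 0 < n)
  have h1 := hn0 n (by omega)
  rw [Real.dist_eq]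
  change |L n / n - p| < ε
  have e : L n / n - p = (L n - n * p) / n := by field_simp
  rw [e, abs_div, abs_of_pos hnpos, div_lt_iff₀ hnpos]
  rw [div_lt_iff₀ hnpos] at h1
  have := hbound κ n
  have := mul_lt_mul_of_pos_right hκ hnpos
  linarith

end Loss

/-! ### Numbers of arrivals in a random time -/

/-- The probability of `k` arrivals in a time with law `ν`. -/
noncomputable def mixedPoisson (lam : ℝ) (ν : Measure ℝ) (k : ℕ) : ℝ := ∫ t, poissonProb lam k t ∂ν

section MixedPoisson

variable {lam : ℝ} {ν : Measure ℝ}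

lemma ae_nonneg_of_measure_Iio (hν : ν (Set.Iio 0) = 0) : ∀ᵐ t ∂ν, 0 ≤ t := by
  rw [ae_iff]; simp only [not_le]; exact hν

lemma mixedPoisson_nonneg (hlam : 0 < lam) (hν : ν (Set.Iio 0) = 0) (k : ℕ) :
    0 ≤ mixedPoisson lam ν k := by
  refine integral_nonneg_of_ae ?_
  filter_upwards [ae_nonneg_of_measure_Iio hν] with t ht using poissonProb_nonneg hlam ht k

variable [IsProbabilityMeasure ν]

lemma integrable_poissonProb (hlam : 0 < lam) (hν : ν (Set.Iio 0) = 0) (k : ℕ) :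
    Integrable (poissonProb lam k) ν := by
  refine Integrable.of_bound (C := 1) (continuous_poissonProb _ _).aestronglyMeasurable ?_
  filter_upwards [ae_nonneg_of_measure_Iio hν] with t ht
  rw [Real.norm_eq_abs, abs_of_nonneg (poissonProb_nonneg hlam ht k)]
  exact poissonProb_le_one hlam ht k

lemma ofReal_mixedPoisson (hlam : 0 < lam) (hν : ν (Set.Iio 0) = 0) (k : ℕ) :
    ENNReal.ofReal (mixedPoisson lam ν k) = ∫⁻ t, ENNReal.ofReal (poissonProb lam k t) ∂ν := by
  refine ofReal_integral_eq_lintegral_ofReal (integrable_poissonProb hlam hν k) ?_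
  filter_upwards [ae_nonneg_of_measure_Iio hν] with t ht using poissonProb_nonneg hlam ht k

lemma hasSum_poissonProb_mul_pow (lam x t : ℝ) :
    HasSum (fun k => poissonProb lam k t * x ^ k) (Real.exp (-(lam - lam * x) * t)) := by
  have h := (NormedSpace.expSeries_div_hasSum_exp (lam * t * x)).mul_left (Real.exp (-(lam * t)))
  rw [← Real.exp_eq_exp_ℝ, ← Real.exp_add] at h
  convert! h using 1
  · ext k; unfold poissonProb; rw [mul_pow _ x]; ring
  · ring_nf

/-- Tonelli's theorem for the Poisson generating function. Working in [0, ∞] includes the case of an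
infinite transform, which part (ii) allows at r. -/
lemma tsum_mixedPoisson_mul_pow (hlam : 0 < lam) (hν : ν (Set.Iio 0) = 0) {x : ℝ} (hx : 0 ≤ x) :
    ∑' k, ENNReal.ofReal (mixedPoisson lam ν k * x ^ k) = realLst ν (lam - lam * x) := by
  have hm : ∀ k, Measurable fun t => ENNReal.ofReal (poissonProb lam k t) := fun k =>
    (continuous_poissonProb lam k).measurable.ennreal_ofReal
  have e : ∀ k, ENNReal.ofReal (mixedPoisson lam ν k * x ^ k) =
      ∫⁻ t, ENNReal.ofReal (poissonProb lam k t) * ENNReal.ofReal (x ^ k) ∂ν := fun k => by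
    rw [ENNReal.ofReal_mul (mixedPoisson_nonneg hlam hν k), ofReal_mixedPoisson hlam hν,
      lintegral_mul_const _ (hm k)]
  simp only [e]
  rw [← lintegral_tsum fun k => ((hm k).mul_const _).aemeasurable, realLst]
  refine lintegral_congr_ae ?_
  filter_upwards [ae_nonneg_of_measure_Iio hν] with t ht
  have hs := hasSum_poissonProb_mul_pow lam x t
  rw [← hs.tsum_eq, ENNReal.ofReal_tsum_of_nonneg
    (fun k => mul_nonneg (poissonProb_nonneg hlam ht k) (pow_nonneg hx k)) hs.summable]
  exact tsum_congr fun k => (ENNReal.ofReal_mul (poissonProb_nonneg hlam ht k)).symm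

lemma hasSum_mixedPoisson_mul_pow (hlam : 0 < lam) (hν : ν (Set.Iio 0) = 0) {x : ℝ} (hx : 0 ≤ x)
    (h : realLst ν (lam - lam * x) ≠ ⊤) :
    HasSum (fun k => mixedPoisson lam ν k * x ^ k) (realLst ν (lam - lam * x)).toReal := by
  have hnn : ∀ k, 0 ≤ mixedPoisson lam ν k * x ^ k := fun k =>
    mul_nonneg (mixedPoisson_nonneg hlam hν k) (pow_nonneg hx k)
  rw [← tsum_mixedPoisson_mul_pow hlam hν hx] at h ⊢
  convert! ENNReal.hasSum_toReal h using 1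
  · ext k; rw [ENNReal.toReal_ofReal (hnn k)]
  · rw [ENNReal.tsum_toReal_eq fun k => ENNReal.ofReal_ne_top]

lemma hasSum_mixedPoisson (hlam : 0 < lam) (hν : ν (Set.Iio 0) = 0) :
    HasSum (mixedPoisson lam ν) 1 := by
  have h1 : realLst ν (lam - lam * 1) = 1 := by simp [realLst]
  have h := hasSum_mixedPoisson_mul_pow hlam hν zero_le_one (h1 ▸ ENNReal.one_ne_top)
  rw [h1] at h
  simpa using h

lemma mixedPoisson_zero_pos (hν : ν (Set.Iio 0) = 0) (hlam : 0 < lam) :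
    0 < mixedPoisson lam ν 0 := by
  have hpos : ∀ t, 0 < poissonProb lam 0 t := fun t => by unfold poissonProb; positivity
  rw [mixedPoisson, integral_pos_iff_support_of_nonneg (fun t => (hpos t).le)
    (integrable_poissonProb hlam hν 0)]
  rw [Function.support_eq_univ fun t => (hpos t).ne']
  simp

lemma tsum_nat_mul_mixedPoisson (hlam : 0 < lam) (hν : ν (Set.Iio 0) = 0)
    (hi : Integrable (fun t : ℝ => t) ν) :
    ∑' k : ℕ, ENNReal.ofReal (mixedPoisson lam ν k) * ENNReal.ofReal k =
      ENNReal.ofReal (lam * ∫ t, t ∂ν) := by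
  have hm : ∀ k, Measurable fun t => ENNReal.ofReal (poissonProb lam k t) := fun k =>
    (continuous_poissonProb lam k).measurable.ennreal_ofReal
  have e : ∀ k : ℕ, ENNReal.ofReal (mixedPoisson lam ν k) * ENNReal.ofReal k =
      ∫⁻ t, ENNReal.ofReal (poissonProb lam k t) * ENNReal.ofReal k ∂ν := fun k => by
    rw [ofReal_mixedPoisson hlam hν, lintegral_mul_const _ (hm k)]
  simp only [e]
  rw [← lintegral_tsum fun k => ((hm k).mul_const _).aemeasurable, ← integral_const_mul,
    ofReal_integral_eq_lintegral_ofReal (hi.const_mul lam)]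
  · refine lintegral_congr_ae ?_
    filter_upwards [ae_nonneg_of_measure_Iio hν] with t ht
    have hs : HasSum (fun k : ℕ => poissonProb lam k t * k) (lam * t) := by
      rw [← hasSum_nat_add_iff' 1]
      convert! (hasSum_poissonProb hlam ht).mul_left (lam * t) using 1
      · ext k
        have hk : ((k + 1).factorial : ℝ) = (k + 1) * k.factorial := by
          rw [Nat.factorial_succ]; push_cast; ring
        have h1 : (k.factorial : ℝ) ≠ 0 := by positivity
        have h2 : (k + 1 : ℝ) ≠ 0 := by positivity
        unfold poissonProb
        rw [hk]
        push_cast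
        field_simp
        ring
      · simp
    rw [← hs.tsum_eq, ENNReal.ofReal_tsum_of_nonneg
      (fun k => mul_nonneg (poissonProb_nonneg hlam ht k) (Nat.cast_nonneg k)) hs.summable]
    exact tsum_congr fun k => (ENNReal.ofReal_mul (poissonProb_nonneg hlam ht k)).symm
  · filter_upwards [ae_nonneg_of_measure_Iio hν] with t ht using mul_nonneg hlam.le ht

lemma integral_poissonAvg (hlam : 0 < lam) (hν : ν (Set.Iio 0) = 0) (N : ℕ) (u : ℕ → ℝ) (n : ℕ) :
    ∫ t, poissonAvg lam N u n t ∂ν =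
      u N + ∑ j ∈ Finset.range (N - n), mixedPoisson lam ν j * (u (n + j) - u N) := by
  unfold poissonAvg
  rw [integral_add (integrable_const _) (integrable_finsetSum _ fun j _ =>
    (integrable_poissonProb hlam hν j).mul_const _), integral_finsetSum _ fun j _ =>
    (integrable_poissonProb hlam hν j).mul_const _]
  simp [integral_mul_const, mixedPoisson]

end MixedPoisson

/-! ### Tail sums and generating functions -/

section Tail

variable {a : ℕ → ℝ}

lemma tail_eq_tsum (ha : HasSum a 1) (k : ℕ) :
    1 - ∑ j ∈ Finset.range (k + 1), a j = ∑' j, a (j + (k + 1)) := by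
  rw [← ha.tsum_eq, ← ha.summable.sum_add_tsum_nat_add (k + 1)]; ring

lemma tail_nonneg (ha0 : ∀ k, 0 ≤ a k) (ha : HasSum a 1) (k : ℕ) :
    0 ≤ 1 - ∑ j ∈ Finset.range (k + 1), a j := by
  rw [tail_eq_tsum ha]; exact tsum_nonneg fun j => ha0 _

/-- Both sides sum a_j x^k over k < j, in the two orders. -/
lemma tsum_tail_mul_pow (ha0 : ∀ k, 0 ≤ a k) (ha : HasSum a 1) {x : ℝ} (hx : 0 ≤ x) :
    ∑' k, ENNReal.ofReal ((1 - ∑ j ∈ Finset.range (k + 1), a j) * x ^ k) =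
      ∑' j, ENNReal.ofReal (a j) * ENNReal.ofReal (∑ k ∈ Finset.range j, x ^ k) := by
  have e1 : ∀ k, ENNReal.ofReal ((1 - ∑ j ∈ Finset.range (k + 1), a j) * x ^ k) =
      ∑' j, if k < j then ENNReal.ofReal (a j) * ENNReal.ofReal (x ^ k) else 0 := by
    intro k
    have hs : Summable fun j => a (j + (k + 1)) := (summable_nat_add_iff (k + 1)).2 ha.summable
    rw [ENNReal.ofReal_mul (tail_nonneg ha0 ha k), tail_eq_tsum ha,
      ENNReal.ofReal_tsum_of_nonneg (fun j => ha0 _) hs, ← ENNReal.tsum_mul_right,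
      ← Summable.sum_add_tsum_nat_add' (k := k + 1)
        (f := fun j => if k < j then ENNReal.ofReal (a j) * ENNReal.ofReal (x ^ k) else 0)
        ENNReal.summable]
    rw [Finset.sum_eq_zero fun i hi => if_neg (by have := Finset.mem_range.1 hi; omega), zero_add]
    exact tsum_congr fun j => (if_pos (by omega)).symm
  simp only [e1]
  rw [ENNReal.tsum_comm]
  refine tsum_congr fun j => ?_
  rw [ENNReal.ofReal_sum_of_nonneg fun k _ => pow_nonneg hx k, Finset.mul_sum,
    tsum_eq_sum (s := Finset.range j) fun k hk => if_neg (by simpa using hk)]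
  exact Finset.sum_congr rfl fun k hk => if_pos (Finset.mem_range.1 hk)

lemma summable_tail_mul_pow (ha0 : ∀ k, 0 ≤ a k) (ha : HasSum a 1) {x : ℝ} (hx : 1 < x)
    (h : Summable fun k => a k * x ^ k) :
    Summable fun k => (1 - ∑ j ∈ Finset.range (k + 1), a j) * x ^ k := by
  have hnn : ∀ k, 0 ≤ (1 - ∑ j ∈ Finset.range (k + 1), a j) * x ^ k := fun k =>
    mul_nonneg (tail_nonneg ha0 ha k) (by positivity)
  have h1 : ∑' k, ENNReal.ofReal ((1 - ∑ j ∈ Finset.range (k + 1), a j) * x ^ k) ≠ ⊤ := by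
    rw [tsum_tail_mul_pow ha0 ha (by linarith)]
    have h2 : ∑' j, ENNReal.ofReal (a j * x ^ j * (1 / (x - 1))) ≠ ⊤ :=
      (h.mul_right _).tsum_ofReal_ne_top
    refine ne_top_of_le_ne_top h2 (ENNReal.tsum_le_tsum fun j => ?_)
    rw [← ENNReal.ofReal_mul (ha0 j), mul_assoc]
    refine ENNReal.ofReal_le_ofReal (mul_le_mul_of_nonneg_left ?_ (ha0 j))
    rw [geom_sum_eq hx.ne', mul_one_div]
    exact div_le_div_of_nonneg_right (by linarith) (by linarith)
  have h2 := ENNReal.summable_toReal h1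
  simpa only [ENNReal.toReal_ofReal (hnn _)] using h2

end Tail

lemma hasSum_tail_mixedPoisson {lam : ℝ} {ν : Measure ℝ} [IsProbabilityMeasure ν] (hlam : 0 < lam)
    (hν : ν (Set.Iio 0) = 0) (hi : Integrable (fun t : ℝ => t) ν) :
    HasSum (fun k => 1 - ∑ j ∈ Finset.range (k + 1), mixedPoisson lam ν j)
      (lam * ∫ t, t ∂ν) := by
  have h0 := mixedPoisson_nonneg hlam hν
  have h1 := hasSum_mixedPoisson hlam hν
  have h := tsum_tail_mul_pow h0 h1 zero_le_one
  simp only [one_pow, mul_one, Finset.sum_const, Finset.card_range, nsmul_eq_mul] at h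
  rw [tsum_nat_mul_mixedPoisson hlam hν hi] at h
  have hf : ∑' k, ENNReal.ofReal (1 - ∑ j ∈ Finset.range (k + 1), mixedPoisson lam ν j) ≠ ⊤ := by
    rw [h]; exact ENNReal.ofReal_ne_top
  have hm : 0 ≤ lam * ∫ t, t ∂ν := mul_nonneg hlam.le
    (integral_nonneg_of_ae (ae_nonneg_of_measure_Iio hν))
  have h2 := ENNReal.hasSum_toReal hf
  rw [← ENNReal.tsum_toReal_eq fun k => ENNReal.ofReal_ne_top, h, ENNReal.toReal_ofReal hm] at h2
  simpa only [ENNReal.toReal_ofReal (tail_nonneg h0 h1 _)] using h2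

/-! ### Generating functions for the number of services in a cycle -/

namespace PowerSeries

lemma coeff_mul_mk_one (f : PowerSeries ℝ) (n : ℕ) :
    coeff n (f * mk 1) = ∑ k ∈ Finset.range (n + 1), coeff k f := by
  rw [coeff_mul, Finset.Nat.sum_antidiagonal_eq_sum_range_succ_mk]
  simp

/-- The generating function of the tails `1 - ∑ j ≤ k, coeff j f`. -/
noncomputable def tailSeries (f : PowerSeries ℝ) : PowerSeries ℝ := (1 - f) * mk 1

lemma coeff_tailSeries (f : PowerSeries ℝ) (n : ℕ) :
    coeff n (tailSeries f) = 1 - ∑ k ∈ Finset.range (n + 1), coeff k f := by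
  rw [tailSeries, sub_mul, one_mul, map_sub, coeff_mul_mk_one]
  simp

lemma tailSeries_mul_one_sub_X (f : PowerSeries ℝ) : tailSeries f * (1 - X) = 1 - f := by
  rw [tailSeries, mul_assoc, show (mk 1 : PowerSeries ℝ) * (1 - X) = 1 from
    mk_one_mul_one_sub_eq_one ℝ, mul_one]

/-- The generating function of the renewal sequence with weights `coeff k (tailSeries f)`. -/
noncomputable def renewalSeries (f : PowerSeries ℝ) : PowerSeries ℝ := (1 - tailSeries f)⁻¹

/-- The coefficient of index `i` is the mean number of services that are needed to reduce the number
of customers by one if there is room for `i` more customers. -/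
noncomputable def descentSeries (f : PowerSeries ℝ) : PowerSeries ℝ :=
  f * renewalSeries f * mk 1

variable {f : PowerSeries ℝ}

lemma renewalSeries_mul (hf : coeff 0 f ≠ 0) : renewalSeries f * (1 - tailSeries f) = 1 := by
  refine PowerSeries.inv_mul_cancel _ ?_
  rw [← coeff_zero_eq_constantCoeff_apply, map_sub, coeff_tailSeries]
  simpa using hf

/-- From (1 - X) `tailSeries f` = 1 - f one gets (f - X) `renewalSeries f` = 1 - X. Thus
`descentSeries f` is f/(f - X), and subtracting 1 leaves X/(f - X). -/
lemma descentSeries_eq (hf : coeff 0 f ≠ 0) :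
    descentSeries f = 1 + X * (renewalSeries f * mk 1) := by
  have h1 := renewalSeries_mul hf
  have h2 : (mk 1 : PowerSeries ℝ) * (1 - X) = 1 := mk_one_mul_one_sub_eq_one ℝ
  have h3 := tailSeries_mul_one_sub_X f
  have h4 : (f - X) * renewalSeries f = 1 - X := by
    linear_combination (1 - X) * h1 + renewalSeries f * h3
  rw [descentSeries]
  linear_combination mk 1 * h4 + h2

lemma descentSeries_rec (hf : coeff 0 f ≠ 0) :
    descentSeries f = mk 1 + tailSeries f * (descentSeries f - 1) := by
  have h1 := renewalSeries_mul hf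
  have h2 : (mk 1 : PowerSeries ℝ) * (1 - X) = 1 := mk_one_mul_one_sub_eq_one ℝ
  rw [descentSeries_eq hf]
  linear_combination X * mk 1 * h1 - h2

lemma coeff_zero_descentSeries (hf : coeff 0 f ≠ 0) : coeff 0 (descentSeries f) = 1 := by
  rw [descentSeries_eq hf]; simp

/-- With room for n more customers, one service is spent at once. With probability `coeff i
(tailSeries f)` more than i customers arrive during it, and then the level with room for n - i has
to be descended as well, for each i < n. -/
lemma coeff_descentSeries_rec (hf : coeff 0 f ≠ 0) (n : ℕ) :
    coeff n (descentSeries f) = 1 + ∑ i ∈ Finset.range n,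
      coeff i (tailSeries f) * coeff (n - i) (descentSeries f) := by
  conv_lhs => rw [descentSeries_rec hf]
  rw [map_add, coeff_mul, Finset.Nat.sum_antidiagonal_eq_sum_range_succ_mk,
    Finset.sum_range_succ]
  simp only [coeff_mk, Pi.one_apply, map_sub, Nat.sub_self, coeff_zero_descentSeries hf,
    coeff_one, if_true, sub_self, mul_zero, add_zero]
  congr 1
  refine Finset.sum_congr rfl fun i hi => ?_
  rw [if_neg (by have := Finset.mem_range.1 hi; omega), sub_zero]

/-- The renewal equation is solved coefficient by coefficient: the newest coefficient is multiplied
by 1 - `coeff 0 (tailSeries f)` = `coeff 0 f` > 0, and all other contributions are nonnegative. -/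
lemma coeff_renewalSeries_nonneg (hf : 0 < coeff 0 f) (ht : ∀ k, 0 ≤ coeff k (tailSeries f))
    (n : ℕ) : 0 ≤ coeff n (renewalSeries f) := by
  induction n using Nat.strong_induction_on with
  | _ n ih =>
    have h := congrArg (coeff n) (renewalSeries_mul hf.ne')
    rw [coeff_mul, Finset.Nat.sum_antidiagonal_eq_sum_range_succ_mk, Finset.sum_range_succ] at h
    simp only [map_sub, Nat.sub_self, coeff_one, if_true] at h
    have h0 : 1 - coeff 0 (tailSeries f) = coeff 0 f := by
      rw [coeff_tailSeries]; simp
    rw [h0] at h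
    have hs : ∑ x ∈ Finset.range n, coeff x (renewalSeries f) *
        ((if n - x = 0 then (1 : ℝ) else 0) - coeff (n - x) (tailSeries f)) ≤ 0 := by
      refine Finset.sum_nonpos fun x hx => ?_
      have := Finset.mem_range.1 hx
      rw [if_neg (by omega), zero_sub]
      exact mul_nonpos_of_nonneg_of_nonpos (ih x this) (neg_nonpos.2 (ht _))
    have hp : 0 ≤ coeff n (renewalSeries f) * coeff 0 f := by
      have : (0 : ℝ) ≤ if n = 0 then 1 else 0 := by split_ifs <;> norm_num
      linarith
    exact nonneg_of_mul_nonneg_left hp hf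

/-- Apart from the first, the coefficients are partial sums of `renewalSeries f`, whose leading term
1 / `coeff 0 f` is at least 1. -/
lemma one_le_coeff_descentSeries (hf : 0 < coeff 0 f) (hf1 : coeff 0 f ≤ 1)
    (ht : ∀ k, 0 ≤ coeff k (tailSeries f)) (n : ℕ) : 1 ≤ coeff n (descentSeries f) := by
  rcases n with _ | n
  · rw [coeff_zero_descentSeries hf.ne']
  · rw [descentSeries_eq hf.ne', map_add, coeff_succ_X_mul, coeff_mul_mk_one, coeff_one,
      if_neg (by omega), zero_add]
    have h := congrArg (coeff 0) (renewalSeries_mul hf.ne')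
    rw [coeff_mul] at h
    simp only [Finset.Nat.antidiagonal_zero, Finset.sum_singleton, map_sub, coeff_tailSeries] at h
    simp only [zero_add, Finset.range_one, Finset.sum_singleton, coeff_one, if_true,
      sub_sub_cancel] at h
    have hg := coeff_renewalSeries_nonneg hf ht
    calc (1 : ℝ) = coeff 0 (renewalSeries f) * coeff 0 f := h.symm
      _ ≤ coeff 0 (renewalSeries f) * 1 := mul_le_mul_of_nonneg_left hf1 (hg 0)
      _ = coeff 0 (renewalSeries f) := mul_one _
      _ ≤ _ := Finset.single_le_sum (f := fun k => coeff k (renewalSeries f))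
          (fun k _ => hg k) (by simp)

end PowerSeries

open PowerSeries in
/-- The mean number of services in a cycle. -/
noncomputable def cycleServices (f g : PowerSeries ℝ) (N : ℕ) : ℝ :=
  coeff (N - 1) (tailSeries g * descentSeries f)

lemma sum_mul_sum_Ico (a f : ℕ → ℝ) (L : ℕ) :
    ∑ j ∈ Finset.range L, a j * ∑ i ∈ Finset.Ico j L, f i =
      ∑ i ∈ Finset.range L, (∑ j ∈ Finset.range (i + 1), a j) * f i := by
  simp only [Finset.mul_sum, Finset.sum_mul]
  exact Finset.sum_comm' fun j i => by simp only [Finset.mem_range, Finset.mem_Ico]; omega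

/-- The generating function of the number of arrivals in a time with law `ν`. -/
noncomputable def arrivalSeries (lam : ℝ) (ν : Measure ℝ) : PowerSeries ℝ :=
  PowerSeries.mk (mixedPoisson lam ν)

open PowerSeries in
lemma coeff_tailSeries_arrivalSeries_nonneg {lam : ℝ} {ν : Measure ℝ} [IsProbabilityMeasure ν]
    (hlam : 0 < lam) (hν : ν (Set.Iio 0) = 0) (k : ℕ) :
    0 ≤ coeff k (tailSeries (arrivalSeries lam ν)) := by
  rw [coeff_tailSeries]
  simp only [arrivalSeries, coeff_mk]
  exact tail_nonneg (mixedPoisson_nonneg hlam hν) (hasSum_mixedPoisson hlam hν) k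

open PowerSeries in
lemma coeff_zero_arrivalSeries_pos {lam : ℝ} {ν : Measure ℝ} [IsProbabilityMeasure ν]
    (hlam : 0 < lam) (hν : ν (Set.Iio 0) = 0) : 0 < coeff 0 (arrivalSeries lam ν) := by
  rw [arrivalSeries, coeff_mk]; exact mixedPoisson_zero_pos hν hlam

open PowerSeries in
-- A busy period that starts with n customers descends through the levels n, …, 1, and level i + 1
-- leaves room for N - 1 - i. Averaging over the arrivals is summation by parts: partial sums of
-- arrival probabilities turn into tails, and the service equation becomes
-- `coeff_descentSeries_rec`.
lemma isMeanServices_descentSeries {lam : ℝ} {σ υ : Measure ℝ} [IsProbabilityMeasure σ]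
    [IsProbabilityMeasure υ] (hlam : 0 < lam) (hσ : σ (Set.Iio 0) = 0) (hυ : υ (Set.Iio 0) = 0)
    (hυi : Integrable (fun t : ℝ => t) υ) (hυpos : 0 < ∫ t, t ∂υ) {N : ℕ} (hN : 1 ≤ N) :
    IsMeanServices lam σ υ N
      (fun n => ∑ i ∈ Finset.range n, coeff (N - 1 - i) (descentSeries (arrivalSeries lam σ)))
      (cycleServices (arrivalSeries lam σ) (arrivalSeries lam υ) N) := by
  set f := arrivalSeries lam σ with hf
  set g := arrivalSeries lam υ with hg
  set d : ℕ → ℝ := fun i => coeff i (descentSeries f) with hd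
  have hf0 : 0 < coeff 0 f := coeff_zero_arrivalSeries_pos hlam hσ
  have htf := coeff_tailSeries_arrivalSeries_nonneg hlam hσ
  have htg := coeff_tailSeries_arrivalSeries_nonneg hlam hυ
  have hf1 : coeff 0 f ≤ 1 := by
    have := htf 0
    rw [coeff_tailSeries] at this
    simpa using this
  have hd1 : ∀ i, 1 ≤ d i := one_le_coeff_descentSeries hf0 hf1 htf
  have hm : ∀ {j k : ℕ}, j ≤ k → ∑ i ∈ Finset.range k, d (N - 1 - i) -
      ∑ i ∈ Finset.range j, d (N - 1 - i) = ∑ i ∈ Finset.Ico j k, d (N - 1 - i) := fun h =>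
    (Finset.sum_Ico_eq_sub _ h).symm
  have hcycle : cycleServices f g N = ∑ i ∈ Finset.range N, coeff i (tailSeries g) * d (N - 1 - i) := by
    rw [cycleServices, coeff_mul, Finset.Nat.sum_antidiagonal_eq_sum_range_succ_mk,
      Nat.succ_eq_add_one, Nat.sub_add_cancel hN]
  refine ⟨by simp, fun n hn => ?_, fun n hn1 hn => ?_, ?_, ?_⟩
  · exact (hd1 (N - 1 - 0)).trans (Finset.single_le_sum (f := fun i => d (N - 1 - i))
      (fun i _ => zero_le_one.trans (hd1 _)) (Finset.mem_range.2 hn))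
  · rw [integral_poissonAvg hlam hσ]
    have hdiff : ∀ j ∈ Finset.range (N - n), mixedPoisson lam σ j *
        (∑ i ∈ Finset.range (n + j - 1), d (N - 1 - i) - ∑ i ∈ Finset.range (N - 1), d (N - 1 - i))
        = -(mixedPoisson lam σ j * ∑ i ∈ Finset.Ico j (N - n), d (N - n - i)) := by
      intro j hj
      have hj := Finset.mem_range.1 hj
      rw [← mul_neg, ← neg_sub, hm (by omega : n + j - 1 ≤ N - 1)]
      congr 2
      rw [show n + j - 1 = j + (n - 1) by omega, show N - 1 = (N - n) + (n - 1) by omega,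
        ← Finset.sum_Ico_add']
      refine Finset.sum_congr rfl fun i hi => ?_
      have := Finset.mem_Ico.1 hi
      congr 1; omega
    rw [Finset.sum_congr rfl hdiff, Finset.sum_neg_distrib, sum_mul_sum_Ico]
    have hrec := coeff_descentSeries_rec hf0.ne' (N - n)
    have htail : ∀ i, ∑ j ∈ Finset.range (i + 1), mixedPoisson lam σ j
        = 1 - coeff i (tailSeries f) := by
      intro i; rw [coeff_tailSeries]; simp [hf, arrivalSeries]
    simp only [htail, sub_mul, one_mul, Finset.sum_sub_distrib]
    have h1 : ∑ i ∈ Finset.range n, d (N - 1 - i) =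
        ∑ i ∈ Finset.range (n - 1), d (N - 1 - i) + d (N - n) := by
      obtain ⟨k, rfl⟩ : ∃ k, n = k + 1 := ⟨n - 1, by omega⟩
      rw [Finset.sum_range_succ, Nat.add_sub_cancel, Nat.sub_sub, add_comm 1 k]
    have h2 := hm (by omega : n - 1 ≤ N - 1)
    have h3 : ∑ i ∈ Finset.Ico (n - 1) (N - 1), d (N - 1 - i) =
        ∑ i ∈ Finset.range (N - n), d (N - n - i) := by
      rw [show N - 1 = (N - n) + (n - 1) by omega]
      nth_rewrite 1 [show n - 1 = 0 + (n - 1) by omega]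
      rw [← Finset.sum_Ico_add', Finset.range_eq_Ico]
      refine Finset.sum_congr rfl fun i hi => ?_
      congr 1; omega
    rw [h1]
    simp only [hd] at h2 h3 hrec ⊢
    linarith
  · rw [integral_poissonAvg hlam hυ, hcycle]
    have hdiff : ∀ j ∈ Finset.range (N - 0), mixedPoisson lam υ j *
        (∑ i ∈ Finset.range (0 + j), d (N - 1 - i) - ∑ i ∈ Finset.range N, d (N - 1 - i))
        = -(mixedPoisson lam υ j * ∑ i ∈ Finset.Ico j N, d (N - 1 - i)) := by
      intro j hj
      have hj := Finset.mem_range.1 hj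
      rw [← hm (by omega : j ≤ N), zero_add]; ring
    rw [Finset.sum_congr rfl hdiff, Finset.sum_neg_distrib, Nat.sub_zero, sum_mul_sum_Ico]
    have htail : ∀ i, ∑ j ∈ Finset.range (i + 1), mixedPoisson lam υ j
        = 1 - coeff i (tailSeries g) := by
      intro i; rw [coeff_tailSeries]; simp [hg, arrivalSeries]
    simp only [htail, sub_mul, one_mul, Finset.sum_sub_distrib]
    ring
  · rw [hcycle]
    have hw := hasSum_tail_mixedPoisson hlam hυ hυi
    -- This is the probability of an arrival during a vacation. If it were 0, all tails would
    -- vanish, although they sum to λE[V] > 0.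
    have hw0 : 0 < coeff 0 (tailSeries g) := by
      by_contra hcon
      have h0 : coeff 0 (tailSeries g) = 0 := le_antisymm (not_lt.1 hcon) (htg 0)
      have hall : ∀ k, 1 - ∑ j ∈ Finset.range (k + 1), mixedPoisson lam υ j = 0 := by
        intro k
        refine le_antisymm ?_ (tail_nonneg (mixedPoisson_nonneg hlam hυ)
          (hasSum_mixedPoisson hlam hυ) k)
        have h1 : mixedPoisson lam υ 0 ≤ ∑ j ∈ Finset.range (k + 1), mixedPoisson lam υ j :=
          Finset.single_le_sum (fun j _ => mixedPoisson_nonneg hlam hυ j) (by simp)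
        rw [coeff_tailSeries] at h0
        simp only [zero_add, Finset.range_one, Finset.sum_singleton, hg, arrivalSeries,
          coeff_mk] at h0
        linarith
      simp only [hall] at hw
      have := hw.unique hasSum_zero
      exact (mul_pos hlam hυpos).ne' this
    calc (0 : ℝ) < coeff 0 (tailSeries g) * d (N - 1 - 0) :=
          mul_pos hw0 (zero_lt_one.trans_le (hd1 _))
      _ ≤ _ := Finset.single_le_sum (f := fun i => coeff i (tailSeries g) * d (N - 1 - i))
          (fun i _ => mul_nonneg (htg i) (zero_le_one.trans (hd1 _))) (Finset.mem_range.2 hN)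

/-! ### Sums of power series -/

namespace PowerSeries

variable {𝕜 : Type*} [RCLike 𝕜]

/-- The sum of a power series at `z`. -/
noncomputable def evalSum (f : PowerSeries 𝕜) (z : 𝕜) : 𝕜 := ∑' n, coeff n f * z ^ n

/-- Absolute convergence of a power series at `z`. -/
def AbsConv (f : PowerSeries 𝕜) (z : 𝕜) : Prop := Summable fun n => ‖coeff n f * z ^ n‖

variable {f g : PowerSeries 𝕜} {z : 𝕜}

lemma AbsConv.hasSum (hf : AbsConv f z) : HasSum (fun n => coeff n f * z ^ n) (evalSum f z) :=
  (Summable.of_norm hf).hasSum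

lemma coeff_mul_mul_pow (f g : PowerSeries 𝕜) (z : 𝕜) (n : ℕ) :
    coeff n (f * g) * z ^ n = ∑ k ∈ Finset.range (n + 1),
      (coeff k f * z ^ k) * (coeff (n - k) g * z ^ (n - k)) := by
  rw [coeff_mul, Finset.Nat.sum_antidiagonal_eq_sum_range_succ_mk, Finset.sum_mul]
  refine Finset.sum_congr rfl fun k hk => ?_
  obtain ⟨m, rfl⟩ := Nat.exists_eq_add_of_le (Finset.mem_range_succ_iff.1 hk)
  rw [Nat.add_sub_cancel_left, pow_add]; ring

lemma AbsConv.mul (hf : AbsConv f z) (hg : AbsConv g z) : AbsConv (f * g) z := by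
  unfold AbsConv
  simp only [coeff_mul_mul_pow]
  exact summable_norm_sum_mul_range_of_summable_norm (f := fun n => coeff n f * z ^ n)
    (g := fun n => coeff n g * z ^ n) hf hg

lemma evalSum_mul (hf : AbsConv f z) (hg : AbsConv g z) :
    evalSum (f * g) z = evalSum f z * evalSum g z := by
  unfold evalSum
  simp only [coeff_mul_mul_pow]
  exact (tsum_mul_tsum_eq_tsum_sum_range_of_summable_norm (f := fun n => coeff n f * z ^ n)
    (g := fun n => coeff n g * z ^ n) hf hg).symm

lemma hasSum_one_mul_pow (z : 𝕜) : HasSum (fun n => coeff n (1 : PowerSeries 𝕜) * z ^ n) 1 := by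
  convert! hasSum_single (f := fun n => coeff n (1 : PowerSeries 𝕜) * z ^ n) 0 ?_ using 1
  · simp
  · intro n hn; simp [coeff_one, hn]

lemma absConv_one (z : 𝕜) : AbsConv (1 : PowerSeries 𝕜) z :=
  summable_of_ne_finset_zero (s := {0}) fun n hn => by
    simp only [Finset.mem_singleton] at hn; simp [coeff_one, hn]

lemma evalSum_one (z : 𝕜) : evalSum (1 : PowerSeries 𝕜) z = 1 := (hasSum_one_mul_pow z).tsum_eq

lemma absConv_X (z : 𝕜) : AbsConv (X : PowerSeries 𝕜) z :=
  summable_of_ne_finset_zero (s := {1}) fun n hn => by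
    simp only [Finset.mem_singleton] at hn; simp [coeff_X, hn]

lemma evalSum_X (z : 𝕜) : evalSum (X : PowerSeries 𝕜) z = z := by
  unfold evalSum
  rw [tsum_eq_single 1 fun n hn => by simp [coeff_X, hn]]
  simp

lemma AbsConv.sub (hf : AbsConv f z) (hg : AbsConv g z) : AbsConv (f - g) z := by
  refine Summable.of_nonneg_of_le (fun n => norm_nonneg _) (fun n => ?_) (Summable.add hf hg)
  rw [map_sub, sub_mul]; exact norm_sub_le _ _

lemma evalSum_sub (hf : AbsConv f z) (hg : AbsConv g z) :
    evalSum (f - g) z = evalSum f z - evalSum g z := by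
  have h := hf.hasSum.sub hg.hasSum
  unfold evalSum at h ⊢
  rw [← h.tsum_eq]
  exact tsum_congr fun n => by rw [map_sub, sub_mul]

lemma AbsConv.of_norm_le {w : 𝕜} (hf : AbsConv f w) (h : ‖z‖ ≤ ‖w‖) : AbsConv f z := by
  refine Summable.of_nonneg_of_le (fun n => norm_nonneg _) (fun n => ?_) hf
  rw [norm_mul, norm_mul, norm_pow, norm_pow]
  gcongr

lemma AbsConv.continuousOn {w : 𝕜} (hf : AbsConv f w) :
    ContinuousOn (evalSum f) (Metric.closedBall 0 ‖w‖) := by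
  refine continuousOn_tsum (u := fun n => ‖coeff n f * w ^ n‖)
    (fun n => (continuous_const.mul (continuous_pow n)).continuousOn) hf fun n z hz => ?_
  rw [mem_closedBall_zero_iff] at hz
  rw [norm_mul, norm_mul, norm_pow, norm_pow]
  gcongr

end PowerSeries

/-! ### Convergence of the renewal series -/

section Nonneg

open PowerSeries

lemma absConv_of_nonneg {f : PowerSeries ℝ} (hf : ∀ n, 0 ≤ coeff n f) {x : ℝ} (hx : 0 ≤ x) :
    AbsConv f x ↔ Summable fun n => coeff n f * x ^ n := by
  unfold AbsConv
  simp only [Real.norm_eq_abs]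
  rw [show (fun n => |coeff n f * x ^ n|) = fun n => coeff n f * x ^ n from
    funext fun n => abs_of_nonneg (mul_nonneg (hf n) (pow_nonneg hx n))]

/-- By R = 1 + R T and nonnegativity, a partial sum s of R at x satisfies s ≤ 1 + sβ with β = T(x) <
1. So the partial sums are bounded by 1/(1 - β). -/
lemma absConv_renewalSeries {f : PowerSeries ℝ} (hf : 0 < coeff 0 f)
    (ht : ∀ k, 0 ≤ coeff k (tailSeries f)) {x : ℝ} (hx : 0 ≤ x) (hc : AbsConv (tailSeries f) x)
    (h1 : evalSum (tailSeries f) x < 1) :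
    AbsConv (renewalSeries f) x ∧
      evalSum (renewalSeries f) x = 1 / (1 - evalSum (tailSeries f) x) := by
  have hg := coeff_renewalSeries_nonneg hf ht
  set β := evalSum (tailSeries f) x with hβ
  have hgx : ∀ n, 0 ≤ coeff n (renewalSeries f) * x ^ n := fun n =>
    mul_nonneg (hg n) (pow_nonneg hx n)
  have htx : ∀ n, 0 ≤ coeff n (tailSeries f) * x ^ n := fun n =>
    mul_nonneg (ht n) (pow_nonneg hx n)
  have hrec : renewalSeries f = 1 + renewalSeries f * tailSeries f := by
    linear_combination renewalSeries_mul hf.ne'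
  have hpart : ∀ K, ∑ n ∈ Finset.range K, coeff n (renewalSeries f) * x ^ n ≤ 1 / (1 - β) := by
    intro K
    set s := ∑ n ∈ Finset.range K, coeff n (renewalSeries f) * x ^ n with hs
    have h2 : s ≤ 1 + s * β := by
      have e : s = ∑ n ∈ Finset.range K, (coeff n (1 : PowerSeries ℝ) * x ^ n) +
          ∑ n ∈ Finset.range K, coeff n (renewalSeries f * tailSeries f) * x ^ n := by
        rw [hs, ← Finset.sum_add_distrib]
        refine Finset.sum_congr rfl fun n _ => ?_
        conv_lhs => rw [hrec]
        rw [map_add, add_mul]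
      rw [e]
      refine add_le_add ?_ ?_
      · refine sum_le_hasSum _ (fun n _ => ?_) (hasSum_one_mul_pow x)
        rw [coeff_one]; split_ifs <;> positivity
      · rw [← e, hs]
        simp only [coeff_mul_mul_pow]
        rw [Finset.sum_range_diag_flip K fun i j =>
          (coeff i (renewalSeries f) * x ^ i) * (coeff j (tailSeries f) * x ^ j), Finset.sum_mul]
        refine Finset.sum_le_sum fun i _ => ?_
        rw [← Finset.mul_sum]
        exact mul_le_mul_of_nonneg_left (sum_le_hasSum _ (fun n _ => htx n) hc.hasSum) (hgx i)
    rw [le_div_iff₀ (by linarith)]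
    linarith
  have hconv : AbsConv (renewalSeries f) x :=
    (absConv_of_nonneg hg hx).2 (summable_of_sum_range_le hgx hpart)
  refine ⟨hconv, ?_⟩
  have h3 := evalSum_mul hconv ((absConv_one x).sub hc)
  rw [renewalSeries_mul hf.ne', evalSum_one, evalSum_sub (absConv_one x) hc, evalSum_one] at h3
  rw [eq_div_iff (by linarith : 1 - β ≠ 0)]
  exact h3.symm

end Nonneg

/-! ### Sequences of the order of `k ^ (θ - 1) / r ^ k` -/

section Asymptotics

open PowerSeries

/-- `s k` divided by `(k + 1) ^ (θ - 1) / r ^ k`. -/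
noncomputable def scaled (θ r : ℝ) (s : ℕ → ℝ) (k : ℕ) : ℝ := (k + 1 : ℝ) ^ (1 - θ) * r ^ k * s k

variable {θ r C : ℝ} {s : ℕ → ℝ}

lemma tendsto_ratio_rpow (i : ℕ) (p : ℝ) :
    Tendsto (fun k : ℕ => ((k + 1 : ℝ) / (k + i + 1)) ^ p) atTop (𝓝 1) := by
  have h : Tendsto (fun k : ℕ => (k + 1 : ℝ) / (k + i + 1)) atTop (𝓝 1) := by
    have h1 : Tendsto (fun k : ℕ => 1 - (i : ℝ) / (k + i + 1)) atTop (𝓝 (1 - 0)) := by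
      refine tendsto_const_nhds.sub (tendsto_const_nhds.div_atTop ?_)
      exact tendsto_atTop_add_const_right _ _
        (tendsto_atTop_add_const_right _ _ tendsto_natCast_atTop_atTop)
    rw [sub_zero] at h1
    refine h1.congr fun k => ?_
    have : (k + i + 1 : ℝ) ≠ 0 := by positivity
    field_simp; ring
  simpa using h.rpow_const (p := p) (Or.inl one_ne_zero)

lemma scaled_bound (h : Tendsto (scaled θ r s) atTop (𝓝 C)) :
    ∃ B, 0 ≤ B ∧ ∀ k, |scaled θ r s k| ≤ B := by
  obtain ⟨B, hB⟩ := h.norm.bddAbove_range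
  exact ⟨B, (norm_nonneg _).trans (hB ⟨0, rfl⟩), fun k => hB ⟨k, rfl⟩⟩

lemma tendsto_scaled_shift (hr : r ≠ 0) (h : Tendsto (scaled θ r s) atTop (𝓝 C)) :
    Tendsto (scaled θ r fun k => s (k + 1)) atTop (𝓝 (C / r)) := by
  have h1 := ((h.comp (tendsto_add_atTop_nat 1)).mul (tendsto_ratio_rpow 1 (1 - θ))).div_const r
  rw [mul_one] at h1
  refine h1.congr fun k => ?_
  simp only [scaled, Function.comp_apply]
  rw [Real.div_rpow (by positivity) (by positivity)]
  have : ((k + 1 + 1 : ℝ)) ^ (1 - θ) ≠ 0 := (Real.rpow_pos_of_pos (by positivity) _).ne'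
  push_cast
  field_simp
  ring

/-- Relative to the scale at k, the term k + i carries the weight r^{-i} times a ratio of powers.
That ratio tends to 1 and is at most polynomial in i uniformly in k, so dominated convergence gives
a geometric series. -/
lemma tendsto_scaled_tsum (hr : 1 < r) (h : Tendsto (scaled θ r s) atTop (𝓝 C)) :
    Tendsto (scaled θ r fun k => ∑' i, s (k + i)) atTop (𝓝 (C * (r / (r - 1)))) := by
  have hr0 : 0 < r := by linarith
  obtain ⟨B, hB0, hB⟩ := scaled_bound h
  obtain ⟨p, hp⟩ := exists_nat_ge |1 - θ|
  have hratio : ∀ k i : ℕ, ((k + 1 : ℝ) / (k + i + 1)) ^ (1 - θ) ≤ ((i : ℝ) + 1) ^ p := by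
    intro k i
    have h0 : 0 < (k + 1 : ℝ) / (k + i + 1) := by positivity
    have h1 : (k + 1 : ℝ) / (k + i + 1) ≤ 1 := by
      rw [div_le_one (by positivity)]; linarith [(Nat.cast_nonneg i : (0 : ℝ) ≤ i)]
    have h2 : (1 : ℝ) / (i + 1) ≤ (k + 1 : ℝ) / (k + i + 1) := by
      rw [div_le_div_iff₀ (by positivity) (by positivity)]
      nlinarith [(Nat.cast_nonneg i : (0 : ℝ) ≤ i), (Nat.cast_nonneg k : (0 : ℝ) ≤ k)]
    calc ((k + 1 : ℝ) / (k + i + 1)) ^ (1 - θ) ≤ ((k + 1 : ℝ) / (k + i + 1)) ^ (-(p : ℝ)) :=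
          Real.rpow_le_rpow_of_exponent_ge h0 h1 (by linarith [neg_abs_le (1 - θ)])
      _ ≤ ((1 : ℝ) / (i + 1)) ^ (-(p : ℝ)) :=
          Real.rpow_le_rpow_of_nonpos (by positivity) h2 (by simp)
      _ = ((i : ℝ) + 1) ^ p := by
          rw [Real.rpow_neg (by positivity), Real.rpow_natCast, one_div, inv_pow, inv_inv]
  have hsum : Summable fun i : ℕ => B * (((i : ℝ) + 1) ^ p * (1 / r) ^ i) := by
    have h1 : Summable fun i : ℕ => (i : ℝ) ^ p * (1 / r) ^ i :=
      summable_pow_mul_geometric_of_norm_lt_one p (by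
        rw [Real.norm_eq_abs, abs_of_pos (by positivity), div_lt_one hr0]; exact hr)
    refine Summable.mul_left _ ((((summable_nat_add_iff 1).2 h1).mul_left r).congr fun i => ?_)
    push_cast
    rw [pow_succ]
    field_simp
  have key := tendsto_tsum_of_dominated_convergence (𝓕 := atTop)
    (f := fun (k : ℕ) (i : ℕ) => scaled θ r s (k + i) * (((k + 1 : ℝ) / (k + i + 1)) ^ (1 - θ) *
      (1 / r) ^ i)) (g := fun i => C * (1 * (1 / r) ^ i)) hsum
    (fun i => (h.comp (tendsto_add_atTop_nat i)).mul
      ((tendsto_ratio_rpow i (1 - θ)).mul_const _))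
    (Eventually.of_forall fun k i => by
      rw [norm_mul, norm_mul, Real.norm_eq_abs, Real.norm_of_nonneg
        (Real.rpow_nonneg (by positivity) _), Real.norm_of_nonneg (by positivity)]
      exact mul_le_mul (hB _) (mul_le_mul_of_nonneg_right (hratio k i) (by positivity))
        (mul_nonneg (Real.rpow_nonneg (by positivity) _) (by positivity)) hB0)
  have hlim : ∑' i : ℕ, C * (1 * (1 / r) ^ i) = C * (r / (r - 1)) := by
    simp only [one_mul]
    rw [tsum_mul_left, tsum_geometric_of_lt_one (by positivity) (by rw [div_lt_one hr0]; exact hr)]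
    congr 1
    have : r - 1 ≠ 0 := by linarith
    field_simp
  rw [hlim] at key
  refine key.congr fun k => ?_
  simp only [scaled]
  rw [← tsum_mul_left]
  refine tsum_congr fun i => ?_
  rw [Real.div_rpow (by positivity) (by positivity)]
  have : ((k + i + 1 : ℝ)) ^ (1 - θ) ≠ 0 := (Real.rpow_pos_of_pos (by positivity) _).ne'
  push_cast
  rw [pow_add, one_div, inv_pow]
  field_simp

/-- The factor g shifts mass by j at the price r^j and a ratio ((k + 1)/(k - j + 1))^(1 - θ). For θ
≥ 1 that ratio is at most 1 and absolute convergence of g at r suffices; for θ < 1 it can reach (j +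
1)^(1 - θ), which explains the weight. -/
lemma tendsto_scaled_mul (hr : 0 < r) {f g : PowerSeries ℝ}
    (h : Tendsto (scaled θ r fun k => coeff k f) atTop (𝓝 C))
    (hg : Summable fun j : ℕ => (j + 1 : ℝ) ^ max (1 - θ) 0 * |coeff j g * r ^ j|) :
    Tendsto (scaled θ r fun k => coeff k (f * g)) atTop (𝓝 (C * evalSum g r)) := by
  obtain ⟨B, hB0, hB⟩ := scaled_bound h
  have hratio : ∀ k j : ℕ, ((k + j + 1 : ℝ) / (k + 1)) ^ (1 - θ) ≤ (j + 1 : ℝ) ^ max (1 - θ) 0 := by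
    intro k j
    have h1 : 1 ≤ (k + j + 1 : ℝ) / (k + 1) := by
      rw [one_le_div (by positivity)]; linarith [(Nat.cast_nonneg j : (0 : ℝ) ≤ j)]
    have h2 : (k + j + 1 : ℝ) / (k + 1) ≤ j + 1 := by
      rw [div_le_iff₀ (by positivity)]
      nlinarith [(Nat.cast_nonneg j : (0 : ℝ) ≤ j), (Nat.cast_nonneg k : (0 : ℝ) ≤ k)]
    exact (Real.rpow_le_rpow_of_exponent_le h1 (le_max_left _ _)).trans
      (Real.rpow_le_rpow (by positivity) h2 (le_max_right _ _))
  have key := tendsto_tsum_of_dominated_convergence (𝓕 := atTop)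
    (f := fun (k : ℕ) (j : ℕ) => if j ≤ k then scaled θ r (fun k => coeff k f) (k - j) *
      ((((k - j : ℕ) + j + 1 : ℝ) / ((k - j : ℕ) + 1)) ^ (1 - θ) * (coeff j g * r ^ j)) else 0)
    (g := fun j => C * (1 * (coeff j g * r ^ j))) (hg.mul_left B) (fun j => ?_)
    (Eventually.of_forall fun k j => ?_)
  · simp only [one_mul] at key
    rw [tsum_mul_left] at key
    refine key.congr fun k => ?_
    rw [tsum_eq_sum (s := Finset.range (k + 1)) fun j hj => if_neg (by simpa using hj)]
    simp only [scaled]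
    rw [mul_comm f g, coeff_mul, Finset.Nat.sum_antidiagonal_eq_sum_range_succ_mk, Finset.mul_sum]
    refine Finset.sum_congr rfl fun j hj => ?_
    have hj : j ≤ k := Nat.lt_succ_iff.1 (Finset.mem_range.1 hj)
    rw [if_pos hj, Real.div_rpow (by positivity) (by positivity)]
    have h1 : (((k - j : ℕ) + 1 : ℝ)) ^ (1 - θ) ≠ 0 := (Real.rpow_pos_of_pos (by positivity) _).ne'
    have h2 : ((k - j : ℕ) + j + 1 : ℝ) = k + 1 := by
      rw [← Nat.cast_add, Nat.sub_add_cancel hj]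
    have h3 : r ^ k = r ^ (k - j) * r ^ j := by rw [← pow_add, Nat.sub_add_cancel hj]
    rw [h2, h3]
    field_simp
  · have e1 : Tendsto (fun k : ℕ => ((((k - j : ℕ) : ℝ) + j + 1) / ((k - j : ℕ) + 1)) ^ (1 - θ)) atTop
        (𝓝 1) := by
      have := (tendsto_ratio_rpow j (-(1 - θ))).comp (tendsto_sub_atTop_nat j)
      refine this.congr fun k => ?_
      simp only [Function.comp_apply]
      rw [Real.rpow_neg_eq_inv_rpow, inv_div]
    refine ((h.comp (tendsto_sub_atTop_nat j)).mul (e1.mul_const _)).congr' ?_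
    filter_upwards [eventually_ge_atTop j] with k hk
    rw [if_pos hk]; rfl
  · split_ifs with hjk
    · rw [norm_mul, norm_mul, Real.norm_eq_abs, Real.norm_of_nonneg
        (Real.rpow_nonneg (by positivity) _), Real.norm_eq_abs]
      exact mul_le_mul (hB _) (mul_le_mul_of_nonneg_right (hratio _ j) (abs_nonneg _))
        (mul_nonneg (Real.rpow_nonneg (by positivity) _) (abs_nonneg _)) hB0
    · rw [norm_zero]
      exact mul_nonneg hB0 (mul_nonneg (Real.rpow_nonneg (by positivity) _) (abs_nonneg _))

lemma summable_rpow_mul_of_lt {f : ℕ → ℝ} {x : ℝ} (hr : 0 < r) (hrx : r < x) (p : ℝ)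
    (h : Summable fun j => |f j * x ^ j|) :
    Summable fun j : ℕ => (j + 1 : ℝ) ^ p * |f j * r ^ j| := by
  obtain ⟨n, hn⟩ := exists_nat_ge p
  have hx : 0 < x := hr.trans hrx
  have h1 : Tendsto (fun i : ℕ => (i : ℝ) ^ n * (r / x) ^ i) atTop (𝓝 0) :=
    (summable_pow_mul_geometric_of_norm_lt_one n (by
      rw [Real.norm_eq_abs, abs_of_pos (by positivity), div_lt_one hx]; exact hrx) :
      Summable fun i : ℕ => (i : ℝ) ^ n * (r / x) ^ i).tendsto_atTop_zero
  obtain ⟨B, hB⟩ := (h1.comp (tendsto_add_atTop_nat 1)).bddAbove_range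
  refine Summable.of_nonneg_of_le (fun j => by positivity) (fun j => ?_)
    (h.mul_left (B * (x / r)))
  have hb : ((j + 1 : ℕ) : ℝ) ^ n * (r / x) ^ (j + 1) ≤ B := hB ⟨j, rfl⟩
  have h2 : (j + 1 : ℝ) ^ p ≤ (j + 1 : ℝ) ^ n := by
    rw [← Real.rpow_natCast]
    exact Real.rpow_le_rpow_of_exponent_le (by linarith [(Nat.cast_nonneg j : (0 : ℝ) ≤ j)]) hn
  rw [abs_mul, abs_mul, abs_of_pos (pow_pos hr j), abs_of_pos (pow_pos hx j)]
  have h3 : (j + 1 : ℝ) ^ n * r ^ j ≤ B * (x / r) * x ^ j := by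
    rw [div_pow, pow_succ, pow_succ] at hb
    push_cast at hb
    have h4 := mul_le_mul_of_nonneg_right hb (by positivity : 0 ≤ x ^ j * (x / r))
    calc (j + 1 : ℝ) ^ n * r ^ j = (j + 1 : ℝ) ^ n * (r ^ j * r / (x ^ j * x)) * (x ^ j * (x / r)) := by
          field_simp
      _ ≤ B * (x ^ j * (x / r)) := h4
      _ = _ := by ring
  calc (j + 1 : ℝ) ^ p * (|f j| * r ^ j) ≤ (j + 1 : ℝ) ^ n * (|f j| * r ^ j) := by gcongr
    _ = ((j + 1 : ℝ) ^ n * r ^ j) * |f j| := by ring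
    _ ≤ (B * (x / r) * x ^ j) * |f j| := by gcongr
    _ = _ := by ring

end Asymptotics

/-! ### Transfer of singular behaviour to coefficients -/

section Transfer

open Complex

/-- The coefficient of `z ^ k` in `(1 - z) ^ (-θ)`. -/
noncomputable def binomCoeff (θ : ℝ) (k : ℕ) : ℝ := Ring.choose (θ + k - 1) k

lemma factorial_mul_binomCoeff (θ : ℝ) (k : ℕ) :
    (k.factorial : ℝ) * binomCoeff θ k = ∏ j ∈ Finset.range k, (θ + j) := by
  have h := Ring.factorial_nsmul_multichoose_eq_ascPochhammer θ k
  rw [nsmul_eq_mul] at h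
  rw [binomCoeff, Ring.choose, show θ + k - 1 - k + 1 = θ by ring, h,
    Polynomial.ascPochhammer_smeval_eq_eval]
  clear h
  induction k with
  | zero => simp
  | succ n ih => rw [ascPochhammer_succ_eval, ih, Finset.prod_range_succ]

/-- Up to ratios tending to 1, the left side is the reciprocal of Euler's product for Γ(θ). -/
lemma tendsto_scaled_binomCoeff {θ : ℝ} (hθ : 0 < θ) :
    Tendsto (fun k : ℕ => (k + 1 : ℝ) ^ (1 - θ) * binomCoeff θ k) atTop (𝓝 (Real.Gamma θ)⁻¹) := by
  have h1 : Tendsto (fun k : ℕ => (k + 1 : ℝ) / (k + θ)) atTop (𝓝 1) := by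
    have h2 : Tendsto (fun k : ℕ => 1 + (1 - θ) / (k + θ)) atTop (𝓝 (1 + 0)) :=
      tendsto_const_nhds.add (tendsto_const_nhds.div_atTop
        (tendsto_atTop_add_const_right _ _ tendsto_natCast_atTop_atTop))
    rw [add_zero] at h2
    refine h2.congr fun k => ?_
    have : (k + θ : ℝ) ≠ 0 := by positivity
    field_simp; ring
  have h2 : Tendsto (fun k : ℕ => ((k : ℝ) / (k + 1)) ^ θ) atTop (𝓝 1) := by
    simpa using (tendsto_natCast_div_add_atTop (1 : ℝ)).rpow_const (p := θ) (Or.inr hθ.le)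
  have h3 := (Real.GammaSeq_tendsto_Gamma θ).inv₀ (Real.Gamma_pos_of_pos hθ).ne'
  have h4 := (h1.mul h2).mul h3
  rw [mul_one, one_mul] at h4
  refine h4.congr' ?_
  filter_upwards [eventually_gt_atTop 0] with k hk
  have hk' : (0 : ℝ) < k := by exact_mod_cast hk
  have hfac : (k.factorial : ℝ) ≠ 0 := by positivity
  have hb : binomCoeff θ k = (∏ j ∈ Finset.range k, (θ + j)) / k.factorial := by
    rw [← factorial_mul_binomCoeff, mul_div_cancel_left₀ _ hfac]
  rw [hb, Real.GammaSeq, Finset.prod_range_succ, Real.div_rpow hk'.le (by positivity),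
    Real.rpow_sub (by positivity), Real.rpow_one]
  have e1 : (k : ℝ) ^ θ ≠ 0 := (Real.rpow_pos_of_pos hk' _).ne'
  have e2 : (k + 1 : ℝ) ^ θ ≠ 0 := (Real.rpow_pos_of_pos (by positivity) _).ne'
  have e3 : (k + θ : ℝ) ≠ 0 := by positivity
  rw [add_comm θ (k : ℝ)]
  field_simp

lemma hasSum_binomCoeff {θ r : ℝ} (hr : 0 < r) {z : ℂ} (hz : ‖z‖ < r) :
    HasSum (fun k => ((r ^ (-θ) * binomCoeff θ k / r ^ k : ℝ) : ℂ) * z ^ k)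
      (1 / ((r : ℂ) - z) ^ (θ : ℂ)) := by
  have h := (one_div_one_sub_cpow_hasFPowerSeriesOnBall_zero (θ : ℂ)).hasSum (y := z / r) (by
    rw [mem_eball_zero_iff, ← ofReal_norm, ENNReal.ofReal_lt_one, norm_div, norm_real, Real.norm_of_nonneg hr.le,
      div_lt_one hr]; exact hz)
  simp only [FormalMultilinearSeries.ofScalars_apply_eq, zero_add, smul_eq_mul] at h
  have hr0 : (r : ℂ) ≠ 0 := by exact_mod_cast hr.ne'
  have hz1 : 1 - z / r ≠ 0 := by
    intro h0
    have : z = r := by field_simp at h0; linear_combination -h0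
    rw [this, norm_real, Real.norm_of_nonneg hr.le] at hz
    exact lt_irrefl _ hz
  have e : 1 / ((r : ℂ) - z) ^ (θ : ℂ) = (r ^ (-θ) : ℝ) * (1 / (1 - z / r) ^ (θ : ℂ)) := by
    rw [show (r : ℂ) - z = r * (1 - z / r) by field_simp, one_div, one_div, ← cpow_neg, ← cpow_neg,
      cpow_def_of_ne_zero (mul_ne_zero hr0 hz1), cpow_def_of_ne_zero hz1, log_ofReal_mul hr hz1,
      add_mul, exp_add, ofReal_cpow hr.le, cpow_def_of_ne_zero hr0, ofReal_log hr.le]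
    push_cast
    rfl
  rw [e]
  convert! h.mul_left _ using 1
  ext k
  have e2 : (Ring.choose ((θ : ℂ) + k - 1) k) = (binomCoeff θ k : ℂ) := by
    rw [binomCoeff, ofReal_choose]; push_cast; rfl
  rw [e2, div_pow]
  push_cast
  ring

lemma norm_iteratedDeriv_le_circleAverage {F : ℂ → ℂ} {s : ℝ} (hs : 0 < s)
    (hF : DifferentiableOn ℂ F (Metric.closedBall 0 s)) (k : ℕ) :
    ‖iteratedDeriv k F 0‖ ≤ k.factorial / s ^ k * Real.circleAverage (fun z => ‖F z‖) 0 s := by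
  have h := hF.circleIntegral_one_div_sub_center_pow_smul hs k
  have h0 : (2 * Real.pi * I / k.factorial : ℂ) ≠ 0 :=
    div_ne_zero two_pi_I_ne_zero (by exact_mod_cast k.factorial_ne_zero)
  have h1 : ‖(2 * Real.pi * I / k.factorial : ℂ)‖ = 2 * Real.pi / k.factorial := by
    simp [abs_of_pos Real.pi_pos]
  have h2 : ‖∮ z in C(0, s), (1 / (z - 0) ^ (k + 1)) • F z‖ ≤
      (s ^ k)⁻¹ * ∫ φ in (0 : ℝ)..2 * Real.pi, ‖F (circleMap 0 s φ)‖ := by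
    rw [circleIntegral, ← intervalIntegral.integral_const_mul]
    refine (intervalIntegral.norm_integral_le_integral_norm Real.two_pi_pos.le).trans_eq ?_
    refine intervalIntegral.integral_congr fun φ _ => ?_
    simp only [deriv_circleMap, sub_zero, norm_smul, norm_mul, norm_circleMap_zero, norm_I,
      abs_of_pos hs, norm_div, norm_pow, norm_one]
    field_simp
    ring
  rw [h, norm_smul, h1] at h2
  have h3 : (0 : ℝ) < k.factorial := by positivity
  rw [Real.circleAverage_def, smul_eq_mul]
  calc ‖iteratedDeriv k F 0‖ = k.factorial / (2 * Real.pi) *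
        (2 * Real.pi / k.factorial * ‖iteratedDeriv k F 0‖) := by field_simp
    _ ≤ k.factorial / (2 * Real.pi) *
        ((s ^ k)⁻¹ * ∫ φ in (0 : ℝ)..2 * Real.pi, ‖F (circleMap 0 s φ)‖) := by gcongr
    _ = _ := by ring

/-- Since |r - s e^{iφ}| = |r e^{iφ} - s|, this is an average over the circle of radius r of the
Poisson kernel at s divided by r² - s², and the Poisson kernel has mean 1. -/
lemma circleAverage_inv_norm_sq {r s : ℝ} (hs : 0 < s) (hsr : s < r) :
    Real.circleAverage (fun z => (‖(r : ℂ) - z‖ ^ 2)⁻¹) 0 s = (r ^ 2 - s ^ 2)⁻¹ := by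
  have hr : 0 < r := hs.trans hsr
  have h := DiffContOnCl.circleAverage_poissonKernel_smul (E := ℂ) (f := fun _ => 1) (c := 0)
    (R := r) (w := (s : ℂ)) diffContOnCl_const (by simpa [abs_of_pos hs] using hsr)
  have h1 : Real.circleAverage (fun z => (‖(r : ℂ) - z‖ ^ 2)⁻¹) 0 s =
      Real.circleAverage (fun z => (‖z - s‖ ^ 2)⁻¹) 0 r := by
    rw [Real.circleAverage_def, Real.circleAverage_def]
    congr 1
    refine intervalIntegral.integral_congr fun φ _ => ?_
    simp only [circleMap_zero, ← normSq_eq_norm_sq, normSq_apply, sub_re, sub_im, mul_re, mul_im,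
      ofReal_re, ofReal_im, exp_ofReal_mul_I_re, exp_ofReal_mul_I_im]
    congr 1
    linear_combination (s ^ 2 - r ^ 2) * Real.sin_sq_add_cos_sq φ
  have h2 : Real.circleAverage (fun z => (((r ^ 2 - s ^ 2) • (‖z - s‖ ^ 2)⁻¹ : ℝ) : ℂ)) 0 r = 1 := by
    rw [← h]
    refine Real.circleAverage_congr_sphere fun z hz => ?_
    rw [abs_of_pos hr, mem_sphere_zero_iff_norm] at hz
    simp only [Pi.smul_apply', poissonKernel_def, sub_zero, hz, norm_real, Real.norm_eq_abs, sq_abs,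
      real_smul, mul_one, smul_eq_mul, div_eq_mul_inv]
  have h3 : Real.circleAverage (fun z => (r ^ 2 - s ^ 2) • (‖z - s‖ ^ 2)⁻¹) 0 r = 1 := by
    rw [Real.circleAverage_def] at h2 ⊢
    rw [intervalIntegral.integral_ofReal, real_smul] at h2
    exact_mod_cast h2
  rw [Real.circleAverage_fun_smul, ← h1, smul_eq_mul] at h3
  exact eq_inv_of_mul_eq_one_right h3

/-- The argument is traded for a strict inequality between continuous functions, from which openness
of the domain and stability under perturbation can be read off. -/
lemma lt_abs_arg_iff {u : ℂ} (hu : u ≠ 0) {β : ℝ} (h0 : 0 ≤ β) (h1 : β ≤ Real.pi) :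
    β < |arg u| ↔ u.re < Real.cos β * ‖u‖ := by
  rw [← Real.strictAntiOn_cos.lt_iff_gt ⟨abs_nonneg _, abs_arg_le_pi u⟩ ⟨h0, h1⟩, Real.cos_abs,
    cos_arg hu, div_lt_iff₀ (norm_pos_iff.2 hu)]

lemma mem_deltaDomain_iff {r β rhat : ℝ} (h0 : 0 ≤ β) (h1 : β ≤ Real.pi) {z : ℂ} :
    z ∈ deltaDomain r β rhat ↔ ‖z‖ < rhat ∧ (z - r).re < Real.cos β * ‖z - r‖ := by
  rcases eq_or_ne z r with rfl | hz
  · simp [deltaDomain]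
  · simp only [deltaDomain, Set.mem_ofPred_eq, hz, ne_eq, not_false_eq_true, true_and,
      lt_abs_arg_iff (sub_ne_zero.2 hz) h0 h1]

lemma isOpen_deltaDomain {r β rhat : ℝ} (h0 : 0 ≤ β) (h1 : β ≤ Real.pi) :
    IsOpen (deltaDomain r β rhat) := by
  have : deltaDomain r β rhat = {z : ℂ | ‖z‖ < rhat} ∩
      {z : ℂ | (z - r).re < Real.cos β * ‖z - r‖} := by
    ext z; exact mem_deltaDomain_iff h0 h1
  rw [this]
  exact (isOpen_lt (by fun_prop) (by fun_prop)).inter (isOpen_lt (by fun_prop) (by fun_prop))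

lemma re_sub_neg_of_norm_le {r : ℝ} {z : ℂ} (hz : ‖z‖ ≤ r) (hzr : z ≠ r) : (z - r).re < 0 := by
  rw [sub_re, ofReal_re]
  rcases (re_le_norm z).trans hz |>.lt_or_eq with h | h
  · linarith
  · refine absurd ?_ hzr
    have h1 : ‖z‖ = z.re := le_antisymm (hz.trans h.ge) (re_le_norm z)
    have h2 : z.im = 0 := by
      have := sq_norm_sub_sq_re z
      rw [h1, sub_self] at this
      exact pow_eq_zero_iff two_ne_zero |>.1 this.symm
    exact Complex.ext (by simpa using h) (by simpa using h2)

lemma closedBall_diff_subset_deltaDomain {r β rhat : ℝ} (h0 : 0 < β) (h1 : β < Real.pi / 2)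
    (hr : r < rhat) {z : ℂ} (hz : ‖z‖ ≤ r) (hzr : z ≠ r) : z ∈ deltaDomain r β rhat := by
  rw [mem_deltaDomain_iff h0.le (by linarith [Real.pi_pos])]
  refine ⟨hz.trans_lt hr, (re_sub_neg_of_norm_le hz hzr).trans_le (mul_nonneg ?_ (norm_nonneg _))⟩
  exact (Real.cos_pos_of_mem_Ioo ⟨by linarith [Real.pi_pos], h1⟩).le

/-- For |z| < r the vector z - r points into the left half-plane. Moving its end by at most cos β /
2 times its length cannot bring it into the forbidden cone, so there is room for a Cauchy estimate
at the scale |z - r|. -/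
lemma mem_deltaDomain_of_near {r β rhat : ℝ} (h0 : 0 < β) (h1 : β < Real.pi / 2)
    {z w : ℂ} (hz : ‖z‖ < r) (hzr : ‖z - r‖ < rhat - r)
    (hw : ‖w - z‖ ≤ Real.cos β / 2 * ‖z - r‖) : w ∈ deltaDomain r β rhat := by
  have hz' : z ≠ r := by rintro rfl; rw [norm_real] at hz; exact absurd hz (le_abs_self r).not_gt
  have hu : 0 < ‖z - r‖ := norm_pos_iff.2 (sub_ne_zero.2 hz')
  have hc : 0 < Real.cos β := Real.cos_pos_of_mem_Ioo ⟨by linarith [Real.pi_pos], h1⟩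
  have hc1 := Real.cos_le_one β
  rw [mem_deltaDomain_iff h0.le (by linarith [Real.pi_pos])]
  constructor
  · have : ‖w‖ ≤ ‖z‖ + ‖w - z‖ := by simpa using norm_add_le z (w - z)
    nlinarith
  · have e1 : (w - r).re = (z - r).re + (w - z).re := by simp
    have e2 := re_sub_neg_of_norm_le hz.le hz'
    have e3 := (re_le_norm (w - z)).trans hw
    have e4 : ‖z - r‖ ≤ ‖w - r‖ + ‖w - z‖ := by
      have := norm_sub_le (w - r) (w - z)
      simpa using this
    have e5 : ‖z - r‖ / 2 ≤ ‖w - r‖ := by nlinarith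
    have e6 := mul_le_mul_of_nonneg_left e5 hc.le
    linarith

lemma iteratedDeriv_of_hasSum {f : ℂ → ℂ} {φ : ℕ → ℂ} {r : ℝ} (hr : 0 < r)
    (h : ∀ z : ℂ, ‖z‖ < r → HasSum (fun k => φ k * z ^ k) (f z)) (k : ℕ) :
    iteratedDeriv k f 0 = k.factorial * φ k := by
  have h1 : HasFPowerSeriesAt f (.ofScalars ℂ φ) 0 := by
    rw [hasFPowerSeriesAt_iff]
    filter_upwards [Metric.ball_mem_nhds (0 : ℂ) hr] with z hz
    rw [mem_ball_zero_iff] at hz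
    rw [zero_add]
    convert! h z hz using 1
    ext k
    rw [FormalMultilinearSeries.coeff_ofScalars, smul_eq_mul, mul_comm]
  have h2 := h1.eq_formalMultilinearSeries h1.analyticAt.hasFPowerSeriesAt
  have h3 := FormalMultilinearSeries.ofScalars_series_injective ℂ ℂ h2
  rw [h3]
  have : (k.factorial : ℂ) ≠ 0 := by exact_mod_cast k.factorial_ne_zero
  field_simp

/-- On |z| = s the factor |r - z|^{-θ} is at most (r - s)^{-θ}, and the remaining |r - z|^{-2} has
an explicit average, at most 1/((r - s) r). -/
lemma norm_coeff_mul_pow_le {F : ℂ → ℂ} {r θ ε M s : ℝ} (hθ : 0 ≤ θ) (hε : 0 ≤ ε)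
    (hF : DifferentiableOn ℂ F (Metric.ball 0 r))
    (hb : ∀ z : ℂ, ‖z‖ < r → ‖F z‖ ≤ ε * ‖(r : ℂ) - z‖ ^ (-θ - 2) + M) (hs : 0 < s) (hsr : s < r)
    (k : ℕ) : ‖iteratedDeriv k F 0‖ ≤ k.factorial / s ^ k * (ε * ((r - s) ^ (-θ - 1) / r) + M) := by
  have hr := hs.trans hsr
  refine (norm_iteratedDeriv_le_circleAverage hs
    (hF.mono (Metric.closedBall_subset_ball hsr)) k).trans ?_
  have hcont : ContinuousOn (fun z : ℂ => (‖(r : ℂ) - z‖ ^ 2)⁻¹) (Metric.sphere 0 s) := by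
    refine ContinuousOn.inv₀ (by fun_prop) fun z hz => ?_
    rw [mem_sphere_zero_iff_norm] at hz
    refine pow_ne_zero _ (norm_ne_zero_iff.2 (sub_ne_zero.2 ?_))
    rintro rfl
    rw [norm_real, Real.norm_of_nonneg hr.le] at hz
    exact hsr.ne' hz
  have hI := hcont.circleIntegrable hs.le
  have hI2 : CircleIntegrable (fun z => (ε * (r - s) ^ (-θ)) • (‖(r : ℂ) - z‖ ^ 2)⁻¹) 0 s :=
    hI.const_smul
  have hIF : CircleIntegrable (fun z => ‖F z‖) 0 s :=
    ((hF.continuousOn.mono ((Metric.sphere_subset_closedBall).trans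
      (Metric.closedBall_subset_ball hsr))).norm).circleIntegrable hs.le
  gcongr
  calc Real.circleAverage (fun z => ‖F z‖) 0 s
      ≤ Real.circleAverage (fun z => (ε * (r - s) ^ (-θ)) • (‖(r : ℂ) - z‖ ^ 2)⁻¹ + M) 0 s := by
        refine Real.circleAverage_mono hIF (hI2.add (circleIntegrable_const M 0 s))
          fun z hz => ?_
        rw [abs_of_pos hs, mem_sphere_zero_iff_norm] at hz
        have h1 : r - s ≤ ‖(r : ℂ) - z‖ := by
          have := norm_sub_norm_le (r : ℂ) z
          rwa [norm_real, Real.norm_of_nonneg hr.le, hz] at this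
        have h2 : 0 < ‖(r : ℂ) - z‖ := by linarith
        refine (hb z (by rw [hz]; exact hsr)).trans ?_
        rw [show -θ - 2 = -θ + -2 by ring, Real.rpow_add h2, Real.rpow_neg h2.le 2, smul_eq_mul,
          Real.rpow_two, mul_assoc]
        gcongr ε * (?_ * _) + M
        exact Real.rpow_le_rpow_of_nonpos (by linarith) h1 (by linarith)
    _ = ε * (r - s) ^ (-θ) * (r ^ 2 - s ^ 2)⁻¹ + M := by
        rw [Real.circleAverage_fun_add hI2 (circleIntegrable_const M 0 s),
          Real.circleAverage_fun_smul, circleAverage_inv_norm_sq hs hsr, Real.circleAverage_const,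
          smul_eq_mul]
    _ ≤ ε * ((r - s) ^ (-θ - 1) / r) + M := by
        have h1 : 0 < r - s := by linarith
        rw [Real.rpow_sub h1, Real.rpow_one, mul_assoc, div_div, ← div_eq_mul_inv]
        gcongr
        nlinarith

/-- Close to r, Cauchy's estimate on a disc of radius κ|z - r| costs two powers of |z - r|. Away
from r, f'' is bounded on the closed disc by compactness. -/
lemma exists_norm_deriv_deriv_le {f : ℂ → ℂ} {r β rhat θ : ℝ} (hθ : 0 < θ) (h0 : 0 < β)
    (h1 : β < Real.pi / 2) (hr : r < rhat) (hf : DifferentiableOn ℂ f (deltaDomain r β rhat))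
    (hfo : ∀ ε > 0, ∃ δ > 0, ∀ w ∈ deltaDomain r β rhat, ‖w - r‖ < δ → ‖f w‖ ≤ ε * ‖w - r‖ ^ (-θ))
    {ε : ℝ} (hε : 0 < ε) :
    ∃ M, 0 ≤ M ∧ ∀ z : ℂ, ‖z‖ < r → ‖deriv (deriv f) z‖ ≤ ε * ‖(r : ℂ) - z‖ ^ (-θ - 2) + M := by
  set κ := Real.cos β / 2 with hκ
  have hc : 0 < Real.cos β := Real.cos_pos_of_mem_Ioo ⟨by linarith [Real.pi_pos], h1⟩
  have hc1 := Real.cos_le_one β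
  have hκ0 : 0 < κ := by positivity
  have hopen := isOpen_deltaDomain (r := r) (rhat := rhat) h0.le (by linarith [Real.pi_pos] : β ≤ Real.pi)
  -- The 2 and κ² cancel 2!/κ² in Cauchy's estimate; 2 ^ θ pays for |w - r| ≥ |z - r|/2 on the
  -- circle.
  obtain ⟨δ, hδ, hfδ⟩ := hfo (ε * κ ^ 2 / (2 * 2 ^ θ)) (by positivity)
  set η := min (δ / 2) (rhat - r) with hη
  have hη0 : 0 < η := lt_min (by positivity) (by linarith)
  have hnear : ∀ z : ℂ, ‖z‖ < r → ‖z - r‖ < η →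
      ‖deriv (deriv f) z‖ ≤ ε * ‖(r : ℂ) - z‖ ^ (-θ - 2) := by
    intro z hz hzη
    have hz' : z ≠ r := by rintro rfl; rw [norm_real] at hz; exact absurd hz (le_abs_self r).not_gt
    have hu : 0 < ‖z - r‖ := norm_pos_iff.2 (sub_ne_zero.2 hz')
    have hsub : Metric.closedBall z (κ * ‖z - r‖) ⊆ deltaDomain r β rhat := fun w hw =>
      mem_deltaDomain_of_near h0 h1 hz (hzη.trans_le (min_le_right _ _))
        (by rwa [mem_closedBall_iff_norm] at hw)
    have hR : 0 < κ * ‖z - r‖ := by positivity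
    have hd : DiffContOnCl ℂ f (Metric.ball z (κ * ‖z - r‖)) :=
      (hf.mono (by rw [closure_ball z hR.ne']; exact hsub)).diffContOnCl
    have h2 := Complex.norm_iteratedDeriv_le_of_forall_mem_sphere_norm_le 2 hR hd
      (C := ε * κ ^ 2 / (2 * 2 ^ θ) * (2 ^ θ * ‖z - r‖ ^ (-θ))) fun w hw => by
        have hw2 : ‖w - z‖ = κ * ‖z - r‖ := by rwa [mem_sphere_iff_norm] at hw
        have hw3 : ‖w - r‖ ≤ ‖z - r‖ + ‖w - z‖ := by simpa using norm_add_le (z - r) (w - z)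
        have hw4 : ‖z - r‖ ≤ ‖w - r‖ + ‖w - z‖ := by simpa using norm_sub_le (w - r) (w - z)
        have hw5 : ‖z - r‖ / 2 ≤ ‖w - r‖ := by nlinarith
        have hw6 : ‖w - r‖ < δ := by
          have := hzη.trans_le (min_le_left _ _)
          nlinarith
        refine (hfδ w (hsub (Metric.sphere_subset_closedBall hw)) hw6).trans ?_
        gcongr
        calc ‖w - r‖ ^ (-θ) ≤ (‖z - r‖ / 2) ^ (-θ) :=
              Real.rpow_le_rpow_of_nonpos (by positivity) hw5 (by linarith)
          _ = 2 ^ θ * ‖z - r‖ ^ (-θ) := by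
              rw [Real.div_rpow hu.le two_pos.le, Real.rpow_neg two_pos.le, div_inv_eq_mul, mul_comm]
    rw [iteratedDeriv_succ, iteratedDeriv_one] at h2
    refine h2.trans_eq ?_
    rw [norm_sub_rev (r : ℂ) z, Real.rpow_sub hu, Real.rpow_two]
    have : (2 : ℝ) ^ θ ≠ 0 := (Real.rpow_pos_of_pos two_pos _).ne'
    norm_num [Nat.factorial]
    field_simp
  have hcomp : IsCompact (Metric.closedBall (0 : ℂ) r \ Metric.ball (r : ℂ) η) :=
    (isCompact_closedBall _ _).diff Metric.isOpen_ball
  have hcont : ContinuousOn (deriv (deriv f)) (Metric.closedBall (0 : ℂ) r \ Metric.ball (r : ℂ) η) := by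
    refine ((hf.deriv hopen).deriv hopen).continuousOn.mono fun z hz => ?_
    refine closedBall_diff_subset_deltaDomain h0 h1 hr (by simpa using hz.1) ?_
    rintro rfl
    exact hz.2 (Metric.mem_ball_self hη0)
  obtain ⟨M, hM⟩ := hcomp.exists_bound_of_continuousOn hcont
  refine ⟨max M 0, le_max_right _ _, fun z hz => ?_⟩
  have hpos : 0 ≤ ε * ‖(r : ℂ) - z‖ ^ (-θ - 2) := by positivity
  rcases lt_or_ge ‖z - r‖ η with h | h
  · exact (hnear z hz h).trans (le_add_of_nonneg_right (le_max_right _ _))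
  · refine (hM z ⟨by simpa using hz.le, by simpa [dist_eq_norm] using h⟩).trans ?_
    exact (le_max_left _ _).trans (le_add_of_nonneg_left hpos)

/-- Passing to f'' raises the singular exponent to θ + 2 > 2, where the mean over a circle near r is
of the right order and is computed by the Poisson kernel. Thus plain circles suffice for every θ >
0, in place of a Hankel contour, and dividing by k(k - 1) returns to the coefficients of f. -/
lemma tendsto_norm_coeff_of_isLittleO {f : ℂ → ℂ} {r β rhat θ : ℝ} (hθ : 0 < θ) (h0 : 0 < β)
    (h1 : β < Real.pi / 2) (hr0 : 0 < r) (hr : r < rhat)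
    (hf : DifferentiableOn ℂ f (deltaDomain r β rhat))
    (hfo : ∀ ε > 0, ∃ δ > 0, ∀ w ∈ deltaDomain r β rhat, ‖w - r‖ < δ → ‖f w‖ ≤ ε * ‖w - r‖ ^ (-θ))
    {φ : ℕ → ℂ} (hφ : ∀ z : ℂ, ‖z‖ < r → HasSum (fun k => φ k * z ^ k) (f z)) :
    Tendsto (fun k : ℕ => (k + 1 : ℝ) ^ (1 - θ) * r ^ k * ‖φ k‖) atTop (𝓝 0) := by
  have hopen := isOpen_deltaDomain (r := r) (rhat := rhat) h0.le (by linarith [Real.pi_pos] : β ≤ Real.pi)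
  have hball : Metric.ball (0 : ℂ) r ⊆ deltaDomain r β rhat := fun z hz => by
    rw [mem_ball_zero_iff] at hz
    refine closedBall_diff_subset_deltaDomain h0 h1 hr hz.le ?_
    rintro rfl; rw [norm_real] at hz; exact absurd hz (le_abs_self r).not_gt
  have hF := ((hf.deriv hopen).deriv hopen).mono hball
  have key : ∀ ε > 0, ∃ M, 0 ≤ M ∧ ∀ k : ℕ, 2 ≤ k → (k + 1 : ℝ) ^ (1 - θ) * r ^ k * ‖φ k‖ ≤
      18 * r ^ 2 * (ε * r ^ (-θ - 2) + M * (k + 1 : ℝ) ^ (-θ - 1)) := by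
    intro ε hε
    obtain ⟨M, hM0, hM⟩ := exists_norm_deriv_deriv_le hθ h0 h1 hr hf hfo hε
    refine ⟨M, hM0, fun k hk => ?_⟩
    obtain ⟨m, rfl⟩ := Nat.exists_eq_add_of_le' hk
    have hn : (0 : ℝ) < m + 3 := by positivity
    -- With k = m + 2 the radius is r(1 - 1/(k + 1)), the scale on which (r/s)^m stays bounded, here
    -- by e ≤ 3. The constant 18 below is 6 · 3.
    set s := r * ((m + 2) / (m + 3)) with hs
    have hs0 : 0 < s := by positivity
    have hrs : r - s = r / (m + 3) := by rw [hs]; field_simp; ring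
    have hsr : s < r := by
      have : 0 < r / (m + 3 : ℝ) := by positivity
      linarith
    have h2 := norm_coeff_mul_pow_le hθ.le hε.le hF hM hs0 hsr m
    rw [← iteratedDeriv_succ', ← iteratedDeriv_succ', iteratedDeriv_of_hasSum hr0 hφ, norm_mul,
      norm_natCast, hrs, Real.div_rpow hr0.le hn.le, show m + 1 + 1 = m + 2 from rfl] at h2
    have hexp : (r / s) ^ m ≤ 3 := by
      have e1 : r / s = 1 + 1 / (m + 2) := by rw [hs]; field_simp; ring
      have e2 : 1 + 1 / (m + 2 : ℝ) ≤ Real.exp (1 / (m + 2)) := by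
        rw [add_comm]; exact Real.add_one_le_exp _
      calc (r / s) ^ m ≤ (Real.exp (1 / (m + 2))) ^ m := by rw [e1]; gcongr
        _ = Real.exp (m * (1 / (m + 2))) := (Real.exp_nat_mul _ _).symm
        _ ≤ Real.exp 1 := by
            gcongr
            rw [mul_one_div, div_le_one (by positivity)]; linarith
        _ ≤ 3 := Real.exp_one_lt_three.le
    have hfac : ((m + 2).factorial : ℝ) = (m + 2) * (m + 1) * m.factorial := by
      rw [Nat.factorial_succ, Nat.factorial_succ]; push_cast; ring
    have hfac0 : (0 : ℝ) < m.factorial := by positivity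
    have h3 : ‖φ (m + 2)‖ ≤ ((m + 2) * (m + 1) : ℝ)⁻¹ * (s ^ m)⁻¹ *
        (ε * (r ^ (-θ - 1) / (m + 3 : ℝ) ^ (-θ - 1) / r) + M) := by
      rw [hfac] at h2
      rw [← mul_le_mul_iff_right₀ (by positivity : (0 : ℝ) < (m + 2) * (m + 1) * m.factorial)]
      refine h2.trans_eq ?_
      field_simp
    set q := (m + 3 : ℝ) ^ (-θ - 1) with hq
    have hq0 : 0 < q := Real.rpow_pos_of_pos hn _
    have h4 : (m + 3 : ℝ) ^ (1 - θ) = (m + 3) ^ 2 * q := by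
      rw [hq, ← Real.rpow_two, ← Real.rpow_add hn]; congr 1; ring
    have h5 : r ^ (-θ - 1) / r = r ^ (-θ - 2) := by
      rw [show -θ - 2 = -θ - 1 - 1 by ring, Real.rpow_sub hr0 (-θ - 1) 1, Real.rpow_one]
    push_cast
    rw [show (m + 2 + 1 : ℝ) = m + 3 by ring, ← hq, h4]
    have h6 : ((m : ℝ) + 3) ^ 2 * ((m + 2) * (m + 1) : ℝ)⁻¹ ≤ 6 := by
      rw [← div_eq_mul_inv, div_le_iff₀ (by positivity)]
      nlinarith [(Nat.cast_nonneg m : (0 : ℝ) ≤ m)]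
    have h7 : 0 < ε * r ^ (-θ - 2) + M * q := by positivity
    calc (m + 3 : ℝ) ^ 2 * q * r ^ (m + 2) * ‖φ (m + 2)‖
        ≤ (m + 3 : ℝ) ^ 2 * q * r ^ (m + 2) * (((m + 2) * (m + 1) : ℝ)⁻¹ * (s ^ m)⁻¹ *
          (ε * (r ^ (-θ - 1) / q / r) + M)) := by gcongr
      _ = (((m : ℝ) + 3) ^ 2 * ((m + 2) * (m + 1) : ℝ)⁻¹) * (r / s) ^ m * r ^ 2 *
          (ε * (r ^ (-θ - 1) / r) + M * q) := by
          rw [div_pow, pow_add]; field_simp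
      _ ≤ 6 * 3 * r ^ 2 * (ε * r ^ (-θ - 2) + M * q) := by rw [h5]; gcongr
      _ = _ := by ring
  have hdecay : Tendsto (fun k : ℕ => (k + 1 : ℝ) ^ (-θ - 1)) atTop (𝓝 0) := by
    have := (tendsto_rpow_neg_atTop (by linarith : 0 < θ + 1)).comp
      (tendsto_atTop_add_const_right _ (1 : ℝ) tendsto_natCast_atTop_atTop)
    refine this.congr fun k => ?_
    rw [Function.comp_apply]; congr 1; ring
  refine (tendsto_order.2 ⟨fun a ha => Eventually.of_forall fun k => ha.trans_le (by positivity),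
    fun a ha => ?_⟩)
  have hr2 : 0 < r ^ (-θ - 2) := Real.rpow_pos_of_pos hr0 _
  obtain ⟨M, hM0, hM⟩ := key (a / (36 * r ^ 2 * r ^ (-θ - 2))) (by positivity)
  have h8 := (hdecay.const_mul (18 * r ^ 2 * M)).eventually_lt_const
    (show 18 * r ^ 2 * M * 0 < a / 2 by rw [mul_zero]; positivity)
  filter_upwards [h8, eventually_ge_atTop 2] with k hk hk2
  refine (hM k hk2).trans_lt ?_
  have h9 : 18 * r ^ 2 * (a / (36 * r ^ 2 * r ^ (-θ - 2)) * r ^ (-θ - 2)) = a / 2 := by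
    field_simp; norm_num
  rw [mul_add, h9]
  linarith

/-- Transfer of `g ~ c / (r - z) ^ θ` to the coefficients of `g`. -/
lemma tendsto_scaled_of_isEquivalent {g : ℂ → ℂ} {r β rhat θ c : ℝ} (hθ : 0 < θ) (h0 : 0 < β)
    (h1 : β < Real.pi / 2) (hr0 : 0 < r) (hr : r < rhat)
    (hg : DifferentiableOn ℂ g (deltaDomain r β rhat))
    (hgc : g ~[𝓝[deltaDomain r β rhat] (r : ℂ)] (fun z => (c : ℂ) / ((r : ℂ) - z) ^ (θ : ℂ)))
    {v : ℕ → ℝ} (hv : ∀ z : ℂ, ‖z‖ < r → HasSum (fun k => (v k : ℂ) * z ^ k) (g z)) :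
    Tendsto (scaled θ r v) atTop (𝓝 (c * (r ^ (-θ) * (Real.Gamma θ)⁻¹))) := by
  have hβ : β ≤ Real.pi := by linarith [Real.pi_pos]
  -- The domain omits the ray [r, ∞), so r - z avoids the branch cut of the principal power.
  have hslit : ∀ z ∈ deltaDomain r β rhat, (r : ℂ) - z ∈ slitPlane := by
    intro z hz
    rw [mem_deltaDomain_iff h0.le hβ] at hz
    rw [mem_slitPlane_iff]
    by_contra hcon
    push Not at hcon
    have e1 : 0 ≤ (z - r).re := by have := hcon.1; simp only [sub_re] at this ⊢; linarith
    have e2 : (z - r).im = 0 := by have := hcon.2; simp only [sub_im] at this ⊢; linarith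
    have e3 : ‖z - r‖ = (z - r).re := by
      rw [← re_add_im (z - r), e2]; simp only [ofReal_zero, zero_mul, add_zero, norm_real, ofReal_re]
      exact abs_of_nonneg e1
    rw [e3] at hz
    nlinarith [hz.2, Real.cos_le_one β]
  set h : ℂ → ℂ := fun z => (c : ℂ) / ((r : ℂ) - z) ^ (θ : ℂ) with hh
  have hhd : DifferentiableOn ℂ h (deltaDomain r β rhat) := by
    intro z hz
    have hne : ((r : ℂ) - z) ^ (θ : ℂ) ≠ 0 := by
      simp [cpow_eq_zero_iff, slitPlane_ne_zero (hslit z hz)]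
    exact ((differentiableAt_const _).div
      (((differentiableAt_const _).sub differentiableAt_id).cpow_const (hslit z hz))
      hne).differentiableWithinAt
  -- The model function h has explicit binomial coefficients, and the remainder g - h is small
  -- enough at r for its coefficients to be negligible.
  have hlittle : (g - h) =o[𝓝[deltaDomain r β rhat] (r : ℂ)] fun z => ‖z - r‖ ^ (-θ) := by
    have e1 : (g - h) =o[𝓝[deltaDomain r β rhat] (r : ℂ)] h := hgc.isLittleO
    refine e1.trans_isBigO ?_
    refine IsBigO.of_bound |c| (Eventually.of_forall fun z => ?_)
    rw [hh, norm_div, norm_cpow_real, norm_real, norm_sub_rev, Real.norm_eq_abs, Real.norm_of_nonneg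
      (by positivity), Real.rpow_neg (norm_nonneg _), div_eq_mul_inv]
  have hfo : ∀ ε > 0, ∃ δ > 0, ∀ w ∈ deltaDomain r β rhat, ‖w - r‖ < δ →
      ‖(g - h) w‖ ≤ ε * ‖w - r‖ ^ (-θ) := by
    intro ε hε
    have e1 := hlittle.def hε
    rw [eventually_nhdsWithin_iff, Metric.eventually_nhds_iff] at e1
    obtain ⟨δ, hδ, hw⟩ := e1
    refine ⟨δ, hδ, fun w hwD hwr => ?_⟩
    have := hw (by rwa [dist_eq_norm]) hwD
    rwa [Real.norm_of_nonneg (by positivity)] at this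
  have hφ : ∀ z : ℂ, ‖z‖ < r → HasSum
      (fun k => ((v k - c * (r ^ (-θ) * binomCoeff θ k / r ^ k) : ℝ) : ℂ) * z ^ k) ((g - h) z) := by
    intro z hz
    have e := (hv z hz).sub ((hasSum_binomCoeff (θ := θ) hr0 hz).mul_left (c : ℂ))
    rw [mul_one_div] at e
    convert! e using 1
    ext k; push_cast; ring
  have e1 := tendsto_norm_coeff_of_isLittleO hθ h0 h1 hr0 hr (hg.sub hhd) hfo hφ
  have e2 : Tendsto (fun k : ℕ => (k + 1 : ℝ) ^ (1 - θ) * r ^ k *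
      (v k - c * (r ^ (-θ) * binomCoeff θ k / r ^ k))) atTop (𝓝 0) := by
    rw [tendsto_zero_iff_norm_tendsto_zero]
    refine e1.congr fun k => ?_
    rw [norm_real, norm_mul, norm_mul, Real.norm_of_nonneg (by positivity : 0 ≤ (k + 1 : ℝ) ^ (1 - θ)),
      Real.norm_of_nonneg (pow_nonneg hr0.le k)]
  have e3 := e2.add ((tendsto_scaled_binomCoeff hθ).const_mul (c * r ^ (-θ)))
  rw [zero_add, mul_assoc] at e3
  refine e3.congr fun k => ?_
  rw [scaled]
  field_simp
  ring

end Transfer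

/-! ### Singularities of the transform -/

section Extension

variable {lam : ℝ} {ν : Measure ℝ} [IsProbabilityMeasure ν]

lemma hasSum_lst (hlam : 0 < lam) (hν : ν (Set.Iio 0) = 0) {z : ℂ} (hz : ‖z‖ < 1) :
    HasSum (fun k => (mixedPoisson lam ν k : ℂ) * z ^ k) (lst ν (lam - lam * z)) := by
  have hint : ∀ k, Integrable (fun t => (poissonProb lam k t : ℂ) * z ^ k) ν := fun k =>
    ((integrable_poissonProb hlam hν k).ofReal).mul_const _
  have hnorm : ∀ k, ∫ t, ‖(poissonProb lam k t : ℂ) * z ^ k‖ ∂ν = mixedPoisson lam ν k * ‖z‖ ^ k := by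
    intro k
    rw [mixedPoisson, ← integral_mul_const]
    refine integral_congr_ae ?_
    filter_upwards [ae_nonneg_of_measure_Iio hν] with t ht
    rw [norm_mul, norm_pow, Complex.norm_real, Real.norm_of_nonneg (poissonProb_nonneg hlam ht k)]
  have hsum : Summable fun k => ∫ t, ‖(poissonProb lam k t : ℂ) * z ^ k‖ ∂ν := by
    simp only [hnorm]
    refine Summable.of_nonneg_of_le (fun k => mul_nonneg (mixedPoisson_nonneg hlam hν k)
      (by positivity)) (fun k => ?_) (hasSum_mixedPoisson hlam hν).summable
    exact mul_le_of_le_one_right (mixedPoisson_nonneg hlam hν k) (pow_le_one₀ (norm_nonneg _) hz.le)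
  have h := hasSum_integral_of_summable_integral_norm hint hsum
  convert! h using 1
  · ext k
    rw [integral_mul_const, mixedPoisson, integral_complex_ofReal]
  · refine integral_congr_ae (Eventually.of_forall fun t => ?_)
    beta_reduce
    have h1 := (NormedSpace.expSeries_div_hasSum_exp ((lam : ℂ) * t * z)).mul_left
      (Complex.exp (-(lam * t)))
    rw [← Complex.exp_eq_exp_ℂ, ← Complex.exp_add] at h1
    rw [show -((lam : ℂ) - lam * z) * t = -(lam * t) + lam * t * z by ring, ← h1.tsum_eq]
    refine tsum_congr fun k => ?_
    unfold poissonProb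
    push_cast
    rw [mul_pow _ z]; ring

/-- Agreement near 0 fixes the Taylor coefficients, and the Taylor series of a function analytic in
a disc converges in the whole disc. -/
lemma hasSum_mixedPoisson_of_differentiableOn (hlam : 0 < lam) (hν : ν (Set.Iio 0) = 0) {g : ℂ → ℂ}
    {R : ℝ} (hg : DifferentiableOn ℂ g (Metric.ball 0 R)) {R' : ℝ} (hR' : 0 < R')
    (hR'1 : R' ≤ 1) (hgl : ∀ z : ℂ, ‖z‖ < R' → g z = lst ν (lam - lam * z)) {z : ℂ} (hz : ‖z‖ < R) :
    HasSum (fun k => (mixedPoisson lam ν k : ℂ) * z ^ k) (g z) := by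
  have h := Complex.hasSum_taylorSeries_on_ball hg (z := z) (by simpa using hz)
  have h1 := iteratedDeriv_of_hasSum (f := g) hR' (φ := fun k => (mixedPoisson lam ν k : ℂ))
    fun w hw => by rw [hgl w hw]; exact hasSum_lst hlam hν (hw.trans_le hR'1)
  convert! h using 1
  ext k
  have : (k.factorial : ℂ) ≠ 0 := by exact_mod_cast k.factorial_ne_zero
  rw [h1, sub_zero, smul_eq_mul, smul_eq_mul]
  field_simp

/-- The half-plane re z < y contains the disc |z| < y, so the radius of convergence is at least the
abscissa of the leftmost singularity. -/
lemma summable_mixedPoisson_mul_pow (hlam : 0 < lam) (hν : ν (Set.Iio 0) = 0) {x : ℝ} (hx : 0 ≤ x)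
    (h : (x : EReal) < leftmostSingularity lam ν) :
    Summable fun k => mixedPoisson lam ν k * x ^ k := by
  obtain ⟨y, ⟨g, hg, hgl⟩, hxy⟩ := lt_sSup_iff.1 h
  obtain ⟨w, hxw, hwy⟩ := EReal.lt_iff_exists_real_btwn.1 hxy
  have hxw : x < w := by exact_mod_cast hxw
  have h1 := hasSum_mixedPoisson_of_differentiableOn hlam hν (g := g) (R := w)
    (hg.mono fun z hz => ?_) one_pos le_rfl
    (fun z hz => hgl z ((Complex.re_le_norm z).trans_lt hz)) (z := (x : ℂ))
    (by rwa [Complex.norm_real, Real.norm_of_nonneg hx])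
  · have h2 := h1.summable
    exact_mod_cast h2
  · rw [mem_ball_zero_iff] at hz
    have : z.re < w := (Complex.re_le_norm z).trans_lt hz
    exact lt_trans (by exact_mod_cast this) hwy

end Extension

/-! ### Renewal sequences with exponentially decreasing weights -/

section Renewal

open PowerSeries

/-- The complex power series with the coefficients of a real one. -/
noncomputable def complexSeries (f : PowerSeries ℝ) : PowerSeries ℂ := PowerSeries.map Complex.ofRealHom f

lemma coeff_complexSeries (f : PowerSeries ℝ) (n : ℕ) :
    coeff n (complexSeries f) = ((coeff n f : ℝ) : ℂ) := by
  rw [complexSeries, coeff_map]; rfl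

lemma absConv_complexSeries {f : PowerSeries ℝ} {x : ℝ} :
    AbsConv (complexSeries f) (x : ℂ) ↔ AbsConv f x := by
  unfold AbsConv
  simp only [coeff_complexSeries, ← Complex.ofReal_pow, ← Complex.ofReal_mul, Complex.norm_real]

lemma evalSum_complexSeries (f : PowerSeries ℝ) (x : ℝ) :
    evalSum (complexSeries f) (x : ℂ) = evalSum f x := by
  unfold evalSum
  rw [Complex.ofReal_tsum]
  refine tsum_congr fun n => ?_
  rw [coeff_complexSeries]; push_cast; rfl

lemma PowerSeries.eq_of_hasSum {f g : PowerSeries ℂ} {F : ℂ → ℂ} {r : ℝ} (hr : 0 < r)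
    (hf : ∀ z : ℂ, ‖z‖ < r → HasSum (fun k => coeff k f * z ^ k) (F z))
    (hg : ∀ z : ℂ, ‖z‖ < r → HasSum (fun k => coeff k g * z ^ k) (F z)) : f = g := by
  ext k
  have h := (iteratedDeriv_of_hasSum hr hf k).symm.trans (iteratedDeriv_of_hasSum hr hg k)
  exact mul_left_cancel₀ (by exact_mod_cast k.factorial_ne_zero) h

lemma differentiableOn_evalSum {f : PowerSeries ℂ} {x : ℝ} (hx : 0 < x) (hf : AbsConv f (x : ℂ)) :
    DifferentiableOn ℂ (evalSum f) (Metric.ball 0 x) := by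
  refine Complex.differentiableOn_tsum_of_summable_norm (u := fun n => ‖coeff n f * (x : ℂ) ^ n‖) hf
    (fun n => ((differentiable_const _).mul (differentiable_pow n)).differentiableOn) Metric.isOpen_ball
    fun n z hz => ?_
  rw [mem_ball_zero_iff] at hz
  rw [norm_mul, norm_mul, norm_pow, norm_pow, Complex.norm_real, Real.norm_of_nonneg hx.le]
  gcongr

/-- Inversion of a power series without zeros in the closed unit disc. -/
lemma absConv_inv_of_ne_zero {T U : PowerSeries ℝ} (hTU : U * T = 1) {x : ℝ} (hx : 1 < x)
    (hT : AbsConv T x) (h0 : ∀ z : ℂ, ‖z‖ ≤ 1 → evalSum (complexSeries T) z ≠ 0) : AbsConv U 1 := by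
  have hTc : AbsConv (complexSeries T) (x : ℂ) := absConv_complexSeries.2 hT
  have hd := differentiableOn_evalSum (by linarith) hTc
  have hopen : IsOpen (Metric.ball (0 : ℂ) x ∩ evalSum (complexSeries T) ⁻¹' {0}ᶜ) :=
    hd.continuousOn.isOpen_inter_preimage Metric.isOpen_ball isOpen_compl_singleton
  -- By compactness the zero-free region reaches a disc of radius 1 + δ, where 1/T has a convergent
  -- Taylor series u. As formal series u T = 1, so u is U.
  obtain ⟨δ, hδ, hsub⟩ := (isCompact_closedBall (0 : ℂ) 1).exists_thickening_subset_open hopen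
    fun z hz => by
      rw [mem_closedBall_zero_iff] at hz
      exact ⟨by rw [mem_ball_zero_iff]; linarith, h0 z hz⟩
  rw [thickening_closedBall hδ zero_le_one] at hsub
  set F : ℂ → ℂ := fun z => (evalSum (complexSeries T) z)⁻¹
  have hF : DifferentiableOn ℂ F (Metric.ball 0 (δ + 1)) :=
    (hd.mono fun z hz => (hsub hz).1).inv fun z hz => (hsub hz).2
  set u : PowerSeries ℂ := mk fun k => (k.factorial : ℂ)⁻¹ * iteratedDeriv k F 0
  have hu : ∀ z : ℂ, ‖z‖ < δ + 1 → HasSum (fun k => coeff k u * z ^ k) (F z) := by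
    intro z hz
    have h := Complex.hasSum_taylorSeries_on_ball hF (z := z) (by simpa using hz)
    convert! h using 1
    ext k
    rw [coeff_mk, sub_zero, smul_eq_mul, smul_eq_mul]; ring
  have huc : ∀ z : ℂ, ‖z‖ < δ + 1 → AbsConv u z := fun z hz => (hu z hz).summable.norm
  have huT : u * complexSeries T = 1 := by
    refine PowerSeries.eq_of_hasSum (F := fun _ => 1) one_pos (fun z hz => ?_)
      fun z _ => hasSum_one_mul_pow z
    have h1 := huc z (by linarith)
    have h2 : AbsConv (complexSeries T) z := hTc.of_norm_le (by
      rw [Complex.norm_real, Real.norm_of_nonneg (by linarith)]; linarith)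
    have h3 := (h1.mul h2).hasSum
    rwa [evalSum_mul h1 h2, show evalSum u z = F z from (hu z (by linarith)).tsum_eq,
      inv_mul_cancel₀ (h0 z hz.le)] at h3
  have hUT : complexSeries U * complexSeries T = 1 := by
    rw [complexSeries, complexSeries, ← map_mul, hTU, map_one]
  have hUu : complexSeries U = u := by
    calc complexSeries U = complexSeries U * (u * complexSeries T) := by rw [huT, mul_one]
      _ = u * (complexSeries U * complexSeries T) := by ring
      _ = u := by rw [hUT, mul_one]
  rw [← absConv_complexSeries, hUu]
  exact huc _ (by simpa using hδ)

/-- Equality in the triangle inequality: the nonnegative numbers p_k - Re(p_k z^k) sum to 0, hence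
all vanish. The case k = 1 gives Re z = 1; the assumption p_1 > 0 plays the part of aperiodicity. -/
lemma eq_one_of_tsum_mul_pow_eq_one {p : ℕ → ℝ} (hp : ∀ k, 0 ≤ p k) (hs : HasSum p 1)
    (h1 : 0 < p 1) {z : ℂ} (hz : ‖z‖ ≤ 1) (h : ∑' k, (p k : ℂ) * z ^ k = 1) : z = 1 := by
  have hsum : Summable fun k => (p k : ℂ) * z ^ k := by
    refine Summable.of_norm_bounded hs.summable fun k => ?_
    rw [norm_mul, norm_pow, Complex.norm_real, Real.norm_of_nonneg (hp k)]
    exact mul_le_of_le_one_right (hp k) (pow_le_one₀ (norm_nonneg _) hz)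
  have h2 := Complex.hasSum_re (hsum.hasSum)
  rw [h, Complex.one_re] at h2
  have h3 := hs.sub h2
  rw [sub_self] at h3
  have h4 : ∀ k, 0 ≤ p k - ((p k : ℂ) * z ^ k).re := fun k => by
    rw [Complex.re_ofReal_mul]
    have : (z ^ k).re ≤ 1 := (Complex.re_le_norm _).trans (by
      rw [norm_pow]; exact pow_le_one₀ (norm_nonneg _) hz)
    nlinarith [hp k]
  have h5 := congrFun ((hasSum_zero_iff_of_nonneg h4).1 h3) 1
  simp only [pow_one, Complex.re_ofReal_mul, Pi.zero_apply] at h5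
  have h6 : z.re = 1 := by
    have : p 1 * (1 - z.re) = 0 := by linarith
    rcases mul_eq_zero.1 this with h | h <;> linarith
  have h7 : z.im = 0 := by
    have h8 := Complex.sq_norm_sub_sq_re z
    rw [h6] at h8
    have : z.im ^ 2 = 0 := le_antisymm (by nlinarith [norm_nonneg z]) (sq_nonneg _)
    exact pow_eq_zero_iff two_ne_zero |>.1 this
  exact Complex.ext (by simpa using h6) (by simpa using h7)

/-- The renewal theorem for weights with an exponential moment. -/
lemma tendsto_coeff_renewal {p G : PowerSeries ℝ} (hp : ∀ k, 0 ≤ coeff k p)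
    (hs : HasSum (fun k => coeff k p) 1) (h1 : 0 < coeff 1 p) {x : ℝ} (hx : 1 < x)
    (hpx : Summable fun k => coeff k p * x ^ k) (hG : G * (1 - p) = 1) :
    evalSum (tailSeries p) 1 ≠ 0 ∧
      Tendsto (fun n => coeff n G) atTop (𝓝 (evalSum (tailSeries p) 1)⁻¹) := by
  set T := tailSeries p with hT
  have hTnn : ∀ k, 0 ≤ coeff k T := fun k => by
    rw [hT, coeff_tailSeries]; exact tail_nonneg hp hs k
  have hTx : AbsConv T x := by
    rw [absConv_of_nonneg hTnn (by linarith)]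
    simp only [hT, coeff_tailSeries]
    exact summable_tail_mul_pow hp hs hx hpx
  have hT1 : AbsConv T 1 := hTx.of_norm_le (by rw [norm_one, Real.norm_of_nonneg] <;> linarith)
  have hT0 : 0 < coeff 0 T := by
    have := sum_le_hasSum (Finset.range 2) (fun k _ => hp k) hs
    rw [hT, coeff_tailSeries]
    simp only [Finset.sum_range_succ, Finset.sum_range_zero] at this ⊢
    linarith
  have hTpos : 0 < evalSum T 1 := by
    have := hT1.hasSum.summable.sum_le_tsum (Finset.range 1) fun k _ => by simpa using hTnn k
    simp only [Finset.sum_range_one, pow_zero, mul_one] at this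
    exact hT0.trans_le this
  -- This splits off the zero of 1 - p at 1. The coefficients of G = T⁻¹/(1 - X) are then the
  -- partial sums of those of T⁻¹, which are absolutely summable because T has no zero in the closed
  -- unit disc.
  have hfac : T * (1 - X) = 1 - p := tailSeries_mul_one_sub_X p
  have hinv : T⁻¹ * T = 1 := PowerSeries.inv_mul_cancel _ (by
    rw [← coeff_zero_eq_constantCoeff_apply]; exact hT0.ne')
  have hpc : ∀ z : ℂ, ‖z‖ ≤ 1 → AbsConv (complexSeries p) z := fun z hz =>
    AbsConv.of_norm_le (w := ((1 : ℝ) : ℂ)) (absConv_complexSeries.2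
      ((absConv_of_nonneg hp zero_le_one).2 (by simpa using hs.summable))) (by simpa using hz)
  -- A zero of T would give p(z) = 1, hence z = 1, but T(1) > 0.
  have hne : ∀ z : ℂ, ‖z‖ ≤ 1 → evalSum (complexSeries T) z ≠ 0 := by
    intro z hz h0
    have h2 : AbsConv (complexSeries T) z := (absConv_complexSeries.2 hT1).of_norm_le (by simpa using hz)
    have h3 : complexSeries T * (1 - X) = 1 - complexSeries p := by
      have := congrArg complexSeries hfac
      simpa [complexSeries] using this
    have h4 := evalSum_mul h2 ((absConv_one z).sub (absConv_X z))
    rw [h3, h0, zero_mul, evalSum_sub (absConv_one z) (hpc z hz), evalSum_one] at h4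
    have h5 : z = 1 := eq_one_of_tsum_mul_pow_eq_one hp hs h1 hz (by
      rw [sub_eq_zero] at h4
      rw [h4]; exact tsum_congr fun k => by rw [coeff_complexSeries])
    rw [h5, ← Complex.ofReal_one, evalSum_complexSeries, Complex.ofReal_eq_zero] at h0
    exact hTpos.ne' h0
  have hU := absConv_inv_of_ne_zero hinv hx hTx hne
  have hUe : evalSum T⁻¹ 1 = (evalSum T 1)⁻¹ := by
    have := evalSum_mul hU hT1
    rw [hinv, evalSum_one] at this
    exact eq_inv_of_mul_eq_one_left this.symm
  have hGU : G = T⁻¹ * mk 1 := by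
    have h2 : (mk 1 : PowerSeries ℝ) * (1 - X) = 1 := mk_one_mul_one_sub_eq_one ℝ
    calc G = G * ((T⁻¹ * T) * (mk 1 * (1 - X))) := by rw [hinv, h2]; ring
      _ = T⁻¹ * mk 1 * (G * (T * (1 - X))) := by ring
      _ = _ := by rw [hfac, hG, mul_one]
  refine ⟨hTpos.ne', ?_⟩
  rw [← hUe]
  have h3 := (hU.hasSum.tendsto_sum_nat).comp (tendsto_add_atTop_nat 1)
  refine h3.congr fun n => ?_
  rw [hGU, coeff_mul_mk_one]
  simp

end Renewal

/-! ### The loss probability -/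

section Loss

open PowerSeries

lemma absConv_tailSeries {p : PowerSeries ℝ} (hp : ∀ k, 0 ≤ coeff k p)
    (hs : HasSum (fun k => coeff k p) 1) {x : ℝ} (hx : 1 < x) (h : AbsConv p x) :
    AbsConv (tailSeries p) x ∧ evalSum (tailSeries p) x * (1 - x) = 1 - evalSum p x := by
  have h1 : AbsConv (tailSeries p) x := by
    rw [absConv_of_nonneg (fun k => by rw [coeff_tailSeries]; exact tail_nonneg hp hs k) (by linarith)]
    simp only [coeff_tailSeries]
    exact summable_tail_mul_pow hp hs hx ((absConv_of_nonneg hp (by linarith)).1 h)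
  refine ⟨h1, ?_⟩
  have h2 := evalSum_mul h1 ((absConv_one x).sub (absConv_X x))
  rwa [tailSeries_mul_one_sub_X, evalSum_sub (absConv_one x) h, evalSum_sub (absConv_one x)
    (absConv_X x), evalSum_one, evalSum_X, eq_comm] at h2

/-- Loss probabilities from the tails of `y`. -/
lemma tendsto_loss_of_scaled {a ρ θ x D : ℝ} {y : ℕ → ℝ} (ha : 0 < a) (hρ : ρ < 1)
    (hy : HasSum y (a / (1 - ρ))) (hx : 1 < x) (h : Tendsto (scaled θ x y) atTop (𝓝 D)) :
    Tendsto (fun N : ℕ => (N : ℝ) ^ (1 - θ) * x ^ N *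
      (1 - (∑ k ∈ Finset.range N, y k) / (a + ρ * ∑ k ∈ Finset.range N, y k))) atTop
      (𝓝 ((1 - ρ) ^ 2 * D * x / (a * (x - 1)))) := by
  have hρ' : 0 < 1 - ρ := by linarith
  have hx' : 0 < x - 1 := by linarith
  have h1 := tendsto_scaled_tsum hx h
  have h2 : Tendsto (fun N : ℕ => ((N : ℝ) / (N + 1)) ^ (1 - θ)) atTop (𝓝 1) := by
    simpa using (tendsto_natCast_div_add_atTop (1 : ℝ)).rpow_const (p := 1 - θ) (Or.inl one_ne_zero)
  have h3 : Tendsto (fun N : ℕ => a + ρ * ∑ k ∈ Finset.range N, y k) atTop (𝓝 (a / (1 - ρ))) := by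
    have := (hy.tendsto_sum_nat.const_mul ρ).const_add a
    convert! this using 2
    field_simp; ring
  have h0 : a / (1 - ρ) ≠ 0 := by positivity
  -- With Y the partial sum of y, 1 - Y/(a + ρY) = (1 - ρ)(a/(1 - ρ) - Y)/(a + ρY), and a/(1 - ρ) -
  -- Y is the tail of y from N on.
  have h4 := ((h2.mul h1).const_mul (1 - ρ)).div h3 h0
  convert! h4.congr' ?_ using 2
  · field_simp
  · filter_upwards [h3.eventually_ne h0] with N hN
    have e1 : ∑' i, y (N + i) = a / (1 - ρ) - ∑ k ∈ Finset.range N, y k := by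
      rw [← hy.tsum_eq, ← hy.summable.sum_add_tsum_nat_add N, add_sub_cancel_left]
      simp only [add_comm N]
    have e2 : (N + 1 : ℝ) ^ (1 - θ) ≠ 0 := (Real.rpow_pos_of_pos (by positivity) _).ne'
    simp only [Pi.div_apply, scaled, e1]
    rw [Real.div_rpow (by positivity) (by positivity)]
    field_simp
    ring

variable {lam : ℝ} {ν : Measure ℝ}

lemma coeff_arrivalSeries (lam : ℝ) (ν : Measure ℝ) (k : ℕ) :
    coeff k (arrivalSeries lam ν) = mixedPoisson lam ν k := by rw [arrivalSeries, coeff_mk]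

lemma coeff_arrivalSeries_nonneg (hlam : 0 < lam) (hν : ν (Set.Iio 0) = 0) (k : ℕ) :
    0 ≤ coeff k (arrivalSeries lam ν) := by
  rw [coeff_arrivalSeries]; exact mixedPoisson_nonneg hlam hν k

lemma absConv_arrivalSeries (hlam : 0 < lam) (hν : ν (Set.Iio 0) = 0) {x : ℝ} (hx : 0 ≤ x) :
    AbsConv (arrivalSeries lam ν) x ↔ Summable fun k => mixedPoisson lam ν k * x ^ k := by
  rw [absConv_of_nonneg (coeff_arrivalSeries_nonneg hlam hν) hx]
  simp only [coeff_arrivalSeries]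

lemma evalSum_arrivalSeries_nonneg (hlam : 0 < lam) (hν : ν (Set.Iio 0) = 0) {x : ℝ} (hx : 0 ≤ x) :
    0 ≤ evalSum (arrivalSeries lam ν) x :=
  tsum_nonneg fun k => mul_nonneg (coeff_arrivalSeries_nonneg hlam hν k) (pow_nonneg hx k)

variable [IsProbabilityMeasure ν]

lemma hasSum_coeff_arrivalSeries (hlam : 0 < lam) (hν : ν (Set.Iio 0) = 0) :
    HasSum (fun k => coeff k (arrivalSeries lam ν)) 1 := by
  simp only [coeff_arrivalSeries]; exact hasSum_mixedPoisson hlam hν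

lemma realLst_eq_evalSum (hlam : 0 < lam) (hν : ν (Set.Iio 0) = 0) {x : ℝ} (hx : 0 ≤ x)
    (h : AbsConv (arrivalSeries lam ν) x) :
    realLst ν (lam - lam * x) = ENNReal.ofReal (evalSum (arrivalSeries lam ν) x) := by
  rw [absConv_arrivalSeries hlam hν hx] at h
  rw [← tsum_mixedPoisson_mul_pow hlam hν hx, evalSum, ENNReal.ofReal_tsum_of_nonneg]
  · simp only [coeff_arrivalSeries]
  · exact fun k => mul_nonneg (coeff_arrivalSeries_nonneg hlam hν k) (pow_nonneg hx k)
  · simpa only [coeff_arrivalSeries] using h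

lemma toReal_realLst (hlam : 0 < lam) (hν : ν (Set.Iio 0) = 0) {x : ℝ} (hx : 0 ≤ x)
    (h : AbsConv (arrivalSeries lam ν) x) :
    (realLst ν (lam - lam * x)).toReal = evalSum (arrivalSeries lam ν) x := by
  rw [realLst_eq_evalSum hlam hν hx h, ENNReal.toReal_ofReal (evalSum_arrivalSeries_nonneg hlam hν hx)]

lemma absConv_tailSeries_one (hlam : 0 < lam) (hν : ν (Set.Iio 0) = 0)
    (hi : Integrable (fun t : ℝ => t) ν) :
    AbsConv (tailSeries (arrivalSeries lam ν)) 1 ∧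
      evalSum (tailSeries (arrivalSeries lam ν)) 1 = lam * ∫ t, t ∂ν := by
  have h : HasSum (fun k => coeff k (tailSeries (arrivalSeries lam ν)) * 1 ^ k)
      (lam * ∫ t, t ∂ν) := by
    simp only [coeff_tailSeries, coeff_arrivalSeries, one_pow, mul_one]
    exact hasSum_tail_mixedPoisson hlam hν hi
  exact ⟨(absConv_of_nonneg (coeff_tailSeries_arrivalSeries_nonneg hlam hν) zero_le_one).2 h.summable,
    h.tsum_eq⟩

/-- The generating function of the mean numbers of services in a cycle, differenced in `N`. -/
noncomputable def cycleSeries (f g : PowerSeries ℝ) : PowerSeries ℝ :=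
  tailSeries g * (f * renewalSeries f)

lemma cycleServices_eq_sum (f g : PowerSeries ℝ) {N : ℕ} (hN : 1 ≤ N) :
    cycleServices f g N = ∑ k ∈ Finset.range N, coeff k (cycleSeries f g) := by
  obtain ⟨n, rfl⟩ := Nat.exists_eq_add_of_le' hN
  rw [cycleServices, descentSeries, Nat.add_sub_cancel, ← mul_assoc, coeff_mul_mk_one]
  rfl

variable {σ υ : Measure ℝ} [IsProbabilityMeasure σ] [IsProbabilityMeasure υ]

/-- Evaluation at 1, where T_g = λE[V], f = 1 and R = 1/(1 - ρ). The sum is the limit of the mean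
number of services in a cycle as the capacity grows. -/
lemma hasSum_cycleSeries (hlam : 0 < lam) (hσ : σ (Set.Iio 0) = 0) (hυ : υ (Set.Iio 0) = 0)
    (hσi : Integrable (fun t : ℝ => t) σ) (hυi : Integrable (fun t : ℝ => t) υ)
    (hρ : lam * ∫ t, t ∂σ < 1) :
    HasSum (fun k => coeff k (cycleSeries (arrivalSeries lam σ) (arrivalSeries lam υ)))
      (lam * (∫ t, t ∂υ) / (1 - lam * ∫ t, t ∂σ)) := by
  obtain ⟨h1, h2⟩ := absConv_tailSeries_one hlam hσ hσi
  obtain ⟨h3, h4⟩ := absConv_tailSeries_one hlam hυ hυi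
  obtain ⟨h5, h6⟩ := absConv_renewalSeries (coeff_zero_arrivalSeries_pos hlam hσ)
    (coeff_tailSeries_arrivalSeries_nonneg hlam hσ) zero_le_one h1 (by rwa [h2])
  have h7 : HasSum (fun k => coeff k (arrivalSeries lam σ) * 1 ^ k) 1 := by
    simpa using hasSum_coeff_arrivalSeries hlam hσ
  have h8 : AbsConv (arrivalSeries lam σ) 1 :=
    (absConv_of_nonneg (coeff_arrivalSeries_nonneg hlam hσ) zero_le_one).2 h7.summable
  have h9 := (h3.mul (h8.mul h5)).hasSum
  rw [evalSum_mul h3 (h8.mul h5), evalSum_mul h8 h5, h4, h6, h2,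
    show evalSum (arrivalSeries lam σ) 1 = 1 from h7.tsum_eq, one_mul, mul_one_div] at h9
  simpa [cycleSeries] using h9

/-- For x > 1 the condition f(x) < x is the same as T_f(x) < 1, and then R(x) = (x - 1)/(x - f(x)).
-/
lemma absConv_mul_renewalSeries (hlam : 0 < lam) (hσ : σ (Set.Iio 0) = 0) {x : ℝ} (hx : 1 < x)
    (h : AbsConv (arrivalSeries lam σ) x) (hlt : evalSum (arrivalSeries lam σ) x < x) :
    AbsConv (arrivalSeries lam σ * renewalSeries (arrivalSeries lam σ)) x ∧
      evalSum (arrivalSeries lam σ * renewalSeries (arrivalSeries lam σ)) x =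
        evalSum (arrivalSeries lam σ) x * (x - 1) / (x - evalSum (arrivalSeries lam σ) x) := by
  obtain ⟨h1, h2⟩ := absConv_tailSeries (coeff_arrivalSeries_nonneg hlam hσ)
    (hasSum_coeff_arrivalSeries hlam hσ) hx h
  have h3 : evalSum (tailSeries (arrivalSeries lam σ)) x < 1 := by nlinarith
  obtain ⟨h5, h6⟩ := absConv_renewalSeries (coeff_zero_arrivalSeries_pos hlam hσ)
    (coeff_tailSeries_arrivalSeries_nonneg hlam hσ) (by linarith) h1 h3
  refine ⟨h.mul h5, ?_⟩
  rw [evalSum_mul h h5, h6, mul_one_div, div_eq_div_iff (by linarith) (by linarith)]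
  linear_combination -evalSum (arrivalSeries lam σ) x * h2

/-- Heavy vacations: the coefficients of `cycleSeries` inherit the order of those of the number of
arrivals in a vacation. -/
lemma tendsto_scaled_cycleSeries {θ r C : ℝ} (hlam : 0 < lam) (hσ : σ (Set.Iio 0) = 0)
    (hυ : υ (Set.Iio 0) = 0) (hr : 1 < r)
    (hv : Tendsto (scaled θ r (mixedPoisson lam υ)) atTop (𝓝 C))
    (h : AbsConv (arrivalSeries lam σ) r) (hlt : evalSum (arrivalSeries lam σ) r < r)
    (hθ : θ < 1 → ∃ w, r < w ∧ AbsConv (arrivalSeries lam σ) w) :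
    Tendsto (scaled θ r fun k => coeff k (cycleSeries (arrivalSeries lam σ) (arrivalSeries lam υ)))
      atTop (𝓝 (C * evalSum (arrivalSeries lam σ) r / (r - evalSum (arrivalSeries lam σ) r))) := by
  have hr0 : 0 < r := by linarith
  obtain ⟨h1, h2⟩ := absConv_mul_renewalSeries hlam hσ hr h hlt
  have hsum : Summable fun j : ℕ => (j + 1 : ℝ) ^ max (1 - θ) 0 *
      |coeff j (arrivalSeries lam σ * renewalSeries (arrivalSeries lam σ)) * r ^ j| := by
    rcases lt_or_ge θ 1 with hθ1 | hθ1
    -- For θ < 1 the weighted sum is obtained from absolute convergence slightly beyond r; by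
    -- continuity f(x) < x persists at some x > r.
    · obtain ⟨w, hrw, hw⟩ := hθ hθ1
      have hcont : ContinuousAt (evalSum (arrivalSeries lam σ)) r :=
        hw.continuousOn.continuousAt (by
          refine mem_of_superset (Metric.isOpen_ball.mem_nhds ?_) Metric.ball_subset_closedBall
          rw [mem_ball_zero_iff, Real.norm_of_nonneg hr0.le, Real.norm_of_nonneg (by linarith)]
          exact hrw)
      have hev : ∀ᶠ x in 𝓝[>] r, evalSum (arrivalSeries lam σ) x < x :=
        nhdsWithin_le_nhds (hcont.eventually_lt continuousAt_id hlt)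
      obtain ⟨x, hx1, hx2, hx3⟩ := (hev.and (Ioo_mem_nhdsGT hrw)).exists
      have hx : AbsConv (arrivalSeries lam σ) x := hw.of_norm_le (by
        rw [Real.norm_of_nonneg, Real.norm_of_nonneg] <;> linarith)
      exact summable_rpow_mul_of_lt hr0 hx2 _
        (absConv_mul_renewalSeries hlam hσ (hr.trans hx2) hx hx1).1
    · rw [max_eq_right (by linarith)]
      simp only [Real.rpow_zero, one_mul]
      exact h1
  -- The tail at k starts with the coefficient k + 1: the shift contributes 1/r and the summation
  -- r/(r - 1).
  have hW : Tendsto (scaled θ r fun k => coeff k (tailSeries (arrivalSeries lam υ))) atTop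
      (𝓝 (C / r * (r / (r - 1)))) := by
    refine (tendsto_scaled_tsum hr (tendsto_scaled_shift hr0.ne' hv)).congr fun k => ?_
    simp only [scaled, coeff_tailSeries, coeff_arrivalSeries]
    rw [tail_eq_tsum (hasSum_mixedPoisson hlam hυ)]
    congr 1
    exact tsum_congr fun i => by congr 1; ring
  have h3 := tendsto_scaled_mul hr0 hW hsum
  rw [h2] at h3
  convert! h3 using 2
  have e1 : r - 1 ≠ 0 := by linarith
  have e2 : r - evalSum (arrivalSeries lam σ) r ≠ 0 := by linarith
  field_simp

end Loss

/-! ### The root of `z = S^*(lam - lam z)` -/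

section Root

open PowerSeries

/-- A power series whose sum exceeds `r` at `r` exceeds `x` at some smaller `x`. -/
lemma exists_lt_evalSum {f : PowerSeries ℝ} (hf : ∀ k, 0 ≤ coeff k f) {r : ℝ} (hr : 1 < r)
    (hc : ∀ x, 1 < x → x < r → AbsConv f x)
    (h : ENNReal.ofReal r < ∑' k, ENNReal.ofReal (coeff k f * r ^ k)) :
    ∃ x, 1 < x ∧ x < r ∧ x < evalSum f x := by
  -- Some finite partial sum already exceeds r at r. It is a polynomial, hence continuous, so an
  -- infinite value at r does no harm.
  rw [ENNReal.tsum_eq_iSup_nat, lt_iSup_iff] at h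
  obtain ⟨n, hn⟩ := h
  rw [← ENNReal.ofReal_sum_of_nonneg fun k _ => mul_nonneg (hf k) (pow_nonneg (by linarith) k),
    ENNReal.ofReal_lt_ofReal_iff_of_nonneg (by linarith)] at hn
  have hcont : ContinuousAt (fun x : ℝ => ∑ k ∈ Finset.range n, coeff k f * x ^ k) r := by fun_prop
  have hev : ∀ᶠ x in 𝓝[<] r, x < ∑ k ∈ Finset.range n, coeff k f * x ^ k :=
    nhdsWithin_le_nhds (continuousAt_id.eventually_lt hcont hn)
  obtain ⟨x, hx, hx1, hxr⟩ := (hev.and (Ioo_mem_nhdsLT hr)).exists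
  refine ⟨x, hx1, hxr, hx.trans_le ?_⟩
  exact (hc x hx1 hxr).hasSum.summable.sum_le_tsum _ fun k _ =>
    mul_nonneg (hf k) (pow_nonneg (by linarith) k)

lemma evalSum_lt_evalSum {f : PowerSeries ℝ} (hf : ∀ k, 0 ≤ coeff k f) (h1 : 0 < coeff 1 f)
    {x y : ℝ} (hx : 0 ≤ x) (hxy : x < y) (hy : AbsConv f y) : evalSum f x < evalSum f y := by
  have hxc : AbsConv f x := hy.of_norm_le (by
    rw [Real.norm_of_nonneg hx, Real.norm_of_nonneg (hx.trans hxy.le)]; exact hxy.le)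
  refine Summable.tsum_lt_tsum (i := 1) (fun k => ?_) ?_ hxc.hasSum.summable hy.hasSum.summable
  · exact mul_le_mul_of_nonneg_left (pow_le_pow_left₀ hx hxy.le k) (hf k)
  · simpa using mul_lt_mul_of_pos_left hxy h1

lemma absConv_rescale {f : PowerSeries ℝ} {a x : ℝ} :
    AbsConv (rescale a f) x ↔ AbsConv f (a * x) := by
  unfold AbsConv
  refine summable_congr fun k => ?_
  rw [coeff_rescale, mul_pow]; ring_nf

lemma evalSum_rescale (f : PowerSeries ℝ) (a x : ℝ) :
    evalSum (rescale a f) x = evalSum f (a * x) := by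
  unfold evalSum
  refine tsum_congr fun k => ?_
  rw [coeff_rescale, mul_pow]; ring

variable {f : PowerSeries ℝ} {ρ r : ℝ}

lemma evalSum_tailSeries_eq_one_iff (hf : ∀ k, 0 ≤ coeff k f) (hs : HasSum (fun k => coeff k f) 1)
    {x : ℝ} (hx : 1 < x) (h : AbsConv f x) :
    evalSum (tailSeries f) x = 1 ↔ evalSum f x = x := by
  obtain ⟨-, h2⟩ := absConv_tailSeries hf hs hx h
  constructor
  · intro h3; rw [h3] at h2; linarith
  · intro h3
    rw [h3] at h2
    have : (evalSum (tailSeries f) x - 1) * (1 - x) = 0 := by linarith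
    rcases mul_eq_zero.1 this with h4 | h4 <;> linarith

/-- If two or more arrivals had probability 0, T_f would be a constant below 1, and then f(x) < x
for every x > 1. -/
lemma coeff_one_tailSeries_pos (hf : ∀ k, 0 ≤ coeff k f) (hs : HasSum (fun k => coeff k f) 1)
    (h2 : evalSum (tailSeries f) 1 < 1) {x : ℝ} (hx : 1 < x)
    (hc : AbsConv f x) (hlt : x < evalSum f x) : 0 < coeff 1 (tailSeries f) := by
  have hnn : ∀ k, 0 ≤ coeff k (tailSeries f) := fun k => by
    rw [coeff_tailSeries]; exact tail_nonneg hf hs k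
  by_contra hcon
  have h0 : ∀ k, coeff (k + 1) (tailSeries f) = 0 := fun k => by
    refine le_antisymm (le_trans ?_ (not_lt.1 hcon)) (hnn _)
    rw [coeff_tailSeries, coeff_tailSeries]
    have := Finset.sum_le_sum_of_subset_of_nonneg (f := fun k => coeff k f)
      (Finset.range_mono (by omega : 1 + 1 ≤ k + 1 + 1)) fun i _ _ => hf i
    linarith
  have hconst : ∀ y, evalSum (tailSeries f) y = coeff 0 (tailSeries f) := fun y => by
    unfold evalSum
    rw [tsum_eq_single 0 fun k hk => by
      obtain ⟨j, rfl⟩ := Nat.exists_eq_succ_of_ne_zero hk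
      rw [Nat.succ_eq_add_one, h0, zero_mul]]
    simp
  obtain ⟨-, h3⟩ := absConv_tailSeries hf hs hx hc
  rw [hconst] at h2 h3
  nlinarith

/-- Existence and uniqueness of the root. -/
lemma exists_unique_root (hf : ∀ k, 0 ≤ coeff k f) (hs : HasSum (fun k => coeff k f) 1)
    (h2 : evalSum (tailSeries f) 1 < 1) (hr : 1 < r)
    (hc : ∀ x, 1 < x → x < r → AbsConv f x)
    (h : ENNReal.ofReal r < ∑' k, ENNReal.ofReal (coeff k f * r ^ k)) :
    0 < coeff 1 (tailSeries f) ∧ ∃ z, 1 < z ∧ z < r ∧ evalSum f z = z ∧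
      ∀ x, 1 < x → x < r → evalSum f x = x → x = z := by
  have hnn : ∀ k, 0 ≤ coeff k (tailSeries f) := fun k => by
    rw [coeff_tailSeries]; exact tail_nonneg hf hs k
  obtain ⟨x, hx1, hxr, hx⟩ := exists_lt_evalSum hf hr hc h
  have hpos := coeff_one_tailSeries_pos hf hs h2 hx1 (hc x hx1 hxr) hx
  refine ⟨hpos, ?_⟩
  obtain ⟨h3, h4⟩ := absConv_tailSeries hf hs hx1 (hc x hx1 hxr)
  have h5 : 1 < evalSum (tailSeries f) x := by nlinarith
  -- For x > 1 the equation f(x) = x is T_f(x) = 1, with the trivial root at 1 divided out. T_f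
  -- increases strictly from a value below 1 at 1 to a value above 1 at x, so it takes the value 1
  -- exactly once.
  have hcont : ContinuousOn (evalSum (tailSeries f)) (Set.Icc 1 x) :=
    h3.continuousOn.mono fun y hy => by
      rw [mem_closedBall_zero_iff, Real.norm_of_nonneg (by linarith [hy.1]),
        Real.norm_of_nonneg (by linarith)]
      exact hy.2
  obtain ⟨z, ⟨hz1, hzx⟩, hz⟩ := intermediate_value_Ioo hx1.le hcont ⟨h2, h5⟩
  have hzr : z < r := hzx.trans hxr
  refine ⟨z, hz1, hzr, (evalSum_tailSeries_eq_one_iff hf hs hz1 (hc z hz1 hzr)).1 hz, ?_⟩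
  intro y hy1 hyr hy
  rw [← evalSum_tailSeries_eq_one_iff hf hs hy1 (hc y hy1 hyr)] at hy
  rcases lt_trichotomy y z with hlt | heq | hgt
  · have := evalSum_lt_evalSum hnn hpos (by linarith) hlt
      (absConv_tailSeries hf hs hz1 (hc z hz1 hzr)).1
    linarith
  · exact heq
  · have := evalSum_lt_evalSum hnn hpos (by linarith) hgt
      (absConv_tailSeries hf hs hy1 (hc y hy1 hyr)).1
    linarith

/-- The order of the renewal sequence, and the derivative at the root. -/
lemma exists_tendsto_scaled_renewalSeries (hf : ∀ k, 0 ≤ coeff k f)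
    (hs : HasSum (fun k => coeff k f) 1) (hf0 : 0 < coeff 0 f) (hpos : 0 < coeff 1 (tailSeries f))
    {z w : ℝ} (hz : 1 < z) (hzw : z < w) (hw : AbsConv f w) (hroot : evalSum f z = z) :
    ∃ q : ℝ, q ≠ 0 ∧ HasDerivAt (evalSum f) (1 + q * (z - 1) / z) z ∧
      Tendsto (scaled 1 z fun k => coeff k (renewalSeries f)) atTop (𝓝 q⁻¹) := by
  have hnn : ∀ k, 0 ≤ coeff k (tailSeries f) := fun k => by
    rw [coeff_tailSeries]; exact tail_nonneg hf hs k
  have hz0 : 0 < z := by linarith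
  have hconv : ∀ x, 1 < x → x ≤ w → AbsConv f x := fun x hx hxw => hw.of_norm_le (by
    rw [Real.norm_of_nonneg, Real.norm_of_nonneg] <;> linarith)
  have htw := (absConv_tailSeries hf hs (by linarith) hw).1
  obtain ⟨htz, -⟩ := absConv_tailSeries hf hs hz (hconv z hz hzw.le)
  -- Exponential tilting: since T_f(z) = 1, the coefficients of T_f times z^k form a probability
  -- distribution. It has an exponential moment because w > z, and its renewal sequence is z^k times
  -- that of f.
  set p := rescale z (tailSeries f) with hp
  have hpnn : ∀ k, 0 ≤ coeff k p := fun k => by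
    rw [hp, coeff_rescale]; exact mul_nonneg (by positivity) (hnn k)
  have hps : HasSum (fun k => coeff k p) 1 := by
    have := htz.hasSum
    rw [(evalSum_tailSeries_eq_one_iff hf hs hz (hconv z hz hzw.le)).2 hroot] at this
    convert! this using 1
    ext k
    rw [hp, coeff_rescale, mul_comm]
  have hp1 : 0 < coeff 1 p := by rw [hp, coeff_rescale]; positivity
  have hwz : 1 < w / z := by rwa [one_lt_div hz0]
  have hpw : AbsConv p (w / z) := by
    rw [hp, absConv_rescale, mul_div_cancel₀ _ hz0.ne']; exact htw
  have hG : rescale z (renewalSeries f) * (1 - p) = 1 := by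
    have := congrArg (rescale z) (renewalSeries_mul hf0.ne')
    simpa using this
  obtain ⟨hq, hlim⟩ := tendsto_coeff_renewal hpnn hps hp1 hwz
    ((absConv_of_nonneg hpnn (by linarith)).1 hpw) hG
  refine ⟨evalSum (tailSeries p) 1, hq, ?_, ?_⟩
  -- Applying the tail identity to f and then to p gives the exact difference quotient (f(x) -
  -- f(z))/(x - z) = 1 + T_p(x/z)(x - 1)/z. Letting x → z identifies the derivative through the
  -- renewal constant q = T_p(1).
  · obtain ⟨hTw, -⟩ := absConv_tailSeries hpnn hps hwz hpw
    have hcont : ContinuousAt (evalSum (tailSeries p)) 1 := hTw.continuousOn.continuousAt (by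
      refine mem_of_superset (Metric.isOpen_ball.mem_nhds ?_) Metric.ball_subset_closedBall
      rw [mem_ball_zero_iff, norm_one, Real.norm_of_nonneg (by linarith)]
      exact hwz)
    have hcont2 : ContinuousAt (fun x => evalSum (tailSeries p) (x / z)) z := by
      refine ContinuousAt.comp (f := fun x => x / z) (g := evalSum (tailSeries p)) ?_ (by fun_prop)
      rwa [div_self hz0.ne']
    have hlim2 : Tendsto (fun x => 1 + evalSum (tailSeries p) (x / z) * (x - 1) / z) (𝓝[≠] z)
        (𝓝 (1 + evalSum (tailSeries p) 1 * (z - 1) / z)) := by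
      have : ContinuousAt (fun x => 1 + evalSum (tailSeries p) (x / z) * (x - 1) / z) z := by
        fun_prop (disch := exact hz0.ne')
      have h := this.tendsto
      rw [div_self hz0.ne'] at h
      exact h.mono_left nhdsWithin_le_nhds
    rw [hasDerivAt_iff_tendsto_slope]
    refine hlim2.congr' ?_
    have hmem : ∀ᶠ x in 𝓝[≠] z, x ∈ Set.Ioo 1 w := nhdsWithin_le_nhds (Ioo_mem_nhds hz hzw)
    filter_upwards [hmem, self_mem_nhdsWithin] with x ⟨hx1, hxw⟩ hxz
    obtain ⟨htx, h5⟩ := absConv_tailSeries hf hs hx1 (hconv x hx1 hxw.le)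
    have hpx : AbsConv p (x / z) := by rwa [hp, absConv_rescale, mul_div_cancel₀ _ hz0.ne']
    have hTx : AbsConv (tailSeries p) (x / z) := hTw.of_norm_le (by
      rw [Real.norm_of_nonneg (by positivity), Real.norm_of_nonneg (by linarith)]; gcongr)
    have h6 := evalSum_mul hTx ((absConv_one _).sub (absConv_X _))
    rw [tailSeries_mul_one_sub_X, evalSum_sub (absConv_one _) hpx, evalSum_sub (absConv_one _)
      (absConv_X _), evalSum_one, evalSum_X, hp, evalSum_rescale, ← hp,
      mul_div_cancel₀ _ hz0.ne'] at h6
    have hxz' : x - z ≠ 0 := sub_ne_zero.2 hxz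
    rw [slope_def_field, hroot, eq_div_iff hxz']
    have h7 : evalSum f x = 1 - (1 - evalSum (tailSeries p) (x / z) * (1 - x / z)) * (1 - x) := by
      rw [← h6]; linarith
    rw [h7]
    field_simp
    ring
  · refine hlim.congr fun n => ?_
    rw [scaled, coeff_rescale]
    simp

end Root

/-! ### The theorem -/

section Main

open PowerSeries

variable {lam : ℝ} {σ υ : Measure ℝ} [IsProbabilityMeasure σ] [IsProbabilityMeasure υ]

/-- The loss probability of the system of capacity `N`, for `1 ≤ N`. -/
noncomputable def lossProb (lam : ℝ) (σ υ : Measure ℝ) (N : ℕ) : ℝ :=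
  1 - (∑ k ∈ Finset.range N, coeff k (cycleSeries (arrivalSeries lam σ) (arrivalSeries lam υ))) /
    (lam * (∫ t, t ∂υ) + lam * (∫ t, t ∂σ) * ∑ k ∈ Finset.range N,
      coeff k (cycleSeries (arrivalSeries lam σ) (arrivalSeries lam υ)))

lemma isLossProbability_lossProb {Ω : Type*} [MeasurableSpace Ω] {P : Measure Ω}
    [IsProbabilityMeasure P] (hlam : 0 < lam) (hσ : σ (Set.Iio 0) = 0) (hυ : υ (Set.Iio 0) = 0)
    (hσi : Integrable (fun t : ℝ => t) σ) (hυi : Integrable (fun t : ℝ => t) υ)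
    (hυpos : 0 < ∫ t, t ∂υ) {A S V : ℕ → Ω → ℝ} (hin : IsQueueInput P lam σ υ A S V) {N : ℕ}
    (hN : 1 ≤ N) : IsLossProbability P A S V N (lossProb lam σ υ N) := by
  have h := isLossProbability_of_isMeanServices N hin hlam hN hσ hυ hσi hυi hυpos
    (isMeanServices_descentSeries hlam hσ hυ hυi hυpos hN)
  rwa [cycleServices_eq_sum _ _ hN] at h

lemma tendsto_lossProb_of_isEquivalent (hlam : 0 < lam) (hσ : σ (Set.Iio 0) = 0)
    (hυ : υ (Set.Iio 0) = 0) (hσi : Integrable (fun t : ℝ => t) σ)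
    (hυi : Integrable (fun t : ℝ => t) υ) (hυpos : 0 < ∫ t, t ∂υ) (hρ : lam * ∫ t, t ∂σ < 1)
    {r : ℝ} (hr : 1 < r) (hlt : realLst σ (lam - lam * r) < ENNReal.ofReal r)
    {θ c β rhat : ℝ} {g : ℂ → ℂ} (hθ : 0 < θ)
    (hθ1 : θ < 1 → (r : EReal) < leftmostSingularity lam σ)
    (h0 : 0 < β) (h1 : β < Real.pi / 2) (hrr : r < rhat)
    (hg : DifferentiableOn ℂ g (deltaDomain r β rhat))
    (hgl : ∀ z ∈ deltaDomain r β rhat, z.re < 1 → g z = lst υ (lam - lam * z))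
    (hgc : g ~[𝓝[deltaDomain r β rhat] (r : ℂ)] (fun z => (c : ℂ) / ((r : ℂ) - z) ^ (θ : ℂ))) :
    Tendsto (fun N : ℕ => (N : ℝ) ^ (1 - θ) * r ^ N * lossProb lam σ υ N) atTop
      (𝓝 (c * (1 - lam * ∫ t, t ∂σ) ^ 2 * (realLst σ (lam - lam * r)).toReal /
        (r ^ (θ - 1) * Real.Gamma θ * lam * (∫ t, t ∂υ) * (r - 1) *
          (r - (realLst σ (lam - lam * r)).toReal)))) := by
  have hr0 : 0 < r := by linarith
  have hball : ∀ z : ℂ, ‖z‖ < r → z ∈ deltaDomain r β rhat := fun z hz => by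
    refine closedBall_diff_subset_deltaDomain h0 h1 hrr hz.le ?_
    rintro rfl; rw [Complex.norm_real] at hz; exact absurd hz (le_abs_self r).not_gt
  have hv := tendsto_scaled_of_isEquivalent hθ h0 h1 hr0 hrr hg hgc fun z hz =>
    hasSum_mixedPoisson_of_differentiableOn hlam hυ (R := r)
      (hg.mono fun w hw => hball w (by simpa using hw)) one_pos le_rfl
      (fun w hw => hgl w (hball w (hw.trans hr)) ((Complex.re_le_norm w).trans_lt hw)) hz
  have hconv : AbsConv (arrivalSeries lam σ) r := (absConv_arrivalSeries hlam hσ hr0.le).2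
    (hasSum_mixedPoisson_mul_pow hlam hσ hr0.le (hlt.trans_le le_top).ne).summable
  rw [toReal_realLst hlam hσ hr0.le hconv]
  rw [realLst_eq_evalSum hlam hσ hr0.le hconv, ENNReal.ofReal_lt_ofReal_iff hr0] at hlt
  have h2 := tendsto_scaled_cycleSeries hlam hσ hυ hr hv hconv hlt fun hθ' => by
    obtain ⟨w, hrw, hw⟩ := EReal.lt_iff_exists_real_btwn.1 (hθ1 hθ')
    have hrw : r < w := by exact_mod_cast hrw
    exact ⟨w, hrw, (absConv_arrivalSeries hlam hσ (by linarith)).2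
      (summable_mixedPoisson_mul_pow hlam hσ (by linarith) hw)⟩
  have h3 := tendsto_loss_of_scaled (mul_pos hlam hυpos) hρ
    (hasSum_cycleSeries hlam hσ hυ hσi hυi hρ) hr h2
  convert! h3 using 2
  set a := evalSum (arrivalSeries lam σ) r
  have e1 : r - 1 ≠ 0 := by linarith
  have e2 : r - a ≠ 0 := by linarith
  have e3 : Real.Gamma θ ≠ 0 := (Real.Gamma_pos_of_pos hθ).ne'
  have e4 : r ^ θ ≠ 0 := (Real.rpow_pos_of_pos hr0 _).ne'
  rw [Real.rpow_sub hr0, Real.rpow_one, Real.rpow_neg hr0.le]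
  field_simp

lemma exists_root_tendsto_lossProb (hlam : 0 < lam) (hσ : σ (Set.Iio 0) = 0)
    (hυ : υ (Set.Iio 0) = 0) (hσi : Integrable (fun t : ℝ => t) σ)
    (hυi : Integrable (fun t : ℝ => t) υ) (hυpos : 0 < ∫ t, t ∂υ) (hρ : lam * ∫ t, t ∂σ < 1)
    {r : ℝ} (hr : 1 < r) (hrσ : (r : EReal) ≤ leftmostSingularity lam σ)
    (hrυ : (r : EReal) ≤ leftmostSingularity lam υ)
    (hlt : ENNReal.ofReal r < realLst σ (lam - lam * r)) :
    ∃ z₁ : ℝ, 1 < z₁ ∧ z₁ < r ∧ ENNReal.ofReal z₁ = realLst σ (lam - lam * z₁) ∧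
      (∀ z : ℝ, 1 < z → z < r → ENNReal.ofReal z = realLst σ (lam - lam * z) → z = z₁) ∧
      Tendsto (fun N : ℕ => z₁ ^ N * lossProb lam σ υ N) atTop
        (𝓝 (z₁ * (1 - lam * ∫ t, t ∂σ) ^ 2 * (1 - (realLst υ (lam - lam * z₁)).toReal) /
          (lam * (∫ t, t ∂υ) * (z₁ - 1) *
            (1 - deriv (fun u : ℝ => (realLst σ (lam - lam * u)).toReal) z₁)))) := by
  have hAconv : ∀ x, 1 < x → x < r → AbsConv (arrivalSeries lam σ) x := fun x hx hxr =>
    (absConv_arrivalSeries hlam hσ (by linarith)).2 (summable_mixedPoisson_mul_pow hlam hσ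
      (by linarith) (lt_of_lt_of_le (by exact_mod_cast hxr) hrσ))
  have hnn := coeff_arrivalSeries_nonneg hlam hσ
  have hs := hasSum_coeff_arrivalSeries hlam hσ
  have hiff : ∀ x, 1 < x → x < r → (ENNReal.ofReal x = realLst σ (lam - lam * x) ↔
      evalSum (arrivalSeries lam σ) x = x) := fun x hx hxr => by
    rw [realLst_eq_evalSum hlam hσ (by linarith) (hAconv x hx hxr), ENNReal.ofReal_eq_ofReal_iff
      (by linarith) (evalSum_arrivalSeries_nonneg hlam hσ (by linarith)), eq_comm]
  obtain ⟨hpos, z, hz1, hzr, hz, huniq⟩ := exists_unique_root hnn hs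
    (by rw [(absConv_tailSeries_one hlam hσ hσi).2]; exact hρ) hr hAconv (by
      simp only [coeff_arrivalSeries]
      rwa [tsum_mixedPoisson_mul_pow hlam hσ (by linarith)])
  have hz0 : 0 < z := by linarith
  obtain ⟨w, hzw, hwr⟩ := exists_between hzr
  obtain ⟨q, hq, hderiv, hlim⟩ := exists_tendsto_scaled_renewalSeries hnn hs
    (coeff_zero_arrivalSeries_pos hlam hσ) hpos hz1 hzw (hAconv w (hz1.trans hzw) hwr) hz
  refine ⟨z, hz1, hzr, (hiff z hz1 hzr).2 hz, fun x hx hxr hxe => huniq x hx hxr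
    ((hiff x hx hxr).1 hxe), ?_⟩
  have hd : deriv (fun u : ℝ => (realLst σ (lam - lam * u)).toReal) z = 1 + q * (z - 1) / z := by
    rw [← hderiv.deriv]
    refine Filter.EventuallyEq.deriv_eq ?_
    filter_upwards [Ioo_mem_nhds hz1 hzr] with x hx
    exact toReal_realLst hlam hσ (by linarith [hx.1]) (hAconv x hx.1 hx.2)
  have hV : AbsConv (arrivalSeries lam υ) z := (absConv_arrivalSeries hlam hυ hz0.le).2
    (summable_mixedPoisson_mul_pow hlam hυ hz0.le (lt_of_lt_of_le (by exact_mod_cast hzr) hrυ))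
  obtain ⟨hW, hWe⟩ := absConv_tailSeries (coeff_arrivalSeries_nonneg hlam hυ)
    (hasSum_coeff_arrivalSeries hlam hυ) hz1 hV
  have hA := hAconv z hz1 hzr
  -- Compared with part (i) the roles are exchanged: the renewal series carries the order z^{-k},
  -- with θ = 1 and hence no polynomial factor, and T_g f enters through its value at z.
  have h1 := tendsto_scaled_mul hz0 hlim (g := tailSeries (arrivalSeries lam υ) *
    arrivalSeries lam σ) (by
      simp only [sub_self, max_self, Real.rpow_zero, one_mul]
      exact hW.mul hA)
  rw [show renewalSeries (arrivalSeries lam σ) * (tailSeries (arrivalSeries lam υ) *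
    arrivalSeries lam σ) = cycleSeries (arrivalSeries lam σ) (arrivalSeries lam υ) by
      rw [cycleSeries]; ring, evalSum_mul hW hA, hz] at h1
  have h2 := tendsto_loss_of_scaled (mul_pos hlam hυpos) hρ
    (hasSum_cycleSeries hlam hσ hυ hσi hυi hρ) hz1 h1
  rw [hd, toReal_realLst hlam hυ hz0.le hV]
  simp only [sub_self, Real.rpow_zero, one_mul] at h2
  convert! h2 using 2
  have e1 : z - 1 ≠ 0 := by linarith
  rw [← hWe]
  field_simp
  ring

end Main

theorem theorem3p1 {Ω : Type*} [MeasurableSpace Ω] (P : Measure Ω) [IsProbabilityMeasure P]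
    (lam : ℝ) (hlam : 0 < lam)
    -- laws of a service time and of a vacation time, on `[0, ∞)` with finite means
    (σ υ : Measure ℝ) [IsProbabilityMeasure σ] [IsProbabilityMeasure υ]
    (hσ : σ (Set.Iio 0) = 0) (hυ : υ (Set.Iio 0) = 0)
    (hσi : Integrable (fun t : ℝ => t) σ) (hυi : Integrable (fun t : ℝ => t) υ)
    (hυpos : 0 < ∫ t, t ∂υ)
    (A S V : ℕ → Ω → ℝ) (hin : IsQueueInput P lam σ υ A S V)
    (ρ : ℝ) (hρ : ρ = lam * ∫ t, t ∂σ) (hρ1 : ρ < 1)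
    (r : ℝ) (hr : (r : EReal) = min (leftmostSingularity lam σ) (leftmostSingularity lam υ))
    (hr1 : 1 < r) :
    ∃ Ploss : ℕ → ℝ,
      (∀ N : ℕ, 1 ≤ N → IsLossProbability P A S V N (Ploss N)) ∧
      -- part (i)
      ((r : EReal) = leftmostSingularity lam υ →
        realLst σ (lam - lam * r) < ENNReal.ofReal r →
        ∀ θ c β rhat : ℝ, ∀ g : ℂ → ℂ, 0 < θ →
          (θ < 1 → leftmostSingularity lam υ < leftmostSingularity lam σ) →
          0 < β → β < Real.pi / 2 → r < rhat →
          DifferentiableOn ℂ g (deltaDomain r β rhat) →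
          (∀ z ∈ deltaDomain r β rhat, z.re < 1 → g z = lst υ (lam - lam * z)) →
          g ~[𝓝[deltaDomain r β rhat] (r : ℂ)] (fun z => (c : ℂ) / ((r : ℂ) - z) ^ (θ : ℂ)) →
          Tendsto (fun N : ℕ => (N : ℝ) ^ (1 - θ) * r ^ N * Ploss N) atTop
            (𝓝 (c * (1 - ρ) ^ 2 * (realLst σ (lam - lam * r)).toReal /
              (r ^ (θ - 1) * Real.Gamma θ * lam * (∫ t, t ∂υ) * (r - 1) *
                (r - (realLst σ (lam - lam * r)).toReal))))) ∧
      -- part (ii)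
      ((r : EReal) = leftmostSingularity lam σ →
        ENNReal.ofReal r < realLst σ (lam - lam * r) →
        ∃ z₁ : ℝ, 1 < z₁ ∧ z₁ < r ∧ ENNReal.ofReal z₁ = realLst σ (lam - lam * z₁) ∧
          (∀ z : ℝ, 1 < z → z < r → ENNReal.ofReal z = realLst σ (lam - lam * z) → z = z₁) ∧
          Tendsto (fun N : ℕ => z₁ ^ N * Ploss N) atTop
            (𝓝 (z₁ * (1 - ρ) ^ 2 * (1 - (realLst υ (lam - lam * z₁)).toReal) /
              (lam * (∫ t, t ∂υ) * (z₁ - 1) *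
                (1 - deriv (fun u : ℝ => (realLst σ (lam - lam * u)).toReal) z₁))))) := by

  subst hρ
  refine ⟨lossProb lam σ υ, fun N hN =>
    isLossProbability_lossProb hlam hσ hυ hσi hυi hυpos hin hN, ?_, ?_⟩
  · intro hrυ hlt θ c β rhat g hθ hθ1 h0 h1 hrr hg hgl hgc
    exact tendsto_lossProb_of_isEquivalent hlam hσ hυ hσi hυi hυpos hρ1 hr1 hlt hθ
      (fun h => by rw [hrυ]; exact hθ1 h) h0 h1 hrr hg hgl hgc
  · intro _ hlt
    exact exists_root_tendsto_lossProb hlam hσ hυ hσi hυi hυpos hρ1 hr1 (hr.le.trans (min_le_left _ _))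
      (hr.le.trans (min_le_right _ _)) hlt
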